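/- Let $T>0$, $\mathbb T^3=\mathbb R^3/\mathbb Z^3$, and consider the viscous Hall-MHD equations on $(0,T)\times\mathbb T^3$, $$\begin{cases}u_t+u\cdot\nabla u-h\cdot\nabla h+\nabla\Pi-\Delta u=0,\\ h_t+u\cdot\nabla h-h\cdot\nabla u+\nabla\times\big[(\nabla\times h)\times h\big]-\Delta h=0,\\ \operatorname{div}u=\operatorname{div}h=0.\end{cases}$$ A weak solution is a pair $u,h\in C_{\rm weak}([0,T];L^2(\mathbb T^3))$ such that $u(t),h(t)$ are divergence-free in the sense of distributions for every $t\in[0,T]$ and, for every divergence-free vector field $\varphi\in C_c^\infty((0,T)\times\mathbb T^3)$, $$\int_0^T\!\!\int_{\mathbb T^3}u\cdot\partial_t\varphi+\sum_{i,j}(u_iu_j-h_ih_j)\,\partial_i\varphi_j+u\cdot\Delta\varphi\,dx\,dt=0,$$ $$\int_0^T\!\!\int_{\mathbb T^3}h\cdot\partial_t\varphi+\sum_{i,j}(u_ih_j-h_iu_j)\,\partial_i\varphi_j+\sum_{i,j}h_ih_j\,\partial_i(\nabla\times\varphi)_j+h\cdot\Delta\varphi\,dx\,dt=0.$$ For $0<s<1$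 let $\|f\|_{B^s_{3,\infty}}=\|f\|_{L^3(\mathbb T^3)}+\sup_{y\neq0}|y|^{-s}\|f(\cdot-y)-f\|_{L^3(\mathbb T^3)}$, and let $f\in L^3(0,T;\underline B^{s}_{3,VMO}(\mathbb T^3))$ mean that $f\in L^3(0,T;L^3(\mathbb T^3))$ and $$\lim_{\varepsilon\to0^+}\frac1{\varepsilon^{s}}\Big(\int_0^T\!\int_{\mathbb T^3}\frac1{|B_\varepsilon(0)|}\int_{B_\varepsilon(0)}|f(x,t)-f(x-y,t)|^3\,dy\,dx\,dt\Big)^{1/3}=0 .$$ Let $(u,h)$ be a weak solution with $u,h\in L^\infty(0,T;L^2(\mathbb T^3))\cap L^2(0,T;H^1(\mathbb T^3))$. 1. If $u\in L^3(0,T;B^{1/3}_{3,\infty}(\mathbb T^3))$ and $h\in L^3(0,T;\underline B^{2/3}_{3,VMO}(\mathbb T^3))$, then the energy equality holds: for every $t\in[0,T]$, $$\frac12\int_{\mathbb T^3}\big(|u(x,t)|^2+|h(x,t)|^2\big)dx+\int_0^t\!\int_{\mathbb T^3}\big(|\nabla u|^2+|\nabla h|^2\big)dx\,ds=\frac12\int_{\mathbb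 T^3}\big(|u(x,0)|^2+|h(x,0)|^2\big)dx .$$ 2. If $h\in L^3(0,T;B^{1/3}_{3,\infty}(\mathbb T^3))$ and $\int_{\mathbb T^3}h(x,0)\,dx=0$, then for every $t\in[0,T]$ the vector potential $H(t)=\operatorname{curl}^{-1}h(t)$ exists (that is, the divergence-free, mean-zero field $H(t)\in L^2(\mathbb T^3)$ with $\nabla\times H(t)=h(t)$ in the sense of distributions), and the magnetic helicity balance holds: for every $t\in[0,T]$, $$\int_{\mathbb T^3}h\cdot H(x,t)\,dx-\int_{\mathbb T^3}h\cdot H(x,0)\,dx+2\int_0^t\!\int_{\mathbb T^3}(\nabla\times h)\cdot h\,dx\,ds=0 .$$ -/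

import Mathlib

open MeasureTheory Set Filter Topology
open scoped ENNReal

namespace HallMHD

/-- Three-dimensional Euclidean space. -/
abbrev E3 := EuclideanSpace ℝ (Fin 3)

/-- `3 × 3` matrices with the Frobenius (Euclidean) norm. -/
abbrev Mat3 := EuclideanSpace ℝ (Fin 3 × Fin 3)

/-- The flat torus `ℝ³ / ℤ³`, with its Lebesgue (probability) measure `volume`. -/
abbrev Torus3 := UnitAddTorus (Fin 3)

/-- The quotient map `ℝ³ → ℝ³ / ℤ³`. -/
def proj (y : E3) : Torus3 := fun i => ((y i : ℝ) : UnitAddCircle)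

/-! ### Classical calculus of smooth functions on the torus -/

/-- The classical partial derivative `∂ᵢ f` of a function on the torus. -/
noncomputable def pderiv (i : Fin 3) (f : Torus3 → ℝ) (x : Torus3) : ℝ :=
  deriv (fun s : ℝ => f (x + proj (s • EuclideanSpace.single i (1 : ℝ)))) 0

/-- The classical divergence of a vector field on the torus. -/
noncomputable def divg (F : Torus3 → E3) (x : Torus3) : ℝ :=
  ∑ i, pderiv i (fun y => F y i) x

/-- The classical curl of a vector field on the torus. -/
noncomputable def curl (F : Torus3 → E3) (x : Torus3) : E3 :=
  !₂[pderiv 1 (fun y => F y 2) x - pderiv 2 (fun y => F y 1) x,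
     pderiv 2 (fun y => F y 0) x - pderiv 0 (fun y => F y 2) x,
     pderiv 0 (fun y => F y 1) x - pderiv 1 (fun y => F y 0) x]

/-- The classical Laplacian of a scalar function on the torus. -/
noncomputable def lapl (f : Torus3 → ℝ) (x : Torus3) : ℝ :=
  ∑ i, pderiv i (pderiv i f) x

/-- Smooth scalar functions on the torus. -/
def SmoothScalar (f : Torus3 → ℝ) : Prop :=
  ContDiff ℝ (⊤ : ℕ∞) (fun y : E3 => f (proj y))

/-- Smooth vector fields on the torus. -/
def SmoothVector (F : Torus3 → E3) : Prop :=
  ContDiff ℝ (⊤ : ℕ∞) (fun y : E3 => F (proj y))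

/-- Divergence-free vector fields of class `C_c^∞((0,T) × 𝕋³)`. -/
structure IsTestField (T : ℝ) (φ : ℝ → Torus3 → E3) : Prop where
  smooth : ContDiff ℝ (⊤ : ℕ∞) (fun z : ℝ × E3 => φ z.1 (proj z.2))
  compactSupport : ∃ a b : ℝ, 0 < a ∧ b < T ∧ ∀ t, t ∉ Icc a b → ∀ x, φ t x = 0
  divFree : ∀ t x, divg (φ t) x = 0

/-! ### Distributional notions -/

/-- `div F = 0` in the sense of distributions. -/
def WeakDivFree (F : Torus3 → E3) : Prop :=
  ∀ ψ : Torus3 → ℝ, SmoothScalar ψ → ∫ x, ∑ i, F x i * pderiv i ψ x = 0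

/-- `G` is the distributional gradient of `F`: `G x (i, j)` is `∂ᵢ Fⱼ`. -/
def IsWeakGradient (F : Torus3 → E3) (G : Torus3 → Mat3) : Prop :=
  ∀ i j : Fin 3, ∀ ψ : Torus3 → ℝ, SmoothScalar ψ →
    ∫ x, F x j * pderiv i ψ x = - ∫ x, G x (i, j) * ψ x

/-- The curl read off from a gradient matrix `G (i, j) = ∂ᵢ Fⱼ`. -/
noncomputable def curlOfGradient (G : Mat3) : E3 :=
  !₂[G (1, 2) - G (2, 1), G (2, 0) - G (0, 2), G (0, 1) - G (1, 0)]

/-- `H = curl⁻¹ h`: the mean-zero, divergence-free vector potential in `L²` of `h`,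
i.e. `curl H = h` in the sense of distributions. -/
structure IsCurlInverse (h H : Torus3 → E3) : Prop where
  memLp : MemLp H 2 volume
  meanZero : ∫ x, H x = 0
  divFree : WeakDivFree H
  curl_eq : ∀ ψ : Torus3 → E3, SmoothVector ψ →
    ∫ x, inner ℝ (H x) (curl ψ x) = ∫ x, inner ℝ (h x) (ψ x)

/-! ### Function spaces on the space-time cylinder -/

/-- The norm of `L^p(0,T)`, for `[0,∞]`-valued functions of time. -/
noncomputable def timeNorm (T : ℝ) (p : ℝ≥0∞) (N : ℝ → ℝ≥0∞) : ℝ≥0∞ :=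
  eLpNorm N p (volume.restrict (Ioo 0 T))

/-- Measurability on `(0,T) × 𝕋³` (up to null sets). -/
def MeasurableOnCylinder {E : Type*} [TopologicalSpace E] (T : ℝ) (f : ℝ → Torus3 → E) : Prop :=
  AEStronglyMeasurable (Function.uncurry f) ((volume.restrict (Ioo 0 T)).prod volume)

/-- `u ∈ L^∞(0,T;L²(𝕋³)) ∩ L²(0,T;H¹(𝕋³))`, with distributional space gradient `Du`. -/
structure InEnergyClass (T : ℝ) (u : ℝ → Torus3 → E3) (Du : ℝ → Torus3 → Mat3) : Prop where
  measurable : MeasurableOnCylinder T u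
  measurable_gradient : MeasurableOnCylinder T Du
  isWeakGradient : ∀ᵐ t ∂(volume.restrict (Ioo 0 T)), IsWeakGradient (u t) (Du t)
  linfty_L2 : timeNorm T ⊤ (fun t => eLpNorm (u t) 2 volume) < ⊤
  L2_gradient : timeNorm T 2 (fun t => eLpNorm (Du t) 2 volume) < ⊤

/-- The homogeneous Besov seminorm of `Ḃ^s_{p,∞}(𝕋³)`:
`sup_{y ≠ 0} |y|^{-s} ‖f(· - y) - f‖_{L^p}`. -/
noncomputable def besovSeminorm (s : ℝ) (p : ℝ≥0∞) (f : Torus3 → E3) : ℝ≥0∞ :=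
  ⨆ (y : E3) (_ : y ≠ 0),
    eLpNorm (fun x => f (x - proj y) - f x) p volume / ENNReal.ofReal (‖y‖ ^ s)

/-- The norm of `B^s_{p,∞}(𝕋³)`. -/
noncomputable def besovNorm (s : ℝ) (p : ℝ≥0∞) (f : Torus3 → E3) : ℝ≥0∞ :=
  eLpNorm f p volume + besovSeminorm s p f

/-- `f ∈ L^r(0,T;B^s_{p,∞}(𝕋³))`. -/
def InLpBesov (T : ℝ) (r : ℝ≥0∞) (s : ℝ) (p : ℝ≥0∞) (f : ℝ → Torus3 → E3) : Prop :=
  MeasurableOnCylinder T f ∧ timeNorm T r (fun t => besovNorm s p (f t)) < ⊤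

/-- `(∫_{𝕋³} ⨍_{B_ε(0)} |f(x) - f(x - y)|^q dy dx)^{1/q}`. -/
noncomputable def meanOscillation (q : ℝ) (ε : ℝ) (f : Torus3 → E3) : ℝ≥0∞ :=
  (∫⁻ x : Torus3, ⨍⁻ y in Metric.ball (0 : E3) ε,
    ‖f x - f (x - proj y)‖ₑ ^ q ∂volume) ^ (1 / q)

/-- The Besov-VMO space `L^r(0,T;B̲^α_{q,VMO}(𝕋³))`. -/
def InLpBesovVMO (T : ℝ) (r : ℝ≥0∞) (α q : ℝ) (f : ℝ → Torus3 → E3) : Prop :=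
  MeasurableOnCylinder T f ∧
  timeNorm T r (fun t => eLpNorm (f t) (ENNReal.ofReal q) volume) < ⊤ ∧
  Tendsto (fun ε : ℝ => timeNorm T r (fun t => meanOscillation q ε (f t)) / ENNReal.ofReal (ε ^ α))
    (𝓝[>] 0) (𝓝 0)

/-- `u ∈ C_weak([0,T];L²(𝕋³))`. -/
structure WeaklyContinuousL2 (T : ℝ) (u : ℝ → Torus3 → E3) : Prop where
  memLp : ∀ t ∈ Icc 0 T, MemLp (u t) 2 volume
  continuous : ∀ g : Torus3 → E3, MemLp g 2 volume →
    ContinuousOn (fun t => ∫ x, inner ℝ (u t x) (g x)) (Icc 0 T)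

/-! ### Weak solutions -/

/-- Weak solutions `(u, h)` on `[0,T] × 𝕋³` of the viscous Hall-MHD equations
`u_t + u·∇u - h·∇h + ∇Π - Δu = 0`, `h_t + u·∇h - h·∇u + curl ((curl h) × h) - Δh = 0`,
`div u = div h = 0`, with initial data `(u 0, h 0)`.
For divergence-free `h`, `curl ((curl h) × h) = curl (div (h ⊗ h))`. -/
structure IsWeakSolution (T : ℝ) (u h : ℝ → Torus3 → E3) : Prop where
  weakCont_u : WeaklyContinuousL2 T u
  weakCont_h : WeaklyContinuousL2 T h
  divFree_u : ∀ t ∈ Icc 0 T, WeakDivFree (u t)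
  divFree_h : ∀ t ∈ Icc 0 T, WeakDivFree (h t)
  momentum : ∀ φ : ℝ → Torus3 → E3, IsTestField T φ →
    ∫ t in Ioo 0 T, ∫ x,
      (inner ℝ (u t x) (deriv (fun s => φ s x) t)
        + ∑ i, ∑ j, (u t x i * u t x j - h t x i * h t x j) * pderiv i (fun y => φ t y j) x
        + ∑ j, u t x j * lapl (fun y => φ t y j) x) = 0
  induction_eq : ∀ φ : ℝ → Torus3 → E3, IsTestField T φ →
    ∫ t in Ioo 0 T, ∫ x,
      (inner ℝ (h t x) (deriv (fun s => φ s x) t)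
        + ∑ i, ∑ j, (u t x i * h t x j - h t x i * u t x j) * pderiv i (fun y => φ t y j) x
        + ∑ i, ∑ j, h t x i * h t x j * pderiv i (fun y => curl (φ t) y j) x
        + ∑ j, h t x j * lapl (fun y => φ t y j) x) = 0

end HallMHD

namespace HallMHD

/-! ### The covering map and the measure of the torus -/

/-! Both balances come from pairing the equations with a mollified copy of the solution and letting
the scale ε tend to 0. Let K denote two successive convolutions with the even kernel `rho ε`. K is
self-adjoint and commutes with derivatives, and sharing its two factors between both sides of a
pairing turns every quadratic expression into one in the once-mollified fields.

The solution is only weakly continuous in time, so it is not an admissible test field. The equations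
are therefore first integrated in time against a fixed smooth divergence-free field
(`IsWeakSolution.momentum_sub`, `IsWeakSolution.induction_sub`), and that field is then taken to be
K u(s) or K h(s) with s = t and s = r. By symmetry of K the mixed terms cancel when the two
identities are added: the increment of ⟨u,Ku⟩ + ⟨h,Kh⟩ over [r,t] is ∫_r^t (G(τ,t) + G(τ,r)) dτ.
Since G is bounded and continuous in its second variable, summing over finer and finer partitions
yields ∫ 2 G(τ,τ) dτ (`sub_eq_integral_diagonal`). No mollification in time is needed.

On the diagonal one mollifier is moved onto the products (`transport_moll`). The trilinear terms of
the smooth mollified fields cancel, the Hall term included (`transport_self`, `transport_antisymm`,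
`transport_curl_self`). What remains is minus the dissipation of the mollified gradients, plus
commutators (ab)^ε − a^ε b^ε paired with derivatives of a mollified field. By the Constantin–E–Titi
identity `commut_eq` these are bounded by cubic mean oscillations over balls of radius ε, with a
factor ε⁻¹ for the transport terms and ε⁻² for the Hall term, whose test field carries one more
derivative. For h, the VMO condition of order 2/3 says exactly that ε⁻² times the oscillation tends
to 0. For u, the Besov condition of order 1/3 only bounds ε⁻¹ times the oscillation by an integrable
function of time; the convergence to 0 at almost every time comes from u(t) ∈ H¹, because increments
are O(|y|) in L² and bounded in L⁶, so that the oscillation is O(ε^{3/2}). Dominated convergence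
concludes (`InEnergyClass.tendsto_lintegral_oscInt`).

For the helicity the test field is K H(s). Since curl K H = K h, the integrand involves only K h(s),
so no regularity of H in time is required, and the Hall term becomes an ordinary transport
commutator of h at cost ε⁻¹; order 1/3 is then enough. The term with u × h tends to ∫ (u × h)·h = 0
because H¹ ⊂ L⁴, and the diffusion produces the pairing of h with its curl.

The potential is H = curl N with −ΔN_j = h_j. The mean of h is conserved, so each equation is
solvable: the gradient of N_j is obtained by a Riesz argument in the closure of smooth gradients,
based on the Poincaré inequality. One has curl H = h because div N is weakly harmonic with mean
zero, hence zero (`exists_isCurlInverse`). -/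

lemma proj_add (y z : E3) : proj (y + z) = proj y + proj z := by
  funext i; simp [proj]

lemma proj_neg (y : E3) : proj (-y) = -proj y := by
  funext i; simp [proj]

lemma proj_sub (y z : E3) : proj (y - z) = proj y - proj z := by
  funext i; simp [proj]

lemma proj_zero : proj 0 = 0 := by
  funext i; simp [proj]

lemma continuous_proj : Continuous proj := by
  refine continuous_pi fun i => ?_
  exact (AddCircle.continuous_mk' 1).comp (PiLp.continuous_apply 2 _ i)

lemma measurable_proj : Measurable proj := continuous_proj.measurable

lemma isOpenMap_proj : IsOpenMap proj := by
  have h1 : IsOpenMap (Pi.map (fun _ : Fin 3 => ((↑) : ℝ → UnitAddCircle))) :=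
    IsOpenMap.piMap (fun i => QuotientAddGroup.isOpenMap_coe)
      (Filter.Eventually.of_forall fun i => QuotientAddGroup.mk_surjective)
  exact h1.comp (PiLp.homeomorph 2 (fun _ : Fin 3 => ℝ)).isOpenMap

lemma proj_surjective : Function.Surjective proj := by
  intro x
  choose y hy using fun i => QuotientAddGroup.mk_surjective (x i)
  exact ⟨WithLp.toLp 2 y, funext fun i => hy i⟩

lemma isQuotientMap_proj : IsQuotientMap proj :=
  isOpenMap_proj.isQuotientMap continuous_proj proj_surjective

lemma measurePreserving_proj (a : Fin 3 → ℝ) :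
    MeasurePreserving proj
      (volume.restrict {y : E3 | ∀ i, y i ∈ Ioc (a i) (a i + 1)}) volume := by
  have h1 := measurePreserving_pi _ _ (fun i : Fin 3 => UnitAddCircle.measurePreserving_mk (a i))
  have h2 : Measure.pi (fun i : Fin 3 => (volume : Measure ℝ).restrict (Ioc (a i) (a i + 1)))
      = (volume : Measure (Fin 3 → ℝ)).restrict (Set.univ.pi fun i => Ioc (a i) (a i + 1)) :=
    (Measure.restrict_pi_pi _ _).symm
  rw [h2] at h1
  have h3 := (EuclideanSpace.volume_preserving_symm_measurableEquiv_toLp (Fin 3)).restrict_preimage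
    (s := Set.univ.pi fun i => Ioc (a i) (a i + 1))
    (MeasurableSet.univ_pi fun i => measurableSet_Ioc)
  have h4 : {y : E3 | ∀ i, y i ∈ Ioc (a i) (a i + 1)} =
      (MeasurableEquiv.toLp 2 (Fin 3 → ℝ)).symm ⁻¹' (Set.univ.pi fun i => Ioc (a i) (a i + 1)) := by
    ext y
    simp
  rw [h4]
  exact h1.comp h3

instance : IsProbabilityMeasure (volume : Measure Torus3) := by
  constructor
  rw [volume_pi, Measure.pi_univ]
  simp

instance : (volume : Measure Torus3).IsNegInvariant :=
  Measure.IsAddHaarMeasure.isNegInvariant_of_regular _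

/-- A ball of radius 1/2 lies in the unit cube around its centre, and a unit cube is a fundamental
domain. This local injectivity lets null sets, integrability and norms pass between ℝ³ and the
torus. -/
lemma map_proj_restrict_ball_le (c : E3) :
    Measure.map proj (volume.restrict (Metric.ball c (1 / 2))) ≤ volume := by
  rw [← (measurePreserving_proj fun i => c i - 1 / 2).map_eq]
  refine Measure.map_mono (Measure.restrict_mono ?_ le_rfl) measurable_proj
  intro y hy i
  have h1 : ‖(y - c) i‖ ≤ ‖y - c‖ := PiLp.norm_apply_le _ i
  rw [Metric.mem_ball, dist_eq_norm] at hy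
  have h2 := abs_lt.1 (lt_of_le_of_lt h1 hy)
  simp only [PiLp.sub_apply] at h2
  constructor <;> linarith [h2.1, h2.2]

/-- A compact set wraps around the torus boundedly often: `n` is the number of balls of radius 1/2
in a finite cover. Needed for kernels and cut-offs whose support exceeds one cell. -/
lemma exists_map_proj_restrict_le {K : Set E3} (hK : IsCompact K) :
    ∃ n : ℕ, Measure.map proj (volume.restrict K) ≤ (n : ℝ≥0∞) • (volume : Measure Torus3) := by
  obtain ⟨s, hs⟩ := hK.elim_finite_subcover (fun c : E3 => Metric.ball c (1 / 2))
    (fun c => Metric.isOpen_ball) (fun y _ => mem_iUnion.2 ⟨y, Metric.mem_ball_self (by norm_num)⟩)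
  suffices h : ∀ s : Finset E3, ∃ n : ℕ,
      Measure.map proj (volume.restrict (⋃ c ∈ s, Metric.ball c (1 / 2)))
        ≤ (n : ℝ≥0∞) • (volume : Measure Torus3) by
    obtain ⟨n, hn⟩ := h s
    exact ⟨n, (Measure.map_mono (Measure.restrict_mono hs le_rfl) measurable_proj).trans hn⟩
  intro s
  classical
  induction s using Finset.induction_on with
  | empty => exact ⟨0, by simp⟩
  | insert c s _ ih =>
    obtain ⟨n, hn⟩ := ih
    refine ⟨n + 1, ?_⟩
    rw [Finset.set_biUnion_insert]
    refine (Measure.map_mono (Measure.restrict_union_le _ _) measurable_proj).trans ?_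
    rw [Measure.map_add _ _ measurable_proj]
    refine (add_le_add (map_proj_restrict_ball_le c) hn).trans ?_
    rw [Nat.cast_add, add_smul, Nat.cast_one, one_smul, add_comm]

lemma quasiMeasurePreserving_proj : Measure.QuasiMeasurePreserving proj volume volume := by
  refine ⟨measurable_proj, Measure.AbsolutelyContinuous.mk fun s hs h0 => ?_⟩
  rw [Measure.map_apply measurable_proj hs]
  refine measure_null_of_locally_null _ fun y _ =>
    ⟨_, inter_mem_nhdsWithin _ (Metric.ball_mem_nhds y (by norm_num : (0 : ℝ) < 1 / 2)), ?_⟩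
  have h1 := (map_proj_restrict_ball_le y) s
  rw [h0, Measure.map_apply measurable_proj hs, Measure.restrict_apply (measurable_proj hs)] at h1
  exact le_antisymm h1 bot_le

lemma locallyIntegrable_comp_proj {f : Torus3 → ℝ} (hf : Integrable f) :
    LocallyIntegrable (fun y : E3 => f (proj y)) := by
  intro c
  refine ⟨_, Metric.ball_mem_nhds c (by norm_num : (0 : ℝ) < 1 / 2), ?_⟩
  exact (hf.mono_measure (map_proj_restrict_ball_le c)).comp_measurable measurable_proj

lemma measurePreserving_sub_proj (y : E3) :
    MeasurePreserving (fun x : Torus3 => x - proj y) volume volume :=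
  measurePreserving_sub_right volume (proj y)

/-! ### Smooth functions -/

lemma continuous_of_comp_proj {α : Type*} [TopologicalSpace α] {f : Torus3 → α}
    (hf : Continuous fun y => f (proj y)) : Continuous f :=
  isQuotientMap_proj.continuous_iff.2 hf

namespace SmoothScalar

variable {f g : Torus3 → ℝ}

lemma continuous (hf : SmoothScalar f) : Continuous f :=
  continuous_of_comp_proj (ContDiff.continuous hf)

lemma const (c : ℝ) : SmoothScalar fun _ => c := contDiff_const

lemma add (hf : SmoothScalar f) (hg : SmoothScalar g) : SmoothScalar fun x => f x + g x :=
  ContDiff.add hf hg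

lemma sub (hf : SmoothScalar f) (hg : SmoothScalar g) : SmoothScalar fun x => f x - g x :=
  ContDiff.sub hf hg

lemma mul (hf : SmoothScalar f) (hg : SmoothScalar g) : SmoothScalar fun x => f x * g x :=
  ContDiff.mul hf hg

lemma sum {ι : Type*} {s : Finset ι} {F : ι → Torus3 → ℝ} (h : ∀ i ∈ s, SmoothScalar (F i)) :
    SmoothScalar fun x => ∑ i ∈ s, F i x := ContDiff.sum h

lemma integrable (hf : SmoothScalar f) : Integrable f := by
  have := hf.continuous.continuousOn.integrableOn_compact (μ := volume) isCompact_univ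
  rwa [integrableOn_univ] at this

lemma hasDerivAt (hf : SmoothScalar f) (i : Fin 3) (y : E3) (s : ℝ) :
    HasDerivAt (fun s : ℝ => f (proj y + proj (s • EuclideanSpace.single i (1 : ℝ))))
      (fderiv ℝ (fun z : E3 => f (proj z)) (y + s • EuclideanSpace.single i (1 : ℝ))
        (EuclideanSpace.single i 1)) s := by
  have h1 : HasFDerivAt (fun z : E3 => f (proj z)) _ (y + s • EuclideanSpace.single i (1 : ℝ)) :=
    (ContDiff.differentiable hf (by simp)).differentiableAt.hasFDerivAt
  have h2 : HasDerivAt (fun s : ℝ => y + s • EuclideanSpace.single i (1 : ℝ))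
      (EuclideanSpace.single i (1 : ℝ)) s := by
    simpa using ((hasDerivAt_id s).smul_const (EuclideanSpace.single i (1 : ℝ))).const_add y
  have h3 := h1.comp_hasDerivAt s h2
  simpa only [Function.comp_def, proj_add] using h3

lemma pderiv_proj (hf : SmoothScalar f) (i : Fin 3) (y : E3) :
    pderiv i f (proj y) =
      fderiv ℝ (fun z : E3 => f (proj z)) y (EuclideanSpace.single i 1) := by
  have := (hf.hasDerivAt i y 0).deriv
  simpa [pderiv] using this

lemma pderiv (hf : SmoothScalar f) (i : Fin 3) : SmoothScalar (pderiv i f) := by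
  unfold SmoothScalar
  simp_rw [hf.pderiv_proj i]
  have h : ContDiff ℝ (⊤ : ℕ∞) (fderiv ℝ fun z : E3 => f (proj z)) :=
    ContDiff.fderiv_right hf (by simp)
  exact h.clm_apply contDiff_const

lemma hasDerivAt_pderiv (hf : SmoothScalar f) (i : Fin 3) (x : Torus3) (s : ℝ) :
    HasDerivAt (fun s : ℝ => f (x + proj (s • EuclideanSpace.single i (1 : ℝ))))
      (HallMHD.pderiv i f (x + proj (s • EuclideanSpace.single i (1 : ℝ)))) s := by
  obtain ⟨y, rfl⟩ := proj_surjective x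
  rw [← proj_add, hf.pderiv_proj]
  exact hf.hasDerivAt i y s

lemma hasDerivAt_zero (hf : SmoothScalar f) (i : Fin 3) (x : Torus3) :
    HasDerivAt (fun s : ℝ => f (x + proj (s • EuclideanSpace.single i (1 : ℝ))))
      (HallMHD.pderiv i f x) 0 := by
  simpa [proj_zero] using hf.hasDerivAt_pderiv i x 0

end SmoothScalar

/-! ### Calculus rules, integration by parts and testing on the torus. -/

section pderiv

variable {f g : Torus3 → ℝ}

lemma pderiv_const (i : Fin 3) (c : ℝ) : pderiv i (fun _ => c) = fun _ => 0 := by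
  funext x; simp [pderiv]

lemma pderiv_add (hf : SmoothScalar f) (hg : SmoothScalar g) (i : Fin 3) :
    pderiv i (fun x => f x + g x) = fun x => pderiv i f x + pderiv i g x :=
  funext fun x => ((hf.hasDerivAt_zero i x).add (hg.hasDerivAt_zero i x)).deriv

lemma pderiv_sub (hf : SmoothScalar f) (hg : SmoothScalar g) (i : Fin 3) :
    pderiv i (fun x => f x - g x) = fun x => pderiv i f x - pderiv i g x :=
  funext fun x => ((hf.hasDerivAt_zero i x).sub (hg.hasDerivAt_zero i x)).deriv

lemma pderiv_const_mul (c : ℝ) (f : Torus3 → ℝ) (i : Fin 3) :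
    pderiv i (fun x => c * f x) = fun x => c * pderiv i f x := by
  funext x; simp [pderiv]

lemma pderiv_mul (hf : SmoothScalar f) (hg : SmoothScalar g) (i : Fin 3) :
    pderiv i (fun x => f x * g x) = fun x => pderiv i f x * g x + f x * pderiv i g x := by
  funext x
  have := ((hf.hasDerivAt_zero i x).fun_mul (hg.hasDerivAt_zero i x)).deriv
  simpa [pderiv, proj_zero] using this

lemma pderiv_sum {ι : Type*} {s : Finset ι} {F : ι → Torus3 → ℝ}
    (h : ∀ i ∈ s, SmoothScalar (F i)) (k : Fin 3) :
    pderiv k (fun x => ∑ i ∈ s, F i x) = fun x => ∑ i ∈ s, pderiv k (F i) x := by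
  funext x
  exact (HasDerivAt.fun_sum fun i hi => (h i hi).hasDerivAt_zero k x).deriv

lemma pderiv_comm (hf : SmoothScalar f) (i j : Fin 3) :
    pderiv i (pderiv j f) = pderiv j (pderiv i f) := by
  funext x
  obtain ⟨y, rfl⟩ := proj_surjective x
  have hf2 : ContDiff ℝ 2 (fun z : E3 => f (proj z)) := contDiff_infty.1 hf 2
  have hd : Differentiable ℝ (fderiv ℝ fun z : E3 => f (proj z)) :=
    (hf2.fderiv_right (m := 1) (by norm_num)).differentiable (by simp)
  have key : ∀ i j : Fin 3, pderiv i (pderiv j f) (proj y) =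
      fderiv ℝ (fderiv ℝ fun z : E3 => f (proj z)) y (EuclideanSpace.single i 1)
        (EuclideanSpace.single j 1) := by
    intro i j
    rw [(hf.pderiv j).pderiv_proj]
    simp_rw [hf.pderiv_proj j]
    rw [fderiv_clm_apply hd.differentiableAt (differentiableAt_const _)]
    simp
  rw [key, key]
  have hs : IsSymmSndFDerivAt ℝ (fun z : E3 => f (proj z)) y :=
    hf2.contDiffAt.isSymmSndFDerivAt (by simp)
  exact hs _ _

/-- By translation invariance the integral of f(· + s eᵢ) does not depend on s; differentiate it at
s = 0 under the integral sign. -/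
lemma integral_pderiv (hf : SmoothScalar f) (i : Fin 3) : ∫ x, pderiv i f x = 0 := by
  obtain ⟨C, hC⟩ : ∃ C, ∀ x, ‖pderiv i f x‖ ≤ C := by
    obtain ⟨C, hC⟩ := isCompact_univ.exists_bound_of_continuousOn (hf.pderiv i).continuous.continuousOn
    exact ⟨C, fun x => hC x (mem_univ x)⟩
  have h1 := hasDerivAt_integral_of_dominated_loc_of_deriv_le (μ := (volume : Measure Torus3))
    (F := fun (s : ℝ) x => f (x + proj (s • EuclideanSpace.single i (1 : ℝ))))
    (F' := fun (s : ℝ) x => pderiv i f (x + proj (s • EuclideanSpace.single i (1 : ℝ))))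
    (x₀ := 0) (s := univ) (bound := fun _ => C) univ_mem
    (Eventually.of_forall fun s => (hf.continuous.comp (continuous_add_const _)).aestronglyMeasurable)
    (by simpa [proj_zero] using hf.integrable)
    (((hf.pderiv i).continuous.comp (continuous_add_const _)).aestronglyMeasurable)
    (Eventually.of_forall fun x s _ => hC _) (integrable_const C)
    (Eventually.of_forall fun x s _ => hf.hasDerivAt_pderiv i x s)
  have h2 : (fun s : ℝ => ∫ x, f (x + proj (s • EuclideanSpace.single i (1 : ℝ)))) =
      fun _ => ∫ x, f x := by
    funext s
    exact integral_add_right_eq_self f _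
  have h3 := h1.2
  rw [h2] at h3
  simpa [proj_zero] using h3.unique (hasDerivAt_const (0 : ℝ) (∫ x, f x))

/-- Integration by parts on the torus. -/
lemma integral_mul_pderiv (hf : SmoothScalar f) (hg : SmoothScalar g) (i : Fin 3) :
    ∫ x, f x * pderiv i g x = - ∫ x, pderiv i f x * g x := by
  have h := integral_pderiv (hf.mul hg) i
  rw [pderiv_mul hf hg, integral_add ((hf.pderiv i).mul hg).integrable
    (hf.mul (hg.pderiv i)).integrable] at h
  linarith

/-- A smooth function orthogonal to all smooth functions vanishes. -/
lemma SmoothScalar.eq_zero_of_orthogonal (hf : SmoothScalar f)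
    (h : ∀ χ, SmoothScalar χ → ∫ x, f x * χ x = 0) : f = fun _ => 0 := by
  have h1 := h f hf
  have h2 : (fun x => f x * f x) =ᵐ[volume] 0 :=
    (integral_eq_zero_iff_of_nonneg (fun x => mul_self_nonneg _) (hf.mul hf).integrable).1 h1
  have h3 : (fun x => f x * f x) = fun _ => 0 :=
    Continuous.ae_eq_iff_eq volume (hf.mul hf).continuous continuous_const |>.1 h2
  funext x
  exact mul_self_eq_zero.1 (congrFun h3 x)

/-- The tool by which identities between mollified distributions (weak derivatives, divergence,
curl) become pointwise ones: they are checked by duality only. -/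
lemma SmoothScalar.eq_of_forall_integral_mul_eq (hf : SmoothScalar f) (hg : SmoothScalar g)
    (h : ∀ χ, SmoothScalar χ → ∫ x, f x * χ x = ∫ x, g x * χ x) : f = g := by
  have := (hf.sub hg).eq_zero_of_orthogonal fun χ hχ => by
    simp_rw [sub_mul]
    rw [integral_sub (hf.mul hχ).integrable (hg.mul hχ).integrable, h χ hχ, sub_self]
  funext x
  exact sub_eq_zero.1 (congrFun this x)

end pderiv

end HallMHD

namespace HallMHD

/-! ### Mollification -/

/-- Smooth compactly supported convolution kernels on `ℝ³`. -/
structure IsKernel (k : E3 → ℝ) : Prop where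
  smooth : ContDiff ℝ (⊤ : ℕ∞) k
  compact : HasCompactSupport k

/-- The convolution `k * f` of a kernel on `ℝ³` with a function on the torus. -/
noncomputable def conv (k : E3 → ℝ) (f : Torus3 → ℝ) (x : Torus3) : ℝ :=
  ∫ y, k y * f (x - proj y)

/-- The partial derivative of a kernel. -/
noncomputable def dker (i : Fin 3) (k : E3 → ℝ) (y : E3) : ℝ :=
  fderiv ℝ k y (EuclideanSpace.single i 1)

variable {k : E3 → ℝ} {f g : Torus3 → ℝ}

lemma IsKernel.integrable (hk : IsKernel k) : Integrable k :=
  hk.smooth.continuous.integrable_of_hasCompactSupport hk.compact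

lemma IsKernel.dker (hk : IsKernel k) (i : Fin 3) : IsKernel (dker i k) := by
  refine ⟨?_, ?_⟩
  · exact (ContDiff.fderiv_right hk.smooth (by simp)).clm_apply contDiff_const
  · exact hk.compact.fderiv_apply (𝕜 := ℝ) _

/-- The lift of an integrable function is locally integrable and the kernel is compactly supported,
so this holds at every x and not just almost every x; pointwise identities for convolutions need no
exceptional set. -/
lemma IsKernel.integrable_mul (hk : IsKernel k) (hf : Integrable f) (x : Torus3) :
    Integrable fun y => k y * f (x - proj y) := by
  have h1 : Integrable fun z : Torus3 => f (x - z) :=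
    ((Measure.measurePreserving_sub_left volume x).integrable_comp hf.aestronglyMeasurable).2 hf
  exact (locallyIntegrable_comp_proj h1).integrable_smul_left_of_hasCompactSupport
    hk.smooth.continuous hk.compact

lemma conv_proj (k : E3 → ℝ) (f : Torus3 → ℝ) (z : E3) :
    conv k f (proj z) =
      convolution k (fun y : E3 => f (proj y)) (ContinuousLinearMap.lsmul ℝ ℝ) volume z := by
  simp [conv, convolution_def, proj_sub]

lemma IsKernel.smooth_conv (hk : IsKernel k) (hf : Integrable f) : SmoothScalar (conv k f) := by
  unfold SmoothScalar
  simp_rw [conv_proj]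
  exact hk.compact.contDiff_convolution_left _ hk.smooth (locallyIntegrable_comp_proj hf)

lemma IsKernel.pderiv_conv (hk : IsKernel k) (hf : Integrable f) (i : Fin 3) :
    pderiv i (conv k f) = conv (HallMHD.dker i k) f := by
  funext x
  obtain ⟨z, rfl⟩ := proj_surjective x
  rw [(hk.smooth_conv hf).pderiv_proj, conv_proj]
  simp_rw [conv_proj]
  have h1 := hk.compact.hasFDerivAt_convolution_left (ContinuousLinearMap.lsmul ℝ ℝ)
    (contDiff_infty.1 hk.smooth 1) (locallyIntegrable_comp_proj hf) z
  have h2 : HasFDerivAt (fun z : E3 => convolution k (fun y : E3 => f (proj y))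
    (ContinuousLinearMap.lsmul ℝ ℝ) volume z) _ z := h1
  rw [h2.fderiv, convolution_def, convolution_def, ContinuousLinearMap.integral_apply]
  · rfl
  · exact ((hk.compact.fderiv (𝕜 := ℝ)).convolutionExists_left _
      (hk.smooth.continuous_fderiv (by simp)) (locallyIntegrable_comp_proj hf) z).integrable

lemma IsKernel.conv_sub (hk : IsKernel k) (hf : Integrable f) (hg : Integrable g) :
    conv k (fun x => f x - g x) = fun x => conv k f x - conv k g x := by
  funext x
  simp only [conv, mul_sub]
  exact integral_sub (hk.integrable_mul hf x) (hk.integrable_mul hg x)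

lemma IsKernel.conv_sum (hk : IsKernel k) {ι : Type*} {s : Finset ι} {F : ι → Torus3 → ℝ}
    (h : ∀ i ∈ s, Integrable (F i)) :
    conv k (fun x => ∑ i ∈ s, F i x) = fun x => ∑ i ∈ s, conv k (F i) x := by
  funext x
  simp only [conv, Finset.mul_sum]
  exact integral_finsetSum _ fun i hi => hk.integrable_mul (h i hi) x

lemma conv_const (k : E3 → ℝ) (c : ℝ) : conv k (fun _ => c) = fun _ => (∫ y, k y) * c := by
  funext x
  exact integral_mul_const c k

lemma IsKernel.conv_pderiv (hk : IsKernel k) (hf : SmoothScalar f) (i : Fin 3) :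
    pderiv i (conv k f) = conv k (pderiv i f) := by
  funext x
  obtain ⟨C, hC⟩ : ∃ C, ∀ x, ‖pderiv i f x‖ ≤ C := by
    obtain ⟨C, hC⟩ := isCompact_univ.exists_bound_of_continuousOn (hf.pderiv i).continuous.continuousOn
    exact ⟨C, fun x => hC x (mem_univ x)⟩
  have hc : ∀ g : Torus3 → ℝ, SmoothScalar g → ∀ z : Torus3, Continuous fun y => k y * g (z - proj y) :=
    fun g hg z => hk.smooth.continuous.mul (hg.continuous.comp (continuous_const.sub continuous_proj))
  have h1 := hasDerivAt_integral_of_dominated_loc_of_deriv_le (μ := (volume : Measure E3))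
    (F := fun (s : ℝ) y => k y * f (x + proj (s • EuclideanSpace.single i (1 : ℝ)) - proj y))
    (F' := fun (s : ℝ) y =>
      k y * pderiv i f (x + proj (s • EuclideanSpace.single i (1 : ℝ)) - proj y))
    (x₀ := 0) (s := univ) (bound := fun y => ‖k y‖ * C) univ_mem
    (Eventually.of_forall fun s => (hc f hf _).aestronglyMeasurable)
    (hk.integrable_mul hf.integrable _)
    ((hc _ (hf.pderiv i) _).aestronglyMeasurable)
    (Eventually.of_forall fun y s _ => by
      rw [norm_mul]; exact mul_le_mul_of_nonneg_left (hC _) (norm_nonneg _))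
    (hk.integrable.norm.mul_const C)
    (Eventually.of_forall fun y s _ => by
      have := (hf.hasDerivAt_pderiv i (x - proj y) s).const_mul (k y)
      simpa only [sub_add_eq_add_sub] using this)
  have h2 := h1.2.deriv
  simpa [pderiv, conv, proj_zero] using h2

/-- A skew product of translations. It gives the joint integrability behind every exchange of the
kernel integral with the torus integral. -/
lemma measurePreserving_shear :
    MeasurePreserving (fun p : E3 × Torus3 => (p.1, p.2 - proj p.1))
      ((volume : Measure E3).prod (volume : Measure Torus3))
      ((volume : Measure E3).prod (volume : Measure Torus3)) := by
  refine (MeasurePreserving.id _).skew_product (g := fun y x => x - proj y) ?_ ?_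
  · exact (continuous_snd.sub (continuous_proj.comp continuous_fst)).measurable
  · exact Eventually.of_forall fun y => (measurePreserving_sub_proj y).map_eq

lemma integrable_shear {k : E3 → ℝ} (hk : Integrable k) (hf : Integrable f) :
    Integrable (fun p : E3 × Torus3 => k p.1 * f (p.2 - proj p.1))
      ((volume : Measure E3).prod (volume : Measure Torus3)) :=
  (measurePreserving_shear.integrable_comp (hk.mul_prod hf).aestronglyMeasurable).2
    (hk.mul_prod hf)

lemma exists_norm_le_of_continuous {E : Type*} [NormedAddCommGroup E] {g : Torus3 → E}
    (hg : Continuous g) : ∃ C, 0 ≤ C ∧ ∀ x, ‖g x‖ ≤ C := by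
  obtain ⟨C, hC⟩ := isCompact_univ.exists_bound_of_continuousOn hg.continuousOn
  exact ⟨C, (norm_nonneg _).trans (hC 0 (mem_univ _)), fun x => hC x (mem_univ x)⟩

lemma integral_conv_mul (hk : Integrable k) (hf : Integrable f) (hg : Continuous g) :
    ∫ x, conv k f x * g x = ∫ y, k y * ∫ x, f (x - proj y) * g x := by
  obtain ⟨C, -, hC⟩ := exists_norm_le_of_continuous hg
  have h1 : Integrable (fun p : E3 × Torus3 => k p.1 * f (p.2 - proj p.1) * g p.2)
      ((volume : Measure E3).prod (volume : Measure Torus3)) :=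
    (integrable_shear hk hf).mul_bdd (c := C) (hg.comp continuous_snd).aestronglyMeasurable
      (Eventually.of_forall fun p => hC _)
  calc ∫ x, conv k f x * g x = ∫ x, ∫ y, k y * f (x - proj y) * g x := by
        simp only [conv, integral_mul_const]
    _ = ∫ y, ∫ x, k y * f (x - proj y) * g x := (integral_integral_swap h1).symm
    _ = _ := by simp only [mul_assoc, integral_const_mul]

/-- The adjoint of a convolution is the convolution with the reflected kernel. -/
lemma integral_conv_mul_eq_reflect (hk : Integrable k) (hf : Integrable f) (hg : Continuous g) :
    ∫ x, conv k f x * g x = ∫ x, f x * conv (fun y => k (-y)) g x := by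
  have hgi : Integrable g := by
    have := hg.continuousOn.integrableOn_compact (μ := volume) (isCompact_univ (X := Torus3))
    rwa [integrableOn_univ] at this
  obtain ⟨C, -, hC⟩ := exists_norm_le_of_continuous hg
  rw [integral_conv_mul hk hf hg]
  have hk' : Integrable fun y => k (-y) := hk.comp_neg
  have h1 : Integrable (fun p : E3 × Torus3 => k (-p.1) * g (p.2 - proj p.1) * f p.2)
      ((volume : Measure E3).prod (volume : Measure Torus3)) := by
    have : Integrable (fun p : E3 × Torus3 => g (p.2 - proj p.1) * (k (-p.1) * f p.2))
      ((volume : Measure E3).prod (volume : Measure Torus3)) :=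
      (hk'.mul_prod hf).bdd_mul (c := C)
      (hg.comp (continuous_snd.sub (continuous_proj.comp continuous_fst))).aestronglyMeasurable
      (Eventually.of_forall fun p => hC _)
    exact this.congr (Eventually.of_forall fun p => by ring)
  calc ∫ y, k y * ∫ x, f (x - proj y) * g x = ∫ y, k y * ∫ x, f x * g (x - proj (-y)) := by
        refine integral_congr_ae (Eventually.of_forall fun y => ?_)
        simp only
        congr 1
        rw [← integral_add_right_eq_self _ (proj y)]
        simp [proj_neg]
    _ = ∫ y, k (- -y) * ∫ x, f x * g (x - proj (-y)) := by simp only [neg_neg]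
    _ = ∫ y, k (-y) * ∫ x, f x * g (x - proj y) :=
        integral_neg_eq_self (fun y => k (-y) * ∫ x, f x * g (x - proj y)) volume
    _ = ∫ y, ∫ x, k (-y) * g (x - proj y) * f x := by
        simp only [← integral_const_mul]
        congr! 4
        ring
    _ = ∫ x, ∫ y, k (-y) * g (x - proj y) * f x := integral_integral_swap h1
    _ = _ := by simp only [conv, integral_mul_const, mul_comm (f _)]

/-- Convolution with an even kernel is symmetric. -/
lemma integral_conv_mul_comm (hk : Integrable k) (hev : ∀ y, k (-y) = k y) (hf : Integrable f)
    (hg : Continuous g) : ∫ x, conv k f x * g x = ∫ x, f x * conv k g x := by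
  simpa only [hev] using integral_conv_mul_eq_reflect hk hf hg

lemma IsKernel.reflect (hk : IsKernel k) : IsKernel fun y => k (-y) :=
  ⟨hk.smooth.comp contDiff_neg, hk.compact.comp_homeomorph (Homeomorph.neg E3)⟩

/-- Convolution with a kernel maps `L¹` to `L^∞`. -/
lemma IsKernel.exists_norm_conv_le (hk : IsKernel k) :
    ∃ C, 0 ≤ C ∧ ∀ f : Torus3 → ℝ, Integrable f → ∀ x, |conv k f x| ≤ C * ∫ z, |f z| := by
  obtain ⟨n, hn⟩ := exists_map_proj_restrict_le hk.compact
  obtain ⟨A, hA⟩ := hk.compact.exists_bound_of_continuous hk.smooth.continuous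
  have hA0 : 0 ≤ A := (norm_nonneg _).trans (hA 0)
  refine ⟨A * n, by positivity, fun f hf x => ?_⟩
  have h1 : Integrable fun z : Torus3 => |f (x - z)| :=
    ((Measure.measurePreserving_sub_left volume x).integrable_comp hf.aestronglyMeasurable).2 hf |>.abs
  have hsm : Integrable (fun z : Torus3 => |f (x - z)|) ((n : ℝ≥0∞) • volume) :=
    h1.smul_measure (by simp)
  -- The support of the kernel covers the torus at most `n` times, so the L¹ norm over it is at most
  -- `n` times the norm over the torus.
  have h2 : ∫ y in tsupport k, |f (x - proj y)| ≤ n * ∫ z, |f z| := by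
    have e1 : ∫ y in tsupport k, |f (x - proj y)| =
        ∫ z, |f (x - z)| ∂(Measure.map proj (volume.restrict (tsupport k))) :=
      (integral_map measurable_proj.aemeasurable
        (hsm.mono_measure hn).aestronglyMeasurable).symm
    rw [e1]
    refine (integral_mono_measure hn (Eventually.of_forall fun z => abs_nonneg _) hsm).trans ?_
    rw [integral_smul_measure, integral_sub_left_eq_self (fun z => |f z|)]
    simp
  have h3 : IntegrableOn (fun y => |f (x - proj y)|) (tsupport k) :=
    (hsm.mono_measure hn).comp_measurable measurable_proj
  calc |conv k f x| = |∫ y in tsupport k, k y * f (x - proj y)| := by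
        rw [conv, setIntegral_eq_integral_of_forall_compl_eq_zero]
        intro y hy
        rw [image_eq_zero_of_notMem_tsupport hy, zero_mul]
    _ ≤ ∫ y in tsupport k, A * |f (x - proj y)| := by
        rw [← Real.norm_eq_abs]
        refine norm_integral_le_of_norm_le (h3.const_mul A) (Eventually.of_forall fun y => ?_)
        rw [norm_mul]
        exact mul_le_mul_of_nonneg_right (hA y) (abs_nonneg _)
    _ ≤ A * (n * ∫ z, |f z|) := by
        rw [integral_const_mul]
        exact mul_le_mul_of_nonneg_left h2 hA0
    _ = _ := by ring

/-! ### The standard mollifier -/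

/-- The fixed bump function. -/
noncomputable def bump : ContDiffBump (0 : E3) := ⟨1 / 4, 1 / 2, by norm_num, by norm_num⟩

/-- The rescaled kernel `ε⁻³ k(·/ε)`. -/
noncomputable def scale (ε : ℝ) (k : E3 → ℝ) (y : E3) : ℝ := (ε ^ 3)⁻¹ * k (ε⁻¹ • y)

/-- The standard mollifier supported in the ball of radius `1`. -/
noncomputable def rho1 : E3 → ℝ := bump.normed volume

/-- The standard mollifier at scale `ε`. -/
noncomputable def rho (ε : ℝ) : E3 → ℝ := scale ε rho1

lemma isKernel_rho1 : IsKernel rho1 := ⟨bump.contDiff_normed, bump.hasCompactSupport_normed⟩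

lemma IsKernel.scale (hk : IsKernel k) {ε : ℝ} (hε : 0 < ε) : IsKernel (scale ε k) := by
  refine ⟨contDiff_const.mul (hk.smooth.comp (contDiff_const_smul _)), ?_⟩
  exact (hk.compact.comp_smul (inv_ne_zero hε.ne')).mul_left

/-- The source of every power of ε⁻¹ in the flux estimates: one for each derivative that falls on
the mollifier. -/
lemma dker_scale (hk : IsKernel k) (ε : ℝ) (i : Fin 3) :
    dker i (scale ε k) = fun y => ε⁻¹ * scale ε (dker i k) y := by
  funext y
  have hd : HasFDerivAt k (fderiv ℝ k (ε⁻¹ • y)) (ε⁻¹ • y) :=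
    (hk.smooth.differentiable (by simp)).differentiableAt.hasFDerivAt
  have h1 : HasFDerivAt (fun y : E3 => ε⁻¹ • y) (ε⁻¹ • ContinuousLinearMap.id ℝ E3) y :=
    (hasFDerivAt_id y).const_smul ε⁻¹
  have h2 : HasFDerivAt (scale ε k) _ y := (hd.comp y h1).const_mul ((ε ^ 3)⁻¹)
  simp only [dker, scale, h2.fderiv]
  simp
  ring

lemma isKernel_rho {ε : ℝ} (hε : 0 < ε) : IsKernel (rho ε) := isKernel_rho1.scale hε

lemma rho_neg (ε : ℝ) (y : E3) : rho ε (-y) = rho ε y := by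
  simp only [rho, scale, rho1, smul_neg]
  rw [bump.normed_neg]

lemma rho_nonneg {ε : ℝ} (hε : 0 < ε) (y : E3) : 0 ≤ rho ε y :=
  mul_nonneg (by positivity) (bump.nonneg_normed _)

lemma integral_rho {ε : ℝ} (hε : 0 < ε) : ∫ y, rho ε y = 1 := by
  simp only [rho, scale]
  rw [integral_const_mul, Measure.integral_comp_smul, rho1, bump.integral_normed]
  have : |((ε⁻¹ ^ 3)⁻¹ : ℝ)| = ε ^ 3 := by
    rw [inv_pow, inv_inv, abs_of_pos (by positivity)]
  simp only [finrank_euclideanSpace, Fintype.card_fin, this]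
  simp [hε.ne']

end HallMHD

namespace HallMHD

variable {f g : Torus3 → ℝ} {ε : ℝ}

/-! ### Mollification in `L²` -/

lemma MemLp.integrable_two (hf : MemLp f 2 volume) : Integrable f := hf.integrable (by norm_num)

lemma SmoothScalar.memLp (hf : SmoothScalar f) (p : ℝ≥0∞) : MemLp f p volume := by
  obtain ⟨C, -, hC⟩ := exists_norm_le_of_continuous hf.continuous
  exact MemLp.of_bound hf.continuous.aestronglyMeasurable C (Eventually.of_forall hC)

lemma integrable_mul_of_memLp {α : Type*} [MeasurableSpace α] {μ : Measure α} {f g : α → ℝ}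
    (hf : MemLp f 2 μ) (hg : MemLp g 2 μ) : Integrable (fun x => f x * g x) μ :=
  hf.integrable_mul hg

lemma abs_integral_mul_le {α : Type*} [MeasurableSpace α] {μ : Measure α} {f g : α → ℝ}
    (hf : MemLp f 2 μ) (hg : MemLp g 2 μ) :
    |∫ x, f x * g x ∂μ| ≤ √(∫ x, f x ^ 2 ∂μ) * √(∫ x, g x ^ 2 ∂μ) := by
  have h1 := integral_mul_norm_le_Lp_mul_Lq (μ := μ) (f := f) (g := g) (p := 2) (q := 2)
    Real.HolderConjugate.two_two (by simpa using hf) (by simpa using hg)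
  simp only [Real.norm_eq_abs, Real.rpow_two, sq_abs, ← Real.sqrt_eq_rpow] at h1
  refine (abs_integral_le_integral_abs).trans ?_
  simpa only [abs_mul] using h1

/-- Jensen's inequality for the probability density `rho ε`, proved by expanding the variance. -/
lemma sq_conv_rho_le (hε : 0 < ε) (hf : MemLp f 2 volume) (x : Torus3) :
    (conv (rho ε) f x) ^ 2 ≤ conv (rho ε) (fun z => f z ^ 2) x := by
  have hk := isKernel_rho hε
  set c := conv (rho ε) f x with hc
  have i1 := hk.integrable_mul hf.integrable_sq x
  have i2 := hk.integrable_mul (MemLp.integrable_two hf) x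
  have h1 : 0 ≤ ∫ y, rho ε y * (f (x - proj y) - c) ^ 2 :=
    integral_nonneg fun y => mul_nonneg (rho_nonneg hε y) (sq_nonneg _)
  have h2 : ∫ y, rho ε y * (f (x - proj y) - c) ^ 2 =
      conv (rho ε) (fun z => f z ^ 2) x - 2 * c * c + c ^ 2 := by
    have e : (fun y => rho ε y * (f (x - proj y) - c) ^ 2) = fun y =>
        rho ε y * f (x - proj y) ^ 2 - 2 * c * (rho ε y * f (x - proj y)) + c ^ 2 * rho ε y := by
      funext y; ring
    have i3 : Integrable fun y => 2 * c * (rho ε y * f (x - proj y)) := i2.const_mul _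
    have i4 : Integrable fun y => rho ε y * f (x - proj y) ^ 2
        - 2 * c * (rho ε y * f (x - proj y)) := i1.sub i3
    rw [e, integral_add i4 (hk.integrable.const_mul _),
      integral_sub i1 i3, integral_const_mul, integral_const_mul, integral_rho hε]
    simp only [conv] at hc ⊢
    rw [← hc]
    ring
  nlinarith

lemma integral_conv_rho (hε : 0 < ε) (hf : Integrable f) :
    ∫ x, conv (rho ε) f x = ∫ x, f x := by
  have := integral_conv_mul_comm (isKernel_rho hε).integrable (rho_neg ε) hf
    (continuous_const (y := (1 : ℝ)))
  simpa [conv_const, integral_rho hε] using this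

lemma integral_sq_conv_rho_le (hε : 0 < ε) (hf : MemLp f 2 volume) :
    ∫ x, (conv (rho ε) f x) ^ 2 ≤ ∫ x, f x ^ 2 := by
  have hk := isKernel_rho hε
  have h1 := hk.smooth_conv (MemLp.integrable_two hf)
  rw [← integral_conv_rho hε hf.integrable_sq]
  exact integral_mono (h1.memLp 2).integrable_sq (hk.smooth_conv hf.integrable_sq).integrable
    fun x => sq_conv_rho_le hε hf x

/-- Jensen gives (f^ε)⁴ ≤ ((f²)^ε)² pointwise; then the L² contraction is applied to f². -/
lemma integral_pow_four_conv_rho_le (hε : 0 < ε) (hf : MemLp f 2 volume)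
    (hf4 : MemLp (fun x => f x ^ 2) 2 volume) :
    ∫ x, (conv (rho ε) f x) ^ 4 ≤ ∫ x, f x ^ 4 := by
  have hk := isKernel_rho hε
  have h1 := hk.smooth_conv (MemLp.integrable_two hf)
  have h2 := hk.smooth_conv hf.integrable_sq
  calc ∫ x, (conv (rho ε) f x) ^ 4 ≤ ∫ x, (conv (rho ε) (fun z => f z ^ 2) x) ^ 2 := by
        refine integral_mono ?_ (h2.memLp 2).integrable_sq fun x => ?_
        · have := ((h1.mul h1).memLp 2).integrable_sq
          exact this.congr (Eventually.of_forall fun x => by ring)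
        · have := sq_conv_rho_le hε hf x
          calc (conv (rho ε) f x) ^ 4 = ((conv (rho ε) f x) ^ 2) ^ 2 := by ring
            _ ≤ _ := pow_le_pow_left₀ (sq_nonneg _) this 2
    _ ≤ ∫ x, (f x ^ 2) ^ 2 := integral_sq_conv_rho_le hε hf4
    _ = _ := by congr! 2; ring

lemma rho_eq_zero (hε : 0 < ε) {y : E3} (hy : ε ≤ ‖y‖) : rho ε y = 0 := by
  have : rho1 (ε⁻¹ • y) = 0 := by
    rw [← Function.notMem_support, rho1, bump.support_normed_eq]
    simp only [Metric.mem_ball, dist_zero_right, norm_smul, norm_inv, Real.norm_eq_abs,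
      abs_of_pos hε, not_lt, bump]
    rw [inv_mul_eq_div, le_div_iff₀ hε]
    linarith
  simp [rho, scale, this]

/-- Mollifications of continuous functions converge uniformly. -/
lemma eventually_abs_conv_rho_sub_le (hg : Continuous g) {η : ℝ} (hη : 0 < η) :
    ∀ᶠ ε in 𝓝[>] (0 : ℝ), ∀ x, |conv (rho ε) g x - g x| ≤ η := by
  have huc : UniformContinuous g := CompactSpace.uniformContinuous_of_continuous hg
  have h1 : ∀ᶠ z in 𝓝 (0 : Torus3), ∀ x, |g (x - z) - g x| ≤ η := by
    have h2 := huc (Metric.dist_mem_uniformity hη)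
    rw [uniformity_eq_comap_nhds_zero, mem_map, mem_comap] at h2
    obtain ⟨t, ht, hs⟩ := h2
    filter_upwards [ht] with z hz x
    have : (x - z, x) ∈ (fun p : Torus3 × Torus3 => p.2 - p.1) ⁻¹' t := by simpa using hz
    have h3 := hs this
    rw [mem_preimage, mem_ofPred_eq, Real.dist_eq] at h3
    exact h3.le
  have h2 : ∀ᶠ y in 𝓝 (0 : E3), ∀ x, |g (x - proj y) - g x| ≤ η := by
    have := continuous_proj.tendsto 0
    rw [proj_zero] at this
    exact this.eventually h1
  obtain ⟨δ, hδ, hb⟩ := Metric.eventually_nhds_iff.1 h2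
  filter_upwards [self_mem_nhdsWithin, nhdsWithin_le_nhds (gt_mem_nhds hδ)] with ε hε hεδ x
  have hε' : 0 < ε := hε
  have hk := isKernel_rho hε'
  have hgi : Integrable g := by
    have := hg.continuousOn.integrableOn_compact (μ := volume) (isCompact_univ (X := Torus3))
    rwa [integrableOn_univ] at this
  have e : conv (rho ε) g x - g x = ∫ y, rho ε y * (g (x - proj y) - g x) := by
    simp only [mul_sub]
    rw [integral_sub (hk.integrable_mul hgi x) (hk.integrable.mul_const _), integral_mul_const,
      integral_rho hε', one_mul, conv]
  rw [e, ← Real.norm_eq_abs]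
  have := norm_integral_le_of_norm_le (f := fun y => rho ε y * (g (x - proj y) - g x))
    (hk.integrable.mul_const η) (Eventually.of_forall fun y => ?_)
  · rwa [integral_mul_const, integral_rho hε', one_mul] at this
  · rw [norm_mul, Real.norm_eq_abs, abs_of_nonneg (rho_nonneg hε' y)]
    by_cases hy : ε ≤ ‖y‖
    · simp [rho_eq_zero hε' hy]
    · refine mul_le_mul_of_nonneg_left (hb ?_ x) (rho_nonneg hε' y)
      rw [dist_zero_right]; linarith [not_le.1 hy]

/-- Bounded continuous functions are dense in L², mollification is an L² contraction, and on
continuous functions it converges uniformly. -/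
lemma tendsto_integral_sq_conv_rho_sub (hf : MemLp f 2 volume) :
    Tendsto (fun ε => ∫ x, (conv (rho ε) f x - f x) ^ 2) (𝓝[>] 0) (𝓝 0) := by
  rw [Metric.tendsto_nhds]
  intro η hη
  -- Three errors, each of squared size at most η/12 and weighted by 3 in the expansion of the
  -- square, add up to 3η/4 < η.
  have hδ : 0 < η / 12 := by positivity
  obtain ⟨g, hg, hgL⟩ := hf.exists_boundedContinuous_eLpNorm_sub_le (by norm_num)
    (ε := ENNReal.ofReal √(η / 12)) (by simpa using hδ)
  have hfg : MemLp (fun x => f x - g x) 2 volume := hf.sub hgL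
  have h1 : ∫ x, (f x - g x) ^ 2 ≤ η / 12 := by
    have h2 := hfg.eLpNorm_eq_integral_rpow_norm (by norm_num) (by norm_num)
    have h3 : eLpNorm (fun x => f x - g x) 2 volume ≤ ENNReal.ofReal √(η / 12) := hg
    rw [h2] at h3
    simp only [ENNReal.toReal_ofNat, Real.norm_eq_abs, Real.rpow_two, sq_abs] at h3
    rw [ENNReal.ofReal_le_ofReal_iff (Real.sqrt_nonneg _), ← one_div, ← Real.sqrt_eq_rpow] at h3
    exact (Real.sqrt_le_sqrt_iff hδ.le).1 h3
  have hη2 : 0 < √(η / 12) := Real.sqrt_pos.2 hδ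
  filter_upwards [self_mem_nhdsWithin, eventually_abs_conv_rho_sub_le g.continuous hη2]
    with ε hε hu
  have hε' : 0 < ε := hε
  have hk := isKernel_rho hε'
  have hgi := MemLp.integrable_two hgL
  have hfi := MemLp.integrable_two hf
  have hcfg := (hk.smooth_conv (MemLp.integrable_two hfg)).memLp 2
  have hcg := (hk.smooth_conv hgi).memLp 2
  have hcf := (hk.smooth_conv hfi).memLp 2
  have hb : ∀ x, (conv (rho ε) f x - f x) ^ 2 ≤
      3 * (conv (rho ε) (fun z => f z - g z) x) ^ 2 + 3 * (f x - g x) ^ 2 + 3 * (η / 12) := by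
    intro x
    have e := congrFun (hk.conv_sub hfi hgi) x
    have h4 : (conv (rho ε) g x - g x) ^ 2 ≤ η / 12 := by
      rw [← sq_abs, ← Real.sq_sqrt hδ.le]
      exact pow_le_pow_left₀ (abs_nonneg _) (hu x) 2
    rw [e]
    nlinarith [sq_nonneg ((conv (rho ε) f x - conv (rho ε) g x) - (conv (rho ε) g x - g x)),
      sq_nonneg ((conv (rho ε) f x - conv (rho ε) g x) + (f x - g x)),
      sq_nonneg ((conv (rho ε) g x - g x) + (f x - g x))]
  have h5 := integral_sq_conv_rho_le hε' hfg
  have h6 : ∫ x, (conv (rho ε) f x - f x) ^ 2 ≤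
      3 * (∫ x, (conv (rho ε) (fun z => f z - g z) x) ^ 2) + 3 * (∫ x, (f x - g x) ^ 2)
        + 3 * (η / 12) := by
    have j1 : ∀ h : Torus3 → ℝ, MemLp h 2 volume → Integrable fun x => 3 * (h x) ^ 2 :=
      fun h hh => hh.integrable_sq.const_mul 3
    have j2 : Integrable fun x => 3 * (conv (rho ε) (fun z => f z - g z) x) ^ 2
        + 3 * (f x - g x) ^ 2 := (j1 _ hcfg).add (j1 _ hfg)
    have j3 : Integrable fun x => 3 * (conv (rho ε) (fun z => f z - g z) x) ^ 2
        + 3 * (f x - g x) ^ 2 + 3 * (η / 12) := j2.add (integrable_const _)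
    refine (integral_mono (hcf.sub hf).integrable_sq j3 hb).trans ?_
    rw [integral_add j2 (integrable_const _), integral_add (j1 _ hcfg) (j1 _ hfg),
      integral_const_mul, integral_const_mul]
    simp
  rw [Real.dist_eq, sub_zero, abs_of_nonneg (integral_nonneg fun x => sq_nonneg _)]
  linarith

lemma tendsto_integral_conv_rho_mul_conv_rho (hf : MemLp f 2 volume) (hg : MemLp g 2 volume) :
    Tendsto (fun ε => ∫ x, conv (rho ε) f x * conv (rho ε) g x) (𝓝[>] 0)
      (𝓝 (∫ x, f x * g x)) := by
  have h1 : Tendsto (fun ε => √(∫ x, (conv (rho ε) f x - f x) ^ 2) * √(∫ x, g x ^ 2)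
      + √(∫ x, f x ^ 2) * √(∫ x, (conv (rho ε) g x - g x) ^ 2)) (𝓝[>] 0) (𝓝 0) := by
    have a := (tendsto_integral_sq_conv_rho_sub hf).sqrt
    have b := (tendsto_integral_sq_conv_rho_sub hg).sqrt
    simpa using (a.mul_const (√(∫ x, g x ^ 2))).add (b.const_mul (√(∫ x, f x ^ 2)))
  rw [tendsto_iff_norm_sub_tendsto_zero]
  refine squeeze_zero' (Eventually.of_forall fun ε => norm_nonneg _) ?_ h1
  filter_upwards [self_mem_nhdsWithin] with ε hε
  have hε' : 0 < ε := hε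
  have hk := isKernel_rho hε'
  have hcg := (hk.smooth_conv (MemLp.integrable_two hg)).memLp 2
  have hcf := (hk.smooth_conv (MemLp.integrable_two hf)).memLp 2
  have hdf : MemLp (fun x => conv (rho ε) f x - f x) 2 volume := hcf.sub hf
  have hdg : MemLp (fun x => conv (rho ε) g x - g x) 2 volume := hcg.sub hg
  have e : (∫ x, conv (rho ε) f x * conv (rho ε) g x) - ∫ x, f x * g x =
      (∫ x, (conv (rho ε) f x - f x) * conv (rho ε) g x)
        + ∫ x, f x * (conv (rho ε) g x - g x) := by
    rw [← integral_sub (integrable_mul_of_memLp hcf hcg) (integrable_mul_of_memLp hf hg),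
      ← integral_add (integrable_mul_of_memLp hdf hcg) (integrable_mul_of_memLp hf hdg)]
    congr! 2
    ring
  rw [e]
  refine (norm_add_le _ _).trans (add_le_add ?_ ?_)
  · refine (abs_integral_mul_le (hcf.sub hf) hcg).trans ?_
    exact mul_le_mul_of_nonneg_left (Real.sqrt_le_sqrt (integral_sq_conv_rho_le hε' hg))
      (Real.sqrt_nonneg _)
  · exact abs_integral_mul_le hf (hcg.sub hg)

end HallMHD

namespace HallMHD

variable {f g c : Torus3 → ℝ} {ε : ℝ} {k : E3 → ℝ}

/-! ### Weak partial derivatives -/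

/-- `g` is the weak partial derivative `∂ᵢ f`. -/
def HasWeakPartial (i : Fin 3) (f g : Torus3 → ℝ) : Prop :=
  ∀ ψ : Torus3 → ℝ, SmoothScalar ψ → ∫ x, f x * pderiv i ψ x = - ∫ x, g x * ψ x

lemma SmoothScalar.conv_rho_comm (hε : 0 < ε) {χ : Torus3 → ℝ} (hχ : SmoothScalar χ)
    (hf : Integrable f) : ∫ x, conv (rho ε) f x * χ x = ∫ x, f x * conv (rho ε) χ x :=
  integral_conv_mul_comm (isKernel_rho hε).integrable (rho_neg ε) hf hχ.continuous

/-- By duality: the even kernel and the derivative are both moved to the test function, where the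
definition of the weak derivative applies to a smooth function. -/
lemma HasWeakPartial.pderiv_conv {i : Fin 3} (h : HasWeakPartial i f g) (hε : 0 < ε)
    (hf : Integrable f) (hg : Integrable g) :
    pderiv i (conv (rho ε) f) = conv (rho ε) g := by
  have hk := isKernel_rho hε
  refine ((hk.smooth_conv hf).pderiv i).eq_of_forall_integral_mul_eq (hk.smooth_conv hg)
    fun χ hχ => ?_
  have h1 := integral_mul_pderiv (hk.smooth_conv hf) hχ i
  rw [(hχ.pderiv i).conv_rho_comm hε hf, ← hk.conv_pderiv hχ,
    h _ (hk.smooth_conv hχ.integrable), ← hχ.conv_rho_comm hε hg] at h1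
  linarith

/-! ### Mean oscillations and the commutator estimate -/

/-- The normalized Lebesgue measure of the ball of radius `ε`. -/
noncomputable def ballMeasure (ε : ℝ) : Measure E3 :=
  (volume (Metric.ball (0 : E3) ε))⁻¹ • volume.restrict (Metric.ball (0 : E3) ε)

lemma isProbabilityMeasure_ballMeasure (hε : 0 < ε) : IsProbabilityMeasure (ballMeasure ε) := by
  constructor
  rw [ballMeasure, Measure.smul_apply, Measure.restrict_apply_univ, smul_eq_mul]
  exact ENNReal.inv_mul_cancel (Metric.measure_ball_pos _ _ hε).ne' measure_ball_lt_top.ne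

lemma setLAverage_ball_eq (ε : ℝ) (φ : E3 → ℝ≥0∞) :
    ⨍⁻ y in Metric.ball (0 : E3) ε, φ y ∂volume = ∫⁻ y, φ y ∂(ballMeasure ε) := by
  rw [setLAverage_eq, ballMeasure, lintegral_smul_measure, ENNReal.div_eq_inv_mul, smul_eq_mul]

/-- The local cubic mean oscillation `⨍_{B_ε} |f(x) - f(x-y)|³ dy`. -/
noncomputable def osc {E : Type*} [NormedAddCommGroup E] (ε : ℝ) (f : Torus3 → E)
    (x : Torus3) : ℝ≥0∞ :=
  ∫⁻ y, ‖f x - f (x - proj y)‖ₑ ^ 3 ∂(ballMeasure ε)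

/-- A crude Young inequality, from comparing with the largest of the three. Constants are irrelevant
below, and this form reduces products of three increments to cubic oscillations of single functions.
-/
lemma ENNReal_mul_mul_le (x y z : ℝ≥0∞) : x * y * z ≤ x ^ 3 + y ^ 3 + z ^ 3 := by
  set m := max x (max y z) with hm
  have h1 : x * y * z ≤ m * m * m :=
    mul_le_mul' (mul_le_mul' (le_max_left _ _) ((le_max_left _ _).trans (le_max_right _ _)))
      ((le_max_right _ _).trans (le_max_right _ _))
  have h2 : m * m * m = m ^ 3 := by ring
  rw [h2] at h1
  refine h1.trans ?_
  rcases max_choice x (max y z) with h | h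
  · rw [hm, h, add_assoc]; exact le_self_add
  · rcases max_choice y z with h' | h' <;> rw [hm, h, h']
    · rw [add_comm (x ^ 3), add_assoc]; exact le_self_add
    · exact le_add_self

lemma lintegral_pow_three_le {α : Type*} [MeasurableSpace α] {ν : Measure α}
    [IsProbabilityMeasure ν] {a : α → ℝ≥0∞} (ha : AEMeasurable a ν) :
    (∫⁻ y, a y ∂ν) ^ 3 ≤ ∫⁻ y, a y ^ 3 ∂ν := by
  have hpq : (3 : ℝ).HolderConjugate (3 / 2) := by
    constructor <;> norm_num
  have h := ENNReal.lintegral_mul_le_Lp_mul_Lq ν hpq ha (aemeasurable_const (b := (1 : ℝ≥0∞)))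
  simp only [Pi.mul_apply, mul_one, ENNReal.one_rpow, lintegral_const, measure_univ] at h
  calc (∫⁻ y, a y ∂ν) ^ 3 ≤ ((∫⁻ y, a y ^ (3 : ℝ) ∂ν) ^ (1 / 3 : ℝ)) ^ 3 := by gcongr
    _ = ∫⁻ y, a y ^ 3 ∂ν := by
      rw [← ENNReal.rpow_natCast, ← ENNReal.rpow_mul]
      norm_num

/-- Handles the part of the commutator in which two increments are averaged jointly; the next lemma
handles the product of separate averages. Both rest on Young pointwise and Jensen for the
probability measure. -/
lemma lintegral_mul_mul_lintegral_le {α : Type*} [MeasurableSpace α] {ν : Measure α}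
    [IsProbabilityMeasure ν] {a b d : α → ℝ≥0∞} (ha : AEMeasurable a ν) (hb : AEMeasurable b ν)
    (hd : AEMeasurable d ν) :
    (∫⁻ y, a y * b y ∂ν) * ∫⁻ y, d y ∂ν ≤
      (∫⁻ y, a y ^ 3 ∂ν) + (∫⁻ y, b y ^ 3 ∂ν) + ∫⁻ y, d y ^ 3 ∂ν := by
  have hab : AEMeasurable (fun y => a y * b y) ν := ha.mul hb
  rw [← lintegral_mul_const'' _ hab]
  refine (lintegral_mono fun y => ENNReal_mul_mul_le _ _ _).trans ?_
  rw [lintegral_add_right' _ aemeasurable_const, lintegral_add_left' (ha.pow_const 3),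
    lintegral_const, measure_univ, mul_one]
  gcongr
  exact lintegral_pow_three_le hd

lemma lintegral_mul_lintegral_mul_lintegral_le {α : Type*} [MeasurableSpace α] {ν : Measure α}
    [IsProbabilityMeasure ν] {a b d : α → ℝ≥0∞} (ha : AEMeasurable a ν) (hb : AEMeasurable b ν)
    (hd : AEMeasurable d ν) :
    (∫⁻ y, a y ∂ν) * (∫⁻ y, b y ∂ν) * ∫⁻ y, d y ∂ν ≤
      (∫⁻ y, a y ^ 3 ∂ν) + (∫⁻ y, b y ^ 3 ∂ν) + ∫⁻ y, d y ^ 3 ∂ν := by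
  refine (ENNReal_mul_mul_le _ _ _).trans ?_
  gcongr <;> exact lintegral_pow_three_le ‹_›

/-- Kernels supported in the open unit ball. -/
structure IsUnitKernel (k : E3 → ℝ) : Prop extends IsKernel k where
  tsupport_subset : tsupport k ⊆ Metric.ball 0 1

lemma isUnitKernel_rho1 : IsUnitKernel rho1 := by
  refine ⟨isKernel_rho1, ?_⟩
  rw [rho1, bump.tsupport_normed_eq]
  exact Metric.closedBall_subset_ball (by norm_num [bump])

lemma IsUnitKernel.dker (hk : IsUnitKernel k) (i : Fin 3) : IsUnitKernel (dker i k) :=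
  ⟨hk.toIsKernel.dker i, (tsupport_fderiv_apply_subset ℝ _).trans hk.tsupport_subset⟩

/-- The convolution of `k` with the constant 1 is constant, and its derivative is the convolution
with the derivative of the kernel. -/
lemma integral_dker_eq_zero (hk : IsKernel k) (i : Fin 3) : ∫ y, dker i k y = 0 := by
  have h1 := hk.pderiv_conv (integrable_const (1 : ℝ)) i
  rw [conv_const, conv_const, pderiv_const] at h1
  simpa using (congrFun h1 0).symm

lemma integral_scale (hε : 0 < ε) (k : E3 → ℝ) : ∫ y, scale ε k y = ∫ y, k y := by
  simp only [scale]
  rw [integral_const_mul, Measure.integral_comp_smul]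
  have : |((ε⁻¹ ^ 3)⁻¹ : ℝ)| = ε ^ 3 := by
    rw [inv_pow, inv_inv, abs_of_pos (by positivity)]
  simp only [finrank_euclideanSpace, Fintype.card_fin, this, smul_eq_mul]
  field_simp

/-- The rescaled kernel is at most A ε⁻³ in size and lives on the ball of radius ε, whose volume is
ε³ times that of the unit ball. The two powers cancel, so the constant is uniform in ε. -/
lemma IsUnitKernel.exists_enorm_integral_le (hk : IsUnitKernel k) :
    ∃ C : ℝ≥0∞, C ≠ ⊤ ∧ ∀ ε, 0 < ε → ∀ φ : E3 → ℝ,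
      ‖∫ y, scale ε k y * φ y‖ₑ ≤ C * ∫⁻ y, ‖φ y‖ₑ ∂(ballMeasure ε) := by
  obtain ⟨A, hA⟩ := hk.compact.exists_bound_of_continuous hk.smooth.continuous
  have hV : volume (Metric.ball (0 : E3) 1) ≠ ⊤ := measure_ball_lt_top.ne
  have hV0 : volume (Metric.ball (0 : E3) 1) ≠ 0 := (Metric.measure_ball_pos _ _ one_pos).ne'
  refine ⟨ENNReal.ofReal A * volume (Metric.ball (0 : E3) 1),
    ENNReal.mul_ne_top ENNReal.ofReal_ne_top hV, fun ε hε φ => ?_⟩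
  refine (enorm_integral_le_lintegral_enorm _).trans ?_
  have hvol : volume (Metric.ball (0 : E3) ε) =
      ENNReal.ofReal (ε ^ 3) * volume (Metric.ball (0 : E3) 1) := by
    rw [Measure.addHaar_ball _ _ hε.le]; simp
  have hε3 : ENNReal.ofReal (ε ^ 3) ≠ 0 := by
    simpa using pow_pos hε 3
  have hb : ∀ y, ‖scale ε k y * φ y‖ₑ ≤ (Metric.ball (0 : E3) ε).indicator
      (fun y => ENNReal.ofReal A * (ENNReal.ofReal (ε ^ 3))⁻¹ * ‖φ y‖ₑ) y := by
    intro y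
    by_cases hy : y ∈ Metric.ball (0 : E3) ε
    · rw [indicator_of_mem hy, enorm_mul]
      gcongr
      rw [scale, enorm_mul, mul_comm]
      gcongr
      · rw [← ofReal_norm]; exact ENNReal.ofReal_le_ofReal (hA _)
      · rw [← ofReal_norm, Real.norm_eq_abs, abs_of_pos (by positivity),
          ENNReal.ofReal_inv_of_pos (by positivity)]
    · have : k (ε⁻¹ • y) = 0 := by
        refine image_eq_zero_of_notMem_tsupport fun h => hy ?_
        have := hk.tsupport_subset h
        rw [Metric.mem_ball, dist_zero_right, norm_smul, norm_inv, Real.norm_eq_abs,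
          abs_of_pos hε, inv_mul_eq_div, div_lt_one hε] at this
        simpa using this
      simp [scale, this]
  refine (lintegral_mono hb).trans (le_of_eq ?_)
  rw [lintegral_indicator measurableSet_ball, ballMeasure, lintegral_smul_measure, hvol,
    lintegral_const_mul' _ _ (ENNReal.mul_ne_top ENNReal.ofReal_ne_top (ENNReal.inv_ne_top.2 hε3)),
    smul_eq_mul, ENNReal.mul_inv (Or.inl hε3) (Or.inl ENNReal.ofReal_ne_top), ← mul_assoc]
  congr 1
  calc _ = ENNReal.ofReal A * (ENNReal.ofReal (ε ^ 3))⁻¹ * 1 := by rw [mul_one]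
    _ = ENNReal.ofReal A * (ENNReal.ofReal (ε ^ 3))⁻¹ *
        (volume (Metric.ball (0 : E3) 1) * (volume (Metric.ball (0 : E3) 1))⁻¹) := by
          rw [ENNReal.mul_inv_cancel hV0 hV]
    _ = _ := by ring

/-- The commutator `(fg)^ε - f^ε g^ε`. -/
noncomputable def commut (ε : ℝ) (f g : Torus3 → ℝ) (x : Torus3) : ℝ :=
  conv (rho ε) (fun z => f z * g z) x - conv (rho ε) f x * conv (rho ε) g x

lemma conv_eq_add_integral_sub (hk : IsKernel k) (hf : Integrable f) (x : Torus3) :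
    conv k f x = (∫ y, k y) * f x + ∫ y, k y * (f (x - proj y) - f x) := by
  have h : (∫ y, k y * (f (x - proj y) - f x)) = conv k f x - (∫ y, k y) * f x := by
    simp only [mul_sub, conv]
    rw [integral_sub (hk.integrable_mul hf x) (hk.integrable.mul_const _), integral_mul_const]
  rw [h]; ring

/-- The Constantin–E–Titi identity. As `rho ε` has mass 1, expanding the increments around f(x) and
g(x) makes all lower-order terms cancel, and the commutator depends on increments at scale ε only.
-/
lemma commut_eq (hε : 0 < ε) (hf : MemLp f 2 volume) (hg : MemLp g 2 volume) (x : Torus3) :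
    commut ε f g x =
      (∫ y, rho ε y * ((f (x - proj y) - f x) * (g (x - proj y) - g x)))
        - (∫ y, rho ε y * (f (x - proj y) - f x)) * ∫ y, rho ε y * (g (x - proj y) - g x) := by
  have hk := isKernel_rho hε
  have hfi := MemLp.integrable_two hf
  have hgi := MemLp.integrable_two hg
  have hfg : Integrable fun z => f z * g z := integrable_mul_of_memLp hf hg
  have i1 := hk.integrable_mul hfg x
  have i2 := hk.integrable_mul hfi x
  have i3 := hk.integrable_mul hgi x
  have e : (∫ y, rho ε y * ((f (x - proj y) - f x) * (g (x - proj y) - g x))) =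
      conv (rho ε) (fun z => f z * g z) x - g x * conv (rho ε) f x
        - f x * conv (rho ε) g x + f x * g x := by
    have e1 : (fun y => rho ε y * ((f (x - proj y) - f x) * (g (x - proj y) - g x))) = fun y =>
        rho ε y * (f (x - proj y) * g (x - proj y)) - g x * (rho ε y * f (x - proj y))
          - f x * (rho ε y * g (x - proj y)) + f x * g x * rho ε y := by
      funext y; ring
    have j1 : Integrable fun y => rho ε y * (f (x - proj y) * g (x - proj y))
        - g x * (rho ε y * f (x - proj y)) := i1.sub (i2.const_mul _)
    have j2 : Integrable fun y => rho ε y * (f (x - proj y) * g (x - proj y))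
        - g x * (rho ε y * f (x - proj y)) - f x * (rho ε y * g (x - proj y)) :=
      j1.sub (i3.const_mul _)
    rw [e1, integral_add j2 (hk.integrable.const_mul _), integral_sub j1 (i3.const_mul _),
      integral_sub i1 (i2.const_mul _), integral_const_mul, integral_const_mul, integral_const_mul,
      integral_rho hε]
    simp only [conv]
    ring
  rw [e, commut, conv_eq_add_integral_sub hk hfi x, conv_eq_add_integral_sub hk hgi x,
    integral_rho hε]
  ring

lemma aemeasurable_comp_sub_proj {E : Type*} [NormedAddCommGroup E] {F : Torus3 → E}
    (hF : AEStronglyMeasurable F volume) (x : Torus3) :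
    AEMeasurable (fun y : E3 => ‖F (x - proj y) - F x‖ₑ) (ballMeasure ε) := by
  have h1 : Measure.QuasiMeasurePreserving (fun y : E3 => x - proj y) volume volume :=
    (Measure.measurePreserving_sub_left volume x).quasiMeasurePreserving.comp
      quasiMeasurePreserving_proj
  have h2 : AEStronglyMeasurable (fun y : E3 => F (x - proj y)) volume :=
    hF.comp_quasiMeasurePreserving h1
  exact ((h2.sub aestronglyMeasurable_const).enorm.restrict).smul_measure _

/-- The commutator estimate of Constantin–E–Titi. -/
lemma IsUnitKernel.exists_enorm_commut_mul_le (hk : IsUnitKernel k) (h0 : ∫ y, k y = 0) :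
    ∃ C : ℝ≥0∞, C ≠ ⊤ ∧ ∀ ε, 0 < ε → ∀ f g c : Torus3 → ℝ,
      MemLp f 2 volume → MemLp g 2 volume → MemLp c 2 volume → ∀ x,
      ‖commut ε f g x * conv (scale ε k) c x‖ₑ ≤ C * (osc ε f x + osc ε g x + osc ε c x) := by
  obtain ⟨A, hA, hA'⟩ := isUnitKernel_rho1.exists_enorm_integral_le
  obtain ⟨B, hB, hB'⟩ := hk.exists_enorm_integral_le
  -- `A * B` bounds the jointly averaged part of the commutator, `A * A * B` the product of two
  -- separate averages.
  refine ⟨A * B + A * A * B, by finiteness, fun ε hε f g c hf hg hc x => ?_⟩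
  have := isProbabilityMeasure_ballMeasure hε
  have hosc : ∀ F : Torus3 → ℝ, osc ε F x = ∫⁻ y, ‖F (x - proj y) - F x‖ₑ ^ 3 ∂(ballMeasure ε) := by
    intro F
    simp only [osc, enorm_sub_rev (F x)]
  have mf := aemeasurable_comp_sub_proj (ε := ε) hf.1 x
  have mg := aemeasurable_comp_sub_proj (ε := ε) hg.1 x
  have mc := aemeasurable_comp_sub_proj (ε := ε) hc.1 x
  -- A kernel of mass zero does not see the value c(x), so the third factor is an average of
  -- increments as well.
  have e1 : conv (scale ε k) c x = ∫ y, scale ε k y * (c (x - proj y) - c x) := by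
    rw [conv_eq_add_integral_sub (hk.toIsKernel.scale hε) (MemLp.integrable_two hc),
      integral_scale hε, h0]
    ring
  rw [hosc, hosc, hosc, commut_eq hε hf hg, e1, enorm_mul]
  set a := fun y => ‖f (x - proj y) - f x‖ₑ
  set b := fun y => ‖g (x - proj y) - g x‖ₑ
  set d := fun y => ‖c (x - proj y) - c x‖ₑ
  have b1 := hA' ε hε fun y => (f (x - proj y) - f x) * (g (x - proj y) - g x)
  simp only [enorm_mul] at b1
  have b2 := hA' ε hε fun y => f (x - proj y) - f x
  have b3 := hA' ε hε fun y => g (x - proj y) - g x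
  have b4 := hB' ε hε fun y => c (x - proj y) - c x
  calc _ ≤ (A * (∫⁻ y, a y * b y ∂(ballMeasure ε))
        + (A * ∫⁻ y, a y ∂(ballMeasure ε)) * (A * ∫⁻ y, b y ∂(ballMeasure ε)))
          * (B * ∫⁻ y, d y ∂(ballMeasure ε)) := by
        gcongr
        refine (enorm_sub_le).trans ?_
        rw [enorm_mul]
        exact add_le_add b1 (mul_le_mul' b2 b3)
    _ = A * B * ((∫⁻ y, a y * b y ∂(ballMeasure ε)) * ∫⁻ y, d y ∂(ballMeasure ε))
        + A * A * B * ((∫⁻ y, a y ∂(ballMeasure ε)) * (∫⁻ y, b y ∂(ballMeasure ε))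
          * ∫⁻ y, d y ∂(ballMeasure ε)) := by ring
    _ ≤ _ := by
        rw [add_mul]
        gcongr
        · exact lintegral_mul_mul_lintegral_le mf mg mc
        · exact lintegral_mul_lintegral_mul_lintegral_le mf mg mc

lemma aemeasurable_sub_proj_prod {E : Type*} [NormedAddCommGroup E] {F : Torus3 → E}
    (hF : AEStronglyMeasurable F volume) :
    AEMeasurable (fun p : Torus3 × E3 => ‖F p.1 - F (p.1 - proj p.2)‖ₑ ^ 3)
      ((volume : Measure Torus3).prod (ballMeasure ε)) := by
  have h1 : Measure.QuasiMeasurePreserving (fun p : Torus3 × E3 => p.1 - proj p.2)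
      ((volume : Measure Torus3).prod (volume : Measure E3)) volume := by
    refine QuasiMeasurePreserving.prod_of_left ?_ (Eventually.of_forall fun y =>
      (measurePreserving_sub_proj y).quasiMeasurePreserving)
    exact (continuous_fst.sub (continuous_proj.comp continuous_snd)).measurable
  have h2 : AEStronglyMeasurable (fun p : Torus3 × E3 => F p.1 - F (p.1 - proj p.2))
      ((volume : Measure Torus3).prod (volume : Measure E3)) :=
    hF.comp_fst.sub (hF.comp_quasiMeasurePreserving h1)
  have h3 : (volume : Measure Torus3).prod (ballMeasure ε) ≪
      (volume : Measure Torus3).prod (volume : Measure E3) := by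
    refine Measure.AbsolutelyContinuous.rfl.prod ?_
    exact Measure.smul_absolutelyContinuous.trans Measure.restrict_le_self.absolutelyContinuous
  exact (h2.mono_ac h3).enorm.pow_const 3

instance : SFinite (ballMeasure ε) := by rw [ballMeasure]; infer_instance

lemma aemeasurable_osc {E : Type*} [NormedAddCommGroup E] {F : Torus3 → E}
    (hF : AEStronglyMeasurable F volume) : AEMeasurable (osc ε F) volume :=
  (aemeasurable_sub_proj_prod hF).lintegral_prod_right'

lemma osc_apply_le (F : Torus3 → E3) (j : Fin 3) (x : Torus3) :
    osc ε (fun z => F z j) x ≤ osc ε F x := by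
  refine lintegral_mono fun y => ?_
  gcongr
  rw [← ofReal_norm, ← ofReal_norm]
  exact ENNReal.ofReal_le_ofReal (PiLp.norm_apply_le (F x - F (x - proj y)) j)

/-- The space integral of the local oscillation. -/
noncomputable def oscInt {E : Type*} [NormedAddCommGroup E] (ε : ℝ) (f : Torus3 → E) : ℝ≥0∞ :=
  ∫⁻ x, osc ε f x

lemma meanOscillation_three (ε : ℝ) (F : Torus3 → E3) :
    meanOscillation 3 ε F = (oscInt ε F) ^ (1 / 3 : ℝ) := by
  rw [meanOscillation, oscInt]
  simp only [osc, setLAverage_ball_eq]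
  congr! 5
  exact_mod_cast ENNReal.rpow_natCast _ 3

lemma memLp_apply {F : Torus3 → E3} {p : ℝ≥0∞} (hF : MemLp F p volume) (j : Fin 3) :
    MemLp (fun x => F x j) p volume :=
  hF.of_le ((PiLp.continuous_apply 2 _ j).comp_aestronglyMeasurable hF.1)
    (Eventually.of_forall fun _ => PiLp.norm_apply_le _ _)

/-- Integrated commutator estimate for components of vector fields. -/
lemma IsUnitKernel.exists_enorm_integral_commut_mul_le (hk : IsUnitKernel k)
    (h0 : ∫ y, k y = 0) :
    ∃ C : ℝ≥0∞, C ≠ ⊤ ∧ ∀ ε, 0 < ε → ∀ a b c : Torus3 → E3,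
      MemLp a 2 volume → MemLp b 2 volume → MemLp c 2 volume → ∀ i j l : Fin 3,
      ‖∫ x, commut ε (fun z => a z i) (fun z => b z j) x * conv (scale ε k) (fun z => c z l) x‖ₑ
        ≤ C * (oscInt ε a + oscInt ε b + oscInt ε c) := by
  obtain ⟨C, hC, h⟩ := hk.exists_enorm_commut_mul_le h0
  refine ⟨C, hC, fun ε hε a b c ha hb hc i j l => ?_⟩
  refine (enorm_integral_le_lintegral_enorm _).trans ?_
  refine (lintegral_mono fun _ => h ε hε _ _ _ (memLp_apply ha i) (memLp_apply hb j)
    (memLp_apply hc l) _).trans ?_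
  rw [lintegral_const_mul' _ _ hC]
  gcongr
  have hab : AEMeasurable (fun x => osc ε a x + osc ε b x) volume :=
    (aemeasurable_osc ha.1).add (aemeasurable_osc hb.1)
  rw [oscInt, oscInt, oscInt, ← lintegral_add_left' (aemeasurable_osc ha.1),
    ← lintegral_add_left' hab]
  exact lintegral_mono fun x => add_le_add (add_le_add (osc_apply_le a i x) (osc_apply_le b j x))
    (osc_apply_le c l x)

end HallMHD

/-! ### Increments and cubic oscillations of Sobolev and Besov fields. -/

namespace HallMHD

variable {f g : Torus3 → ℝ} {ε : ℝ}

/-! ### Sobolev-type estimates on the torus -/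

lemma norm_fderiv_comp_proj_le (hf : SmoothScalar f) (z : E3) :
    ‖fderiv ℝ (fun y : E3 => f (proj y)) z‖ ≤ ∑ i, |pderiv i f (proj z)| := by
  refine ContinuousLinearMap.opNorm_le_bound _ (Finset.sum_nonneg fun i _ => abs_nonneg _)
    fun v => ?_
  have hv : v = ∑ i, v i • EuclideanSpace.single i (1 : ℝ) := by
    ext j
    simp [Finset.sum_apply, Pi.single_apply]
  conv_lhs => rw [hv]
  rw [map_sum, Finset.sum_mul]
  refine (norm_sum_le _ _).trans (Finset.sum_le_sum fun i _ => ?_)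
  rw [map_smul, norm_smul, ← hf.pderiv_proj, Real.norm_eq_abs (pderiv _ _ _), mul_comm]
  exact mul_le_mul_of_nonneg_left (PiLp.norm_apply_le v i) (abs_nonneg _)

/-- The fundamental theorem of calculus along the segment of direction −y, Jensen in the parameter
s, and Cauchy–Schwarz for the three partial derivatives, which is where the 3 comes from. -/
lemma sq_sub_proj_le (hf : SmoothScalar f) (x : Torus3) (y : E3) :
    (f (x - proj y) - f x) ^ 2 ≤
      ‖y‖ ^ 2 * (3 * ∫ s in (0 : ℝ)..1, ∑ i, (pderiv i f (x - proj (s • y))) ^ 2) := by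
  obtain ⟨z, rfl⟩ := proj_surjective x
  set F : E3 → ℝ := fun y => f (proj y) with hF
  have hFs : ContDiff ℝ (⊤ : ℕ∞) F := hf
  have hd : ∀ s : ℝ, HasDerivAt (fun s : ℝ => F (z - s • y)) (- fderiv ℝ F (z - s • y) y) s := by
    intro s
    have h1 : HasFDerivAt F (fderiv ℝ F (z - s • y)) (z - s • y) :=
      (hFs.differentiable (by simp)).differentiableAt.hasFDerivAt
    have h2 : HasDerivAt (fun s : ℝ => z - s • y) (-y) s := by
      simpa using ((hasDerivAt_id s).smul_const y).const_sub z
    have h3 := h1.comp_hasDerivAt s h2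
    rwa [map_neg] at h3
  have hc : Continuous fun s : ℝ => fderiv ℝ F (z - s • y) y :=
    ((hFs.continuous_fderiv (by simp)).comp (by fun_prop)).clm_apply continuous_const
  have hci : ∀ i, Continuous fun s : ℝ => pderiv i f (proj z - proj (s • y)) := fun i =>
    (hf.pderiv i).continuous.comp
      (continuous_const.sub (continuous_proj.comp (continuous_id.smul continuous_const)))
  have e1 : f (proj z - proj y) - f (proj z) = ∫ s in (0 : ℝ)..1, - fderiv ℝ F (z - s • y) y := by
    rw [intervalIntegral.integral_eq_sub_of_hasDerivAt (fun s _ => hd s)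
      (hc.neg.intervalIntegrable _ _)]
    simp [hF, proj_sub]
  have hpt : ∀ s : ℝ, (fderiv ℝ F (z - s • y) y) ^ 2 ≤
      ‖y‖ ^ 2 * (3 * ∑ i, (pderiv i f (proj z - proj (s • y))) ^ 2) := by
    intro s
    have h1 := (fderiv ℝ F (z - s • y)).le_opNorm y
    have h2 := norm_fderiv_comp_proj_le hf (z - s • y)
    rw [proj_sub] at h2
    have h3 : (∑ i, |pderiv i f (proj z - proj (s • y))|) ^ 2 ≤
        3 * ∑ i, (pderiv i f (proj z - proj (s • y))) ^ 2 := by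
      have := sq_sum_le_card_mul_sum_sq (s := (Finset.univ : Finset (Fin 3)))
        (f := fun i => |pderiv i f (proj z - proj (s • y))|)
      simpa [sq_abs] using this
    calc (fderiv ℝ F (z - s • y) y) ^ 2 = ‖fderiv ℝ F (z - s • y) y‖ ^ 2 := by
          rw [Real.norm_eq_abs, sq_abs]
      _ ≤ ((∑ i, |pderiv i f (proj z - proj (s • y))|) * ‖y‖) ^ 2 := by
          refine pow_le_pow_left₀ (norm_nonneg _) (h1.trans ?_) 2
          exact mul_le_mul_of_nonneg_right h2 (norm_nonneg _)
      _ ≤ _ := by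
          rw [mul_pow, mul_comm]
          exact mul_le_mul_of_nonneg_left h3 (sq_nonneg _)
  rw [e1, intervalIntegral.integral_neg, neg_sq]
  have hjen : (∫ s in (0 : ℝ)..1, fderiv ℝ F (z - s • y) y) ^ 2 ≤
      ∫ s in (0 : ℝ)..1, (fderiv ℝ F (z - s • y) y) ^ 2 := by
    set m := ∫ s in (0 : ℝ)..1, fderiv ℝ F (z - s • y) y with hm
    have h0 : 0 ≤ ∫ s in (0 : ℝ)..1, (fderiv ℝ F (z - s • y) y - m) ^ 2 :=
      intervalIntegral.integral_nonneg zero_le_one fun s _ => sq_nonneg _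
    have e : (fun s : ℝ => (fderiv ℝ F (z - s • y) y - m) ^ 2) = fun s =>
        ((fderiv ℝ F (z - s • y) y) ^ 2 - 2 * m * fderiv ℝ F (z - s • y) y) + m ^ 2 := by
      funext s; ring
    rw [e, intervalIntegral.integral_add (Continuous.intervalIntegrable (by fun_prop) _ _)
      (by simp), intervalIntegral.integral_sub (Continuous.intervalIntegrable (by fun_prop) _ _)
      (Continuous.intervalIntegrable (by fun_prop) _ _), intervalIntegral.integral_const_mul,
      ← hm] at h0
    simp only [intervalIntegral.integral_const, sub_zero, one_smul] at h0
    nlinarith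
  refine hjen.trans ?_
  rw [← intervalIntegral.integral_const_mul, ← intervalIntegral.integral_const_mul]
  refine intervalIntegral.integral_mono_on zero_le_one (Continuous.intervalIntegrable (by fun_prop) _ _)
    (Continuous.intervalIntegrable (by fun_prop) _ _) fun s _ => hpt s

lemma integral_sq_sub_proj_le (hf : SmoothScalar f) (y : E3) :
    ∫ x, (f (x - proj y) - f x) ^ 2 ≤ ‖y‖ ^ 2 * (3 * ∑ i, ∫ x, (pderiv i f x) ^ 2) := by
  have hS : SmoothScalar fun x => ∑ i, (pderiv i f x) ^ 2 := by
    simp only [sq]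
    exact SmoothScalar.sum fun i _ => (hf.pderiv i).mul (hf.pderiv i)
  set S : Torus3 → ℝ := fun x => ∑ i, (pderiv i f x) ^ 2 with hSd
  have hint : ∫ x, S x = ∑ i, ∫ x, (pderiv i f x) ^ 2 :=
    integral_finsetSum _ fun i _ => ((hf.pderiv i).memLp 2).integrable_sq
  have hcont : Continuous fun p : Torus3 × ℝ => S (p.1 - proj (p.2 • y)) :=
    hS.continuous.comp (continuous_fst.sub (continuous_proj.comp (continuous_snd.smul continuous_const)))
  obtain ⟨C, -, hC⟩ := exists_norm_le_of_continuous hS.continuous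
  have hprod : Integrable (fun p : Torus3 × ℝ => S (p.1 - proj (p.2 • y)))
      ((volume : Measure Torus3).prod (volume.restrict (Ioc (0 : ℝ) 1))) :=
    Integrable.of_bound hcont.aestronglyMeasurable C (Eventually.of_forall fun p => hC _)
  have hfub : ∫ x, ∫ s in (0 : ℝ)..1, S (x - proj (s • y)) = ∫ x, S x := by
    simp only [intervalIntegral.integral_of_le zero_le_one]
    rw [integral_integral_swap hprod]
    simp_rw [integral_sub_right_eq_self S]
    simp
  have hcl : Continuous fun x => (f (x - proj y) - f x) ^ 2 :=
    ((hf.continuous.comp (continuous_id.sub continuous_const)).sub hf.continuous).pow 2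
  rw [← hint, ← hfub, ← integral_const_mul, ← integral_const_mul]
  refine integral_mono ?_ ?_ fun x => sq_sub_proj_le hf x y
  · have := hcl.continuousOn.integrableOn_compact (μ := volume) (isCompact_univ (X := Torus3))
    rwa [integrableOn_univ] at this
  · have := hprod.integral_prod_left
    simp only [intervalIntegral.integral_of_le zero_le_one]
    exact (this.const_mul 3).const_mul _

lemma eLpNorm_two_le_of_integral_sq_le {a b : Torus3 → ℝ} (ha : MemLp a 2 volume)
    (hb : MemLp b 2 volume) (h : ∫ x, a x ^ 2 ≤ ∫ x, b x ^ 2) :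
    eLpNorm a 2 volume ≤ eLpNorm b 2 volume := by
  rw [ha.eLpNorm_eq_integral_rpow_norm (by norm_num) (by norm_num),
    hb.eLpNorm_eq_integral_rpow_norm (by norm_num) (by norm_num)]
  simp only [ENNReal.toReal_ofNat, Real.norm_eq_abs, Real.rpow_two, sq_abs]
  refine ENNReal.ofReal_le_ofReal (Real.rpow_le_rpow (integral_nonneg fun x => sq_nonneg _) h
    (by norm_num))

lemma eLpNorm_two_conv_rho_le (hε : 0 < ε) (hf : MemLp f 2 volume) :
    eLpNorm (conv (rho ε) f) 2 volume ≤ eLpNorm f 2 volume :=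
  eLpNorm_two_le_of_integral_sq_le
    (((isKernel_rho hε).smooth_conv (MemLp.integrable_two hf)).memLp 2) hf
    (integral_sq_conv_rho_le hε hf)

/-- Along a sequence of scales, mollifications converge almost everywhere. -/
lemma exists_seq_tendsto_ae_conv_rho (hf : MemLp f 2 volume) :
    ∃ e : ℕ → ℝ, (∀ n, 0 < e n) ∧
      ∀ᵐ x, Tendsto (fun n => conv (rho (e n)) f x) atTop (𝓝 (f x)) := by
  have h1 := (tendsto_integral_sq_conv_rho_sub hf)
  set e0 : ℕ → ℝ := fun n => 1 / ((n : ℝ) + 1) with he0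
  have he0p : ∀ n, 0 < e0 n := fun n => by positivity
  have h2 : Tendsto e0 atTop (𝓝[>] 0) :=
    tendsto_nhdsWithin_iff.2 ⟨tendsto_one_div_add_atTop_nhds_zero_nat,
      Eventually.of_forall he0p⟩
  have hm : ∀ n, MemLp (fun x => conv (rho (e0 n)) f x - f x) 2 volume := fun n =>
    (((isKernel_rho (he0p n)).smooth_conv (MemLp.integrable_two hf)).memLp 2).sub hf
  have h3 : Tendsto (fun n => eLpNorm (fun x => conv (rho (e0 n)) f x - f x) 2 volume) atTop
      (𝓝 0) := by
    have h4 := ENNReal.tendsto_ofReal ((h1.comp h2).sqrt)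
    rw [Real.sqrt_zero, ENNReal.ofReal_zero] at h4
    refine h4.congr fun n => ?_
    rw [(hm n).eLpNorm_eq_integral_rpow_norm (by norm_num) (by norm_num)]
    simp [Real.sqrt_eq_rpow]
  have h5 : TendstoInMeasure volume (fun n => conv (rho (e0 n)) f) atTop f :=
    tendstoInMeasure_of_tendsto_eLpNorm (p := 2) (by norm_num)
      (fun n => ((isKernel_rho (he0p n)).smooth_conv (MemLp.integrable_two hf)).continuous.aestronglyMeasurable) hf.1 h3
  obtain ⟨ns, -, hns⟩ := h5.exists_seq_tendsto_ae
  exact ⟨fun n => e0 (ns n), fun n => he0p _, hns⟩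

/-- The smooth estimate is applied to mollifications, whose gradients are no larger in L², and
passes to the limit by Fatou along a sequence converging almost everywhere. -/
lemma eLpNorm_sub_proj_le {D : Fin 3 → Torus3 → ℝ} (hf : MemLp f 2 volume)
    (hD : ∀ i, MemLp (D i) 2 volume) (h : ∀ i, HasWeakPartial i f (D i)) (y : E3) :
    eLpNorm (fun x => f (x - proj y) - f x) 2 volume ≤
      ENNReal.ofReal (‖y‖ * √(3 * ∑ i, ∫ x, (D i x) ^ 2)) := by
  obtain ⟨e, he, hae⟩ := exists_seq_tendsto_ae_conv_rho hf
  have hs : ∀ n, SmoothScalar (conv (rho (e n)) f) := fun n =>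
    (isKernel_rho (he n)).smooth_conv (MemLp.integrable_two hf)
  have hcont : ∀ n, Continuous fun x => conv (rho (e n)) f (x - proj y) - conv (rho (e n)) f x :=
    fun n => ((hs n).continuous.comp (continuous_id.sub continuous_const)).sub (hs n).continuous
  have hlim : ∀ᵐ x, Tendsto (fun n => conv (rho (e n)) f (x - proj y) - conv (rho (e n)) f x)
      atTop (𝓝 (f (x - proj y) - f x)) := by
    filter_upwards [hae, (measurePreserving_sub_proj y).quasiMeasurePreserving.ae hae] with x h1 h2
    exact h2.sub h1
  refine (Lp.eLpNorm_lim_le_liminf_eLpNorm (fun n => (hcont n).aestronglyMeasurable) _ hlim).trans ?_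
  refine liminf_le_of_le (by isBoundedDefault) fun b hb => ?_
  obtain ⟨n, hn⟩ := hb.exists
  refine hn.trans ?_
  have hm : MemLp (fun x => conv (rho (e n)) f (x - proj y) - conv (rho (e n)) f x) 2 volume := by
    obtain ⟨C, -, hC⟩ := exists_norm_le_of_continuous (hcont n)
    exact MemLp.of_bound (hcont n).aestronglyMeasurable C (Eventually.of_forall hC)
  rw [hm.eLpNorm_eq_integral_rpow_norm (by norm_num) (by norm_num)]
  simp only [ENNReal.toReal_ofNat, Real.norm_eq_abs, Real.rpow_two, sq_abs, ← one_div,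
    ← Real.sqrt_eq_rpow]
  refine ENNReal.ofReal_le_ofReal ?_
  rw [← Real.sqrt_sq (norm_nonneg y), ← Real.sqrt_mul (sq_nonneg _)]
  refine Real.sqrt_le_sqrt ((integral_sq_sub_proj_le (hs n) y).trans ?_)
  refine mul_le_mul_of_nonneg_left (mul_le_mul_of_nonneg_left
    (Finset.sum_le_sum fun i _ => ?_) (by norm_num)) (sq_nonneg _)
  rw [(h i).pderiv_conv (he n) (MemLp.integrable_two hf) (MemLp.integrable_two (hD i))]
  exact integral_sq_conv_rho_le (he n) (hD i)

/-- The lift to ℝ³ is cut off outside a neighbourhood of one cell and the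
Gagliardo–Nirenberg–Sobolev inequality of ℝ³ with exponents 2 and 6 is applied. The derivative of
the cut-off accounts for the L² norm of v itself. -/
lemma exists_eLpNorm_six_le_of_smooth :
    ∃ C : ℝ≥0∞, C ≠ ⊤ ∧ ∀ v : Torus3 → ℝ, SmoothScalar v →
      eLpNorm v 6 volume ≤ C * (eLpNorm v 2 volume + ∑ i, eLpNorm (pderiv i v) 2 volume) := by
  -- The unit cell at the origin has points of norm at most √3 < 2, so the cut-off equals 1 on it.
  let χ : ContDiffBump (0 : E3) := ⟨2, 3, by norm_num, by norm_num⟩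
  have hχs : ContDiff ℝ (⊤ : ℕ∞) χ := χ.contDiff
  have hχc : HasCompactSupport χ := χ.hasCompactSupport
  obtain ⟨n, hn⟩ := exists_map_proj_restrict_le (K := tsupport χ) hχc
  obtain ⟨A, hA⟩ := (hχc.fderiv (𝕜 := ℝ)).exists_bound_of_continuous (hχs.continuous_fderiv (by simp))
  have hA0 : 0 ≤ A := (norm_nonneg _).trans (hA 0)
  let S : ℝ≥0∞ := SNormLESNormFDerivOfEqConst ℝ (volume : Measure E3) 2
  -- `A + 1` comes from the product rule with |χ| ≤ 1 and |∇χ| ≤ A; the square root of `n` from the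
  -- multiplicity with which the support of the cut-off covers the torus, measured in L².
  refine ⟨S * (ENNReal.ofReal (A + 1) * (n : ℝ≥0∞) ^ (1 / 2 : ℝ)), ?_, fun v hv => ?_⟩
  · refine ENNReal.mul_ne_top ENNReal.coe_ne_top (ENNReal.mul_ne_top ENNReal.ofReal_ne_top ?_)
    exact ENNReal.rpow_ne_top_of_nonneg (by norm_num) (by simp)
  set V : E3 → ℝ := fun y => v (proj y) with hV
  have hVs : ContDiff ℝ (⊤ : ℕ∞) V := hv
  set W : E3 → ℝ := fun y => χ y * V y with hW
  have hWs : ContDiff ℝ 1 W := contDiff_infty.1 (hχs.mul hVs) 1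
  have hWc : HasCompactSupport W := hχc.mul_right
  have hgns := eLpNorm_le_eLpNorm_fderiv_of_eq (μ := (volume : Measure E3)) (p := 2) (p' := 6)
    hWs hWc (by norm_num) (by simp) (by simp; norm_num)
  set M : Torus3 → ℝ := fun x => |v x| + ∑ i, |pderiv i v x| with hM
  have hMc : Continuous M := hv.continuous.abs.add
    (continuous_finsetSum _ fun i _ => (hv.pderiv i).continuous.abs)
  have hMn : ∀ x, 0 ≤ M x := fun x =>
    add_nonneg (abs_nonneg _) (Finset.sum_nonneg fun i _ => abs_nonneg _)
  have hbd : ∀ y, ‖fderiv ℝ W y‖ ≤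
      (A + 1) * ‖(tsupport χ).indicator (fun y => M (proj y)) y‖ := by
    intro y
    by_cases hy : y ∈ tsupport χ
    · rw [indicator_of_mem hy, Real.norm_eq_abs, abs_of_nonneg (hMn _)]
      have e : fderiv ℝ W y = χ y • fderiv ℝ V y + V y • fderiv ℝ χ y :=
        fderiv_fun_mul (hχs.differentiable (by simp)).differentiableAt
          (hVs.differentiable (by simp)).differentiableAt
      rw [e]
      have h1 := norm_fderiv_comp_proj_le hv y
      have h2 : |χ y| ≤ 1 := by rw [abs_of_nonneg χ.nonneg]; exact χ.le_one
      have h3 := hA y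
      have h4 : 0 ≤ ∑ i, |pderiv i v (proj y)| := Finset.sum_nonneg fun i _ => abs_nonneg _
      calc ‖χ y • fderiv ℝ V y + V y • fderiv ℝ χ y‖
          ≤ |χ y| * ‖fderiv ℝ V y‖ + |V y| * ‖fderiv ℝ χ y‖ := by
            refine (norm_add_le _ _).trans_eq ?_
            rw [norm_smul, norm_smul, Real.norm_eq_abs, Real.norm_eq_abs]
        _ ≤ 1 * (∑ i, |pderiv i v (proj y)|) + |V y| * A := by gcongr
        _ ≤ (A + 1) * M (proj y) := by
            simp only [hM, hV]
            nlinarith [abs_nonneg (v (proj y)), mul_nonneg hA0 h4]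
    · have : y ∉ tsupport (fderiv ℝ W) := fun h =>
        hy ((tsupport_mul_subset_left) (tsupport_fderiv_subset ℝ h))
      rw [image_eq_zero_of_notMem_tsupport this, norm_zero]
      positivity
  have h1 : eLpNorm v 6 volume ≤ eLpNorm W 6 volume := by
    have hmp := measurePreserving_proj (fun _ => 0)
    rw [← eLpNorm_comp_measurePreserving hv.continuous.aestronglyMeasurable hmp]
    have hme : MeasurableSet {y : E3 | ∀ i, y i ∈ Ioc ((fun _ => (0:ℝ)) i) ((fun _ => (0:ℝ)) i + 1)} := by
      have : {y : E3 | ∀ i, y i ∈ Ioc ((fun _ => (0:ℝ)) i) ((fun _ => (0:ℝ)) i + 1)} =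
        ⋂ i, {y : E3 | y i ∈ Ioc (0 : ℝ) (0 + 1)} := by ext; simp
      rw [this]
      exact MeasurableSet.iInter fun i => (PiLp.continuous_apply 2 _ i).measurable measurableSet_Ioc
    refine (eLpNorm_congr_ae (g := W) ?_).trans_le (eLpNorm_mono_measure _ Measure.restrict_le_self)
    filter_upwards [ae_restrict_mem hme] with y hy
    have : χ y = 1 := by
      refine χ.one_of_mem_closedBall ?_
      rw [mem_closedBall_zero_iff]
      change ‖y‖ ≤ 2
      rw [EuclideanSpace.norm_eq]
      refine Real.sqrt_le_iff.2 ⟨by norm_num, ?_⟩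
      rw [Fin.sum_univ_three]
      have hb : ∀ i, ‖y i‖ ^ 2 ≤ 1 := by
        intro i
        rw [Real.norm_eq_abs, sq_abs]
        have := hy i
        simp only [zero_add, mem_Ioc] at this
        nlinarith [this.1, this.2]
      linarith [hb 0, hb 1, hb 2]
    simp [hW, hV, this]
  have h2 : eLpNorm (fderiv ℝ W) 2 volume ≤
      ENNReal.ofReal (A + 1) * ((n : ℝ≥0∞) ^ (1 / 2 : ℝ) * eLpNorm M 2 volume) := by
    refine (eLpNorm_le_mul_eLpNorm_of_ae_le_mul (Eventually.of_forall hbd) 2).trans ?_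
    gcongr
    rw [eLpNorm_indicator_eq_eLpNorm_restrict (isClosed_tsupport _).measurableSet]
    have e : eLpNorm (fun y => M (proj y)) 2 (volume.restrict (tsupport χ)) =
        eLpNorm M 2 (Measure.map proj (volume.restrict (tsupport χ))) :=
      (eLpNorm_map_measure hMc.aestronglyMeasurable measurable_proj.aemeasurable).symm
    rw [e]
    refine (eLpNorm_mono_measure _ hn).trans ?_
    rw [eLpNorm_smul_measure_of_ne_top (by norm_num)]
    simp
  have h3 : eLpNorm M 2 volume ≤ eLpNorm v 2 volume + ∑ i, eLpNorm (pderiv i v) 2 volume := by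
    have a1 := eLpNorm_add_le (μ := volume) (p := 2) (f := fun x => |v x|)
      (g := fun x => ∑ i, |pderiv i v x|) hv.continuous.abs.aestronglyMeasurable
      (continuous_finsetSum _ fun i _ => (hv.pderiv i).continuous.abs).aestronglyMeasurable
      (by norm_num)
    refine a1.trans (add_le_add ?_ ?_)
    · exact (eLpNorm_norm v).le
    · have a2 := eLpNorm_sum_le (μ := volume) (p := 2) (s := Finset.univ)
        (f := fun i x => |pderiv i v x|)
        (fun i _ => (hv.pderiv i).continuous.abs.aestronglyMeasurable) (by norm_num)
      have e : (fun x => ∑ i, |pderiv i v x|) = ∑ i, fun x => |pderiv i v x| := by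
        funext x; simp [Finset.sum_apply]
      rw [e]
      refine a2.trans (Finset.sum_le_sum fun i _ => ?_)
      exact (eLpNorm_norm (pderiv i v)).le
  calc eLpNorm v 6 volume ≤ S * (ENNReal.ofReal (A + 1) *
        ((n : ℝ≥0∞) ^ (1 / 2 : ℝ) * eLpNorm M 2 volume)) := by
        exact h1.trans (hgns.trans (mul_le_mul' le_rfl h2))
    _ ≤ _ := by
        rw [← mul_assoc (ENNReal.ofReal (A + 1)), ← mul_assoc]
        gcongr

/-- The Sobolev embedding `H¹(𝕋³) ⊂ L⁶(𝕋³)`. -/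
lemma exists_eLpNorm_six_le :
    ∃ C : ℝ≥0∞, C ≠ ⊤ ∧ ∀ (f : Torus3 → ℝ) (D : Fin 3 → Torus3 → ℝ), MemLp f 2 volume →
      (∀ i, MemLp (D i) 2 volume) → (∀ i, HasWeakPartial i f (D i)) →
      eLpNorm f 6 volume ≤ C * (eLpNorm f 2 volume + ∑ i, eLpNorm (D i) 2 volume) := by
  obtain ⟨C, hC, hS⟩ := exists_eLpNorm_six_le_of_smooth
  refine ⟨C, hC, fun f D hf hD h => ?_⟩
  obtain ⟨e, he, hae⟩ := exists_seq_tendsto_ae_conv_rho hf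
  have hs : ∀ n, SmoothScalar (conv (rho (e n)) f) := fun n =>
    (isKernel_rho (he n)).smooth_conv (MemLp.integrable_two hf)
  refine (Lp.eLpNorm_lim_le_liminf_eLpNorm
    (fun n => (hs n).continuous.aestronglyMeasurable) _ hae).trans ?_
  refine liminf_le_of_le (by isBoundedDefault) fun b hb => ?_
  obtain ⟨n, hn⟩ := hb.exists
  refine (hn.trans (hS _ (hs n))).trans ?_
  gcongr with i
  · exact eLpNorm_two_conv_rho_le (he n) hf
  · rw [(h i).pderiv_conv (he n) (MemLp.integrable_two hf) (MemLp.integrable_two (hD i))]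
    exact eLpNorm_two_conv_rho_le (he n) (hD i)

/-- Interpolation: write |f|³ as |f|^{3/2}·|f|^{3/2} and apply Hölder with exponents 4/3 and 4. -/
lemma lintegral_pow_three_le_eLpNorm {α : Type*} [MeasurableSpace α] {μ : Measure α} {f : α → ℝ}
    (hf : AEStronglyMeasurable f μ) :
    ∫⁻ x, ‖f x‖ₑ ^ 3 ∂μ ≤ eLpNorm f 2 μ ^ (3 / 2 : ℝ) * eLpNorm f 6 μ ^ (3 / 2 : ℝ) := by
  have hpq : (4 / 3 : ℝ).HolderConjugate 4 := by constructor <;> norm_num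
  have ha : AEMeasurable (fun x => ‖f x‖ₑ ^ (3 / 2 : ℝ)) μ := hf.enorm.pow_const _
  have h := ENNReal.lintegral_mul_le_Lp_mul_Lq μ hpq ha ha
  simp only [Pi.mul_apply, ← ENNReal.rpow_mul] at h
  rw [eLpNorm_eq_lintegral_rpow_enorm_toReal (by norm_num) (by norm_num),
    eLpNorm_eq_lintegral_rpow_enorm_toReal (by norm_num) (by norm_num), ← ENNReal.rpow_mul,
    ← ENNReal.rpow_mul]
  norm_num at h ⊢
  refine le_trans (le_of_eq (lintegral_congr fun x => ?_)) h
  rw [← ENNReal.rpow_add_of_nonneg _ _ (by norm_num) (by norm_num)]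
  norm_num

lemma ae_ballMeasure_mem (ε : ℝ) : ∀ᵐ y ∂(ballMeasure ε), y ∈ Metric.ball (0 : E3) ε :=
  Measure.ae_smul_measure (ae_restrict_mem measurableSet_ball) _

/-- An upper bound for the translates of `F` in `L³` bounds the integrated oscillation. -/
lemma oscInt_le_of_forall {E : Type*} [NormedAddCommGroup E] {F : Torus3 → E}
    (hF : AEStronglyMeasurable F volume) (hε : 0 < ε) {B : ℝ≥0∞}
    (h : ∀ y ∈ Metric.ball (0 : E3) ε, ∫⁻ x, ‖F x - F (x - proj y)‖ₑ ^ 3 ≤ B) :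
    oscInt ε F ≤ B := by
  have := isProbabilityMeasure_ballMeasure hε
  simp only [oscInt, osc]
  rw [lintegral_lintegral_swap (aemeasurable_sub_proj_prod hF)]
  calc _ ≤ ∫⁻ _, B ∂(ballMeasure ε) := by
        refine lintegral_mono_ae ?_
        filter_upwards [ae_ballMeasure_mem ε] with y hy using h y hy
    _ = B := by simp

/-- Increments of an H¹ function are O(|y|) in L² and bounded in L⁶, so their cubic integral is
O(|y|^{3/2}). The exponent exceeds 1, and this surplus is what beats the factor ε⁻¹ in the flux. -/
lemma exists_oscInt_le {D : Fin 3 → Torus3 → ℝ} (hf : MemLp f 2 volume)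
    (hD : ∀ i, MemLp (D i) 2 volume) (h : ∀ i, HasWeakPartial i f (D i)) :
    ∃ K : ℝ≥0∞, K ≠ ⊤ ∧ ∀ ε, 0 < ε → oscInt ε f ≤ K * ENNReal.ofReal ε ^ (3 / 2 : ℝ) := by
  obtain ⟨C, hC, h6⟩ := exists_eLpNorm_six_le
  have h6f : eLpNorm f 6 volume < ⊤ := by
    refine (h6 f D hf hD h).trans_lt (ENNReal.mul_lt_top hC.lt_top (ENNReal.add_lt_top.2 ⟨hf.2, ?_⟩))
    exact ENNReal.sum_lt_top.2 fun i _ => (hD i).2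
  set G := √(3 * ∑ i, ∫ x, (D i x) ^ 2) with hG
  refine ⟨ENNReal.ofReal G ^ (3 / 2 : ℝ) * (2 * eLpNorm f 6 volume) ^ (3 / 2 : ℝ), ?_,
    fun ε hε => oscInt_le_of_forall hf.1 hε fun y hy => ?_⟩
  · refine ENNReal.mul_ne_top ?_ ?_ <;> refine ENNReal.rpow_ne_top_of_nonneg (by norm_num) ?_
    · exact ENNReal.ofReal_ne_top
    · exact ENNReal.mul_ne_top (by norm_num) h6f.ne
  have hmp := measurePreserving_sub_proj y
  have hm : AEStronglyMeasurable (fun x => f (x - proj y)) volume :=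
    hf.1.comp_measurePreserving hmp
  have hy' : ‖y‖ ≤ ε := by
    rw [mem_ball_zero_iff] at hy; exact hy.le
  have b2 : eLpNorm (fun x => f (x - proj y) - f x) 2 volume ≤
      ENNReal.ofReal ε * ENNReal.ofReal G := by
    refine (eLpNorm_sub_proj_le hf hD h y).trans ?_
    rw [← ENNReal.ofReal_mul hε.le]
    exact ENNReal.ofReal_le_ofReal (mul_le_mul_of_nonneg_right hy' (Real.sqrt_nonneg _))
  have b6 : eLpNorm (fun x => f (x - proj y) - f x) 6 volume ≤ 2 * eLpNorm f 6 volume := by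
    refine (eLpNorm_sub_le hm hf.1 (by norm_num)).trans ?_
    have : eLpNorm (fun x => f (x - proj y)) 6 volume = eLpNorm f 6 volume :=
      eLpNorm_comp_measurePreserving hf.1 hmp
    rw [this, two_mul]
  calc ∫⁻ x, ‖f x - f (x - proj y)‖ₑ ^ 3 = ∫⁻ x, ‖f (x - proj y) - f x‖ₑ ^ 3 := by
        simp only [enorm_sub_rev (f (_ - _))]
    _ ≤ _ := lintegral_pow_three_le_eLpNorm (hm.sub hf.1)
    _ ≤ (ENNReal.ofReal ε * ENNReal.ofReal G) ^ (3 / 2 : ℝ) *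
          (2 * eLpNorm f 6 volume) ^ (3 / 2 : ℝ) := by gcongr
    _ = _ := by
        rw [ENNReal.mul_rpow_of_nonneg _ _ (by norm_num : (0 : ℝ) ≤ 3 / 2)]
        ring

lemma ENNReal_add_add_pow_three_le (x y z : ℝ≥0∞) :
    (x + y + z) ^ 3 ≤ 27 * (x ^ 3 + y ^ 3 + z ^ 3) := by
  set m := max x (max y z) with hm
  have h1 : x + y + z ≤ 3 * m := by
    have : (3 : ℝ≥0∞) * m = m + m + m := by ring
    rw [this]
    exact add_le_add (add_le_add (le_max_left _ _) ((le_max_left _ _).trans (le_max_right _ _)))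
      ((le_max_right _ _).trans (le_max_right _ _))
  have h2 : m ^ 3 ≤ x ^ 3 + y ^ 3 + z ^ 3 := by
    rcases max_choice x (max y z) with h | h
    · rw [hm, h, add_assoc]; exact le_self_add
    · rcases max_choice y z with h' | h' <;> rw [hm, h, h']
      · rw [add_comm (x ^ 3), add_assoc]; exact le_self_add
      · exact le_add_self
  calc (x + y + z) ^ 3 ≤ (3 * m) ^ 3 := by gcongr
    _ = 27 * m ^ 3 := by rw [mul_pow]; norm_num
    _ ≤ _ := by gcongr

lemma enorm_le_sum_apply (v : E3) : ‖v‖ₑ ≤ ‖v 0‖ₑ + ‖v 1‖ₑ + ‖v 2‖ₑ := by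
  have hv : v = ∑ i, v i • EuclideanSpace.single i (1 : ℝ) := by
    ext j
    simp [Finset.sum_apply, Pi.single_apply]
  have h : ‖v‖ ≤ ‖v 0‖ + ‖v 1‖ + ‖v 2‖ := by
    conv_lhs => rw [hv]
    refine (norm_sum_le _ _).trans ?_
    simp [Fin.sum_univ_three, norm_smul]
  rw [← ofReal_norm, ← ofReal_norm, ← ofReal_norm, ← ofReal_norm,
    ← ENNReal.ofReal_add (norm_nonneg _) (norm_nonneg _),
    ← ENNReal.ofReal_add (by positivity) (norm_nonneg _)]
  exact ENNReal.ofReal_le_ofReal h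

lemma oscInt_le_sum {F : Torus3 → E3} (hF : AEStronglyMeasurable F volume) :
    oscInt ε F ≤ 27 * (oscInt ε (fun x => F x 0) + oscInt ε (fun x => F x 1)
      + oscInt ε (fun x => F x 2)) := by
  have hj : ∀ j : Fin 3, AEStronglyMeasurable (fun x => F x j) volume := fun j =>
    (PiLp.continuous_apply 2 _ j).comp_aestronglyMeasurable hF
  have hm : ∀ j : Fin 3, AEMeasurable (fun x => osc ε (fun x => F x j) x) volume := fun j =>
    aemeasurable_osc (hj j)
  have hm01 : AEMeasurable (fun x => osc ε (fun x => F x 0) x + osc ε (fun x => F x 1) x) volume :=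
    (hm 0).add (hm 1)
  simp only [oscInt]
  rw [← lintegral_add_left' (hm 0), ← lintegral_add_left' hm01,
    ← lintegral_const_mul' _ _ (by norm_num)]
  refine lintegral_mono fun x => ?_
  have hy : ∀ j : Fin 3, AEMeasurable
      (fun y => ‖F x j - F (x - proj y) j‖ₑ ^ 3) (ballMeasure ε) := fun j => by
    simp only [enorm_sub_rev (F x j)]
    exact (aemeasurable_comp_sub_proj (hj j) x).pow_const 3
  have hy01 : AEMeasurable (fun y => ‖F x 0 - F (x - proj y) 0‖ₑ ^ 3
      + ‖F x 1 - F (x - proj y) 1‖ₑ ^ 3) (ballMeasure ε) := (hy 0).add (hy 1)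
  simp only [osc]
  rw [← lintegral_add_left' (hy 0), ← lintegral_add_left' hy01,
    ← lintegral_const_mul' _ _ (by norm_num)]
  refine lintegral_mono fun y => ?_
  refine le_trans ?_ (ENNReal_add_add_pow_three_le _ _ _)
  gcongr
  exact enorm_le_sum_apply (F x - F (x - proj y))

lemma IsWeakGradient.hasWeakPartial {F : Torus3 → E3} {G : Torus3 → Mat3}
    (h : IsWeakGradient F G) (i j : Fin 3) :
    HasWeakPartial i (fun x => F x j) (fun x => G x (i, j)) := fun ψ hψ => h i j ψ hψ

lemma memLp_apply_matrix {G : Torus3 → Mat3} {p : ℝ≥0∞} (hG : MemLp G p volume)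
    (q : Fin 3 × Fin 3) : MemLp (fun x => G x q) p volume :=
  hG.of_le ((PiLp.continuous_apply 2 _ q).comp_aestronglyMeasurable hG.1)
    (Eventually.of_forall fun _ => PiLp.norm_apply_le _ _)

/-- Vector fields in `H¹` have cubic oscillation `o(ε)`. -/
lemma tendsto_inv_mul_oscInt {F : Torus3 → E3} {G : Torus3 → Mat3} (hF : MemLp F 2 volume)
    (hG : MemLp G 2 volume) (h : IsWeakGradient F G) :
    Tendsto (fun ε : ℝ => ENNReal.ofReal ε⁻¹ * oscInt ε F) (𝓝[>] 0) (𝓝 0) := by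
  choose K hK hKb using fun j => exists_oscInt_le (memLp_apply hF j)
    (fun i => memLp_apply_matrix hG (i, j)) (fun i => h.hasWeakPartial i j)
  set B : ℝ≥0∞ := 27 * (K 0 + K 1 + K 2) with hB
  have hBt : B ≠ ⊤ := by
    have := hK 0; have := hK 1; have := hK 2
    finiteness
  have hle : ∀ ε : ℝ, 0 < ε →
      ENNReal.ofReal ε⁻¹ * oscInt ε F ≤ B * ENNReal.ofReal (ε ^ (1 / 2 : ℝ)) := by
    intro ε hε
    have e : ENNReal.ofReal ε⁻¹ * ENNReal.ofReal ε ^ (3 / 2 : ℝ) =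
        ENNReal.ofReal (ε ^ (1 / 2 : ℝ)) := by
      rw [ENNReal.ofReal_rpow_of_pos hε, ← ENNReal.ofReal_mul (by positivity),
        ← Real.rpow_neg_one, ← Real.rpow_add hε]
      norm_num
    calc ENNReal.ofReal ε⁻¹ * oscInt ε F
        ≤ ENNReal.ofReal ε⁻¹ * (27 * (K 0 * ENNReal.ofReal ε ^ (3 / 2 : ℝ)
          + K 1 * ENNReal.ofReal ε ^ (3 / 2 : ℝ) + K 2 * ENNReal.ofReal ε ^ (3 / 2 : ℝ))) := by
          refine mul_le_mul' le_rfl ((oscInt_le_sum hF.1).trans ?_)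
          gcongr
          exacts [hKb 0 ε hε, hKb 1 ε hε, hKb 2 ε hε]
      _ = B * (ENNReal.ofReal ε⁻¹ * ENNReal.ofReal ε ^ (3 / 2 : ℝ)) := by rw [hB]; ring
      _ = _ := by rw [e]
  have hlim : Tendsto (fun ε : ℝ => B * ENNReal.ofReal (ε ^ (1 / 2 : ℝ))) (𝓝[>] 0) (𝓝 0) := by
    have h1 : Tendsto (fun ε : ℝ => ε ^ (1 / 2 : ℝ)) (𝓝[>] 0) (𝓝 0) := by
      have := (Real.continuousAt_rpow_const 0 (1 / 2 : ℝ) (Or.inr (by norm_num))).tendsto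
      rw [Real.zero_rpow (by norm_num)] at this
      exact this.mono_left nhdsWithin_le_nhds
    have h2 := ENNReal.Tendsto.const_mul (ENNReal.tendsto_ofReal h1) (Or.inr hBt) (a := B)
    simpa using h2
  refine tendsto_of_tendsto_of_tendsto_of_le_of_le' tendsto_const_nhds hlim
    (Eventually.of_forall fun _ => bot_le) ?_
  filter_upwards [self_mem_nhdsWithin] with ε hε using hle ε hε

/-- Cubing an increment of order |y|^{1/3} gives exactly |y|. This is the critical order: it offsets
ε⁻¹ without any smallness, and therefore serves as the dominating function in time. -/
lemma oscInt_le_besov {F : Torus3 → E3} (hF : AEStronglyMeasurable F volume) (hε : 0 < ε) :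
    oscInt ε F ≤ ENNReal.ofReal ε * besovNorm (1 / 3) 3 F ^ 3 := by
  refine oscInt_le_of_forall hF hε fun y hy => ?_
  by_cases hy0 : y = 0
  · simp [hy0, proj_zero]
  have hyp : 0 < ‖y‖ := norm_pos_iff.2 hy0
  have hr : ENNReal.ofReal (‖y‖ ^ (1 / 3 : ℝ)) ≠ 0 := by
    simpa using Real.rpow_pos_of_pos hyp _
  have h1 : eLpNorm (fun x => F (x - proj y) - F x) 3 volume / ENNReal.ofReal (‖y‖ ^ (1 / 3 : ℝ))
      ≤ besovNorm (1 / 3) 3 F := by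
    refine le_trans ?_ le_add_self
    exact le_iSup₂_of_le (f := fun (y : E3) (_ : y ≠ 0) =>
      eLpNorm (fun x => F (x - proj y) - F x) 3 volume / ENNReal.ofReal (‖y‖ ^ (1 / 3 : ℝ)))
      y hy0 le_rfl
  rw [ENNReal.div_le_iff hr ENNReal.ofReal_ne_top] at h1
  have h2 : ∫⁻ x, ‖F x - F (x - proj y)‖ₑ ^ 3 =
      eLpNorm (fun x => F (x - proj y) - F x) 3 volume ^ 3 := by
    rw [eLpNorm_eq_lintegral_rpow_enorm_toReal (by norm_num) (by norm_num),
      ← ENNReal.rpow_natCast, ← ENNReal.rpow_mul]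
    norm_num
    simp only [enorm_sub_rev (F (_ - _))]
  rw [h2]
  calc _ ≤ (besovNorm (1 / 3) 3 F * ENNReal.ofReal (‖y‖ ^ (1 / 3 : ℝ))) ^ 3 := by gcongr
    _ = ENNReal.ofReal ‖y‖ * besovNorm (1 / 3) 3 F ^ 3 := by
      rw [mul_pow, ← ENNReal.ofReal_pow (by positivity), ← Real.rpow_natCast,
        ← Real.rpow_mul hyp.le]
      norm_num
      ring
    _ ≤ _ := by
      gcongr
      rw [mem_ball_zero_iff] at hy
      exact hy.le

end HallMHD

namespace HallMHD

variable {T ε : ℝ}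

/-! ### Space-time measurability -/

/-- Lebesgue measure on the time interval `(0,T)`. -/
noncomputable abbrev timeMeasure (T : ℝ) : Measure ℝ := volume.restrict (Ioo 0 T)

section measurability

variable {E : Type*} [NormedAddCommGroup E] {f : ℝ → Torus3 → E}

lemma MeasurableOnCylinder.ae_aestronglyMeasurable (hf : MeasurableOnCylinder T f) :
    ∀ᵐ t ∂(timeMeasure T), AEStronglyMeasurable (f t) volume :=
  AEStronglyMeasurable.prodMk_left hf

lemma MeasurableOnCylinder.apply {u : ℝ → Torus3 → E3} (hu : MeasurableOnCylinder T u)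
    (j : Fin 3) : MeasurableOnCylinder T fun t x => u t x j :=
  (PiLp.continuous_apply 2 _ j).comp_aestronglyMeasurable hu

lemma MeasurableOnCylinder.apply_matrix {u : ℝ → Torus3 → Mat3} (hu : MeasurableOnCylinder T u)
    (q : Fin 3 × Fin 3) : MeasurableOnCylinder T fun t x => u t x q :=
  (PiLp.continuous_apply 2 _ q).comp_aestronglyMeasurable hu

lemma quasiMeasurePreserving_shear_time (T : ℝ) :
    Measure.QuasiMeasurePreserving (fun p : (ℝ × Torus3) × E3 => (p.1.1, p.1.2 - proj p.2))
      (((timeMeasure T).prod volume).prod volume) ((timeMeasure T).prod volume) := by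
  refine QuasiMeasurePreserving.prod_of_left ?_ (Eventually.of_forall fun y => ?_)
  · exact ((continuous_fst.comp continuous_fst).prodMk ((continuous_snd.comp continuous_fst).sub
      (continuous_proj.comp continuous_snd))).measurable
  · exact ((MeasurePreserving.id _).prod (measurePreserving_sub_proj y)).quasiMeasurePreserving

lemma MeasurableOnCylinder.shear (hf : MeasurableOnCylinder T f) :
    AEStronglyMeasurable (fun p : (ℝ × Torus3) × E3 => f p.1.1 (p.1.2 - proj p.2))
      (((timeMeasure T).prod volume).prod volume) :=
  AEStronglyMeasurable.comp_quasiMeasurePreserving hf (quasiMeasurePreserving_shear_time T)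

lemma MeasurableOnCylinder.aemeasurable_oscInt (hf : MeasurableOnCylinder T f) :
    AEMeasurable (fun t => oscInt ε (f t)) (timeMeasure T) := by
  have h1 : AEStronglyMeasurable (fun p : (ℝ × Torus3) × E3 =>
      f p.1.1 p.1.2 - f p.1.1 (p.1.2 - proj p.2)) (((timeMeasure T).prod volume).prod volume) :=
    (AEStronglyMeasurable.comp_fst hf).sub hf.shear
  have h3 : ((timeMeasure T).prod (volume : Measure Torus3)).prod (ballMeasure ε) ≪
      ((timeMeasure T).prod (volume : Measure Torus3)).prod (volume : Measure E3) := by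
    refine Measure.AbsolutelyContinuous.rfl.prod ?_
    exact Measure.smul_absolutelyContinuous.trans Measure.restrict_le_self.absolutelyContinuous
  exact ((h1.mono_ac h3).enorm.pow_const 3).lintegral_prod_right'.lintegral_prod_right'

lemma MeasurableOnCylinder.conv {k : E3 → ℝ} {f : ℝ → Torus3 → ℝ} (hk : IsKernel k)
    (hf : MeasurableOnCylinder T f) : MeasurableOnCylinder T fun t => conv k (f t) := by
  have h1 : AEStronglyMeasurable (fun p : (ℝ × Torus3) × E3 =>
      k p.2 * f p.1.1 (p.1.2 - proj p.2)) (((timeMeasure T).prod volume).prod volume) :=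
    (hk.smooth.continuous.comp continuous_snd).aestronglyMeasurable.mul hf.shear
  exact h1.integral_prod_right'

lemma MeasurableOnCylinder.mul {f g : ℝ → Torus3 → ℝ} (hf : MeasurableOnCylinder T f)
    (hg : MeasurableOnCylinder T g) : MeasurableOnCylinder T fun t x => f t x * g t x :=
  AEStronglyMeasurable.mul hf hg

lemma MeasurableOnCylinder.integral {f : ℝ → Torus3 → ℝ} (hf : MeasurableOnCylinder T f) :
    AEStronglyMeasurable (fun t => ∫ x, f t x) (timeMeasure T) :=
  AEStronglyMeasurable.integral_prod_right' hf

lemma MeasurableOnCylinder.aemeasurable_eLpNorm_two (hf : MeasurableOnCylinder T f) :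
    AEMeasurable (fun t => eLpNorm (f t) 2 volume) (timeMeasure T) := by
  simp only [eLpNorm_eq_lintegral_rpow_enorm_toReal (p := 2) (by norm_num) (by norm_num)]
  exact ((AEStronglyMeasurable.enorm hf).pow_const _).lintegral_prod_right'.pow_const _

end measurability

lemma timeNorm_lt_top_iff {N : ℝ → ℝ≥0∞} (n : ℕ) (hn : n ≠ 0) :
    timeNorm T n N < ⊤ ↔ ∫⁻ t in Ioo 0 T, N t ^ n < ⊤ := by
  have h0 : (n : ℝ≥0∞) ≠ 0 := by exact_mod_cast hn
  rw [timeNorm, eLpNorm_eq_lintegral_rpow_enorm_toReal h0 (ENNReal.natCast_ne_top n)]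
  simp only [ENNReal.toReal_natCast, enorm_eq_self, ENNReal.rpow_natCast]
  rw [ENNReal.rpow_lt_top_iff_of_pos]
  have : 0 < (n : ℝ) := by exact_mod_cast Nat.pos_of_ne_zero hn
  positivity

/-! ### Time-integrated oscillations under the hypotheses of the theorem. -/

section energy

variable {u : ℝ → Torus3 → E3} {Du : ℝ → Torus3 → Mat3}

lemma InEnergyClass.lintegral_gradient_lt_top (hu : InEnergyClass T u Du) :
    ∫⁻ t in Ioo 0 T, eLpNorm (Du t) 2 volume ^ 2 < ⊤ :=
  (timeNorm_lt_top_iff 2 (by norm_num)).1 (by exact_mod_cast hu.L2_gradient)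

lemma InEnergyClass.exists_bound (hu : InEnergyClass T u Du) :
    ∃ M : ℝ, 0 ≤ M ∧ ∀ᵐ t ∂(timeMeasure T), eLpNorm (u t) 2 volume ≤ ENNReal.ofReal M := by
  refine ⟨(timeNorm T ⊤ fun t => eLpNorm (u t) 2 volume).toReal, ENNReal.toReal_nonneg, ?_⟩
  rw [ENNReal.ofReal_toReal hu.linfty_L2.ne]
  have := ae_le_eLpNormEssSup (f := fun t => eLpNorm (u t) 2 volume) (μ := timeMeasure T)
  simpa [timeNorm, eLpNorm_exponent_top] using this

lemma InEnergyClass.ae_memLp (hu : InEnergyClass T u Du) :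
    ∀ᵐ t ∂(timeMeasure T), MemLp (u t) 2 volume := by
  obtain ⟨M, -, hM⟩ := hu.exists_bound
  filter_upwards [hM, hu.measurable.ae_aestronglyMeasurable] with t h1 h2
  exact ⟨h2, h1.trans_lt ENNReal.ofReal_lt_top⟩

lemma InEnergyClass.ae_memLp_gradient (hu : InEnergyClass T u Du) :
    ∀ᵐ t ∂(timeMeasure T), MemLp (Du t) 2 volume := by
  have h := ae_lt_top' (hu.measurable_gradient.aemeasurable_eLpNorm_two.pow_const 2)
    hu.lintegral_gradient_lt_top.ne
  filter_upwards [h, hu.measurable_gradient.ae_aestronglyMeasurable] with t h1 h2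
  exact ⟨h2, by simpa using h1⟩

/-- For `u ∈ L²H¹ ∩ L³B^{1/3}_{3,∞}` the space-time cubic oscillation is `o(ε)`. -/
lemma InEnergyClass.tendsto_lintegral_oscInt (hu : InEnergyClass T u Du)
    (hb : InLpBesov T 3 (1 / 3) 3 u) :
    Tendsto (fun ε : ℝ => ∫⁻ t in Ioo 0 T, ENNReal.ofReal ε⁻¹ * oscInt ε (u t))
      (𝓝[>] 0) (𝓝 0) := by
  have hfin : ∫⁻ t in Ioo 0 T, besovNorm (1 / 3) 3 (u t) ^ 3 < ⊤ :=
    (timeNorm_lt_top_iff 3 (by norm_num)).1 (by exact_mod_cast hb.2)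
  -- The two hypotheses divide the work: membership in H¹ at almost every time gives the pointwise
  -- limit 0, and the cube of the Besov norm gives the integrable majorant.
  have h := tendsto_lintegral_filter_of_dominated_convergence' (μ := timeMeasure T)
    (l := 𝓝[>] (0 : ℝ)) (F := fun ε t => ENNReal.ofReal ε⁻¹ * oscInt ε (u t)) (f := fun _ => 0)
    (fun t => besovNorm (1 / 3) 3 (u t) ^ 3)
    (Eventually.of_forall fun ε => hu.measurable.aemeasurable_oscInt.const_mul _) ?_ hfin.ne ?_
  · simpa using h
  · filter_upwards [self_mem_nhdsWithin] with ε hε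
    have hε' : 0 < ε := hε
    filter_upwards [hu.measurable.ae_aestronglyMeasurable] with t ht
    calc _ ≤ ENNReal.ofReal ε⁻¹ * (ENNReal.ofReal ε * besovNorm (1 / 3) 3 (u t) ^ 3) := by
          gcongr; exact oscInt_le_besov ht hε'
      _ = _ := by
          rw [← mul_assoc, ← ENNReal.ofReal_mul (by positivity), inv_mul_cancel₀ hε'.ne']
          simp
  · filter_upwards [hu.ae_memLp, hu.ae_memLp_gradient, hu.isWeakGradient] with t h1 h2 h3
    exact tendsto_inv_mul_oscInt h1 h2 h3

/-- The cube of the quantity in the definition: ε^{2/3} becomes ε², the exact cost of the Hall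
commutator. -/
lemma InLpBesovVMO.tendsto_lintegral_oscInt {h : ℝ → Torus3 → E3}
    (hh : InLpBesovVMO T 3 (2 / 3) 3 h) :
    Tendsto (fun ε : ℝ => ENNReal.ofReal (ε⁻¹ ^ 2) * ∫⁻ t in Ioo 0 T, oscInt ε (h t))
      (𝓝[>] 0) (𝓝 0) := by
  have h1 := hh.2.2
  have h2 := ((ENNReal.continuous_pow 3).tendsto 0).comp h1
  simp only [ne_eq, OfNat.ofNat_ne_zero, not_false_eq_true, zero_pow] at h2
  refine h2.congr' ?_
  filter_upwards [self_mem_nhdsWithin] with ε hε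
  have hε' : 0 < ε := hε
  simp only [Function.comp_apply, meanOscillation_three]
  have e1 : timeNorm T 3 (fun t => oscInt ε (h t) ^ (1 / 3 : ℝ)) ^ 3 =
      ∫⁻ t in Ioo 0 T, oscInt ε (h t) := by
    rw [timeNorm, eLpNorm_eq_lintegral_rpow_enorm_toReal (by norm_num) (by norm_num),
      ← ENNReal.rpow_natCast, ← ENNReal.rpow_mul]
    simp only [enorm_eq_self, ← ENNReal.rpow_mul]
    norm_num
  have e2 : ENNReal.ofReal (ε ^ (2 / 3 : ℝ)) ^ 3 = ENNReal.ofReal (ε ^ 2) := by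
    rw [← ENNReal.ofReal_pow (by positivity), ← Real.rpow_natCast, ← Real.rpow_mul hε'.le]
    norm_num
  rw [ENNReal.div_eq_inv_mul, mul_pow, e1, ← ENNReal.inv_pow, e2, inv_pow,
    ENNReal.ofReal_inv_of_pos (by positivity)]

end energy

end HallMHD

/-! ### Recovering increments in time from weak derivatives and two-time identities. -/

namespace HallMHD

variable {T : ℝ}

/-! ### Two lemmas on functions of time -/

/-- A smooth approximation of the indicator function of `(r, ∞)`. -/
noncomputable def ramp (δ r s : ℝ) : ℝ := Real.smoothTransition (δ⁻¹ * (s - r))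

lemma contDiff_ramp (δ r : ℝ) : ContDiff ℝ (⊤ : ℕ∞) (ramp δ r) :=
  Real.smoothTransition.contDiff.comp (contDiff_const.mul (contDiff_id.sub contDiff_const))

lemma ramp_eq_zero {δ r s : ℝ} (hδ : 0 < δ) (h : s ≤ r) : ramp δ r s = 0 :=
  Real.smoothTransition.zero_of_nonpos
    (mul_nonpos_of_nonneg_of_nonpos (inv_nonneg.2 hδ.le) (by linarith))

lemma ramp_eq_one {δ r s : ℝ} (hδ : 0 < δ) (h : r + δ ≤ s) : ramp δ r s = 1 := by
  refine Real.smoothTransition.one_of_one_le ?_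
  rw [inv_mul_eq_div, le_div_iff₀ hδ]
  linarith

lemma abs_ramp_le (δ r s : ℝ) : |ramp δ r s| ≤ 1 := by
  rw [ramp, abs_of_nonneg (Real.smoothTransition.nonneg _)]
  exact Real.smoothTransition.le_one _

lemma monotone_ramp {δ : ℝ} (hδ : 0 < δ) (r : ℝ) : Monotone (ramp δ r) := by
  intro a b hab
  exact Real.smoothTransition.monotone
    (mul_le_mul_of_nonneg_left (by linarith) (inv_nonneg.2 hδ.le))

/-- The derivative of the ramp is nonnegative, has mass 1 and is supported in [r, r + δ], hence is
an approximate identity at r. -/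
lemma tendsto_integral_mul_deriv_ramp {E : ℝ → ℝ} (hE : ContinuousOn E (Icc 0 T)) {r : ℝ}
    (hr : r ∈ Ioo 0 T) :
    Tendsto (fun δ => ∫ s in Ioo 0 T, E s * deriv (ramp δ r) s) (𝓝[>] 0) (𝓝 (E r)) := by
  rw [Metric.tendsto_nhds]
  intro η hη
  have hc : ContinuousAt E r := hE.continuousAt (Icc_mem_nhds hr.1 hr.2)
  obtain ⟨κ, hκ, hb⟩ := Metric.continuousAt_iff.1 hc (η / 2) (by positivity)
  have h1 : ∀ᶠ δ in 𝓝[>] (0 : ℝ), δ < κ := nhdsWithin_le_nhds (gt_mem_nhds hκ)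
  have h2 : ∀ᶠ δ in 𝓝[>] (0 : ℝ), δ < T - r := nhdsWithin_le_nhds (gt_mem_nhds (by linarith [hr.2]))
  filter_upwards [h1, h2, self_mem_nhdsWithin] with δ hδκ hδT hδ
  have hδ' : 0 < δ := hδ
  have hdc : Continuous (deriv (ramp δ r)) := (contDiff_ramp δ r).continuous_deriv (by simp)
  have hd0 : ∀ s, 0 ≤ deriv (ramp δ r) s := fun s => (monotone_ramp hδ' r).deriv_nonneg
  have hz1 : ∀ s, s < r → deriv (ramp δ r) s = 0 := by
    intro s hs
    have : ramp δ r =ᶠ[𝓝 s] fun _ => 0 := by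
      filter_upwards [gt_mem_nhds hs] with x hx using ramp_eq_zero hδ' hx.le
    rw [this.deriv_eq, deriv_const]
  have hz2 : ∀ s, r + δ < s → deriv (ramp δ r) s = 0 := by
    intro s hs
    have : ramp δ r =ᶠ[𝓝 s] fun _ => 1 := by
      filter_upwards [lt_mem_nhds hs] with x hx using ramp_eq_one hδ' hx.le
    rw [this.deriv_eq, deriv_const]
  have hEc : ∀ {a b : ℝ}, 0 ≤ a → b ≤ T → IntegrableOn (fun s => E s * deriv (ramp δ r) s)
      (Icc a b) := fun ha hb =>
    ((hE.mono (Icc_subset_Icc ha hb)).mul hdc.continuousOn).integrableOn_Icc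
  have hint : ∫ s in Ioo 0 T, E s * deriv (ramp δ r) s =
      ∫ s in Icc r (r + δ), E s * deriv (ramp δ r) s := by
    refine (setIntegral_eq_of_subset_of_forall_sdiff_eq_zero measurableSet_Ioo ?_ ?_)
    · exact fun s hs => ⟨hr.1.trans_le hs.1, by linarith [hs.2]⟩
    · intro s hs
      have : s < r ∨ r + δ < s := by
        by_contra! h
        exact hs.2 ⟨h.1, h.2⟩
      rcases this with h | h
      · rw [hz1 s h, mul_zero]
      · rw [hz2 s h, mul_zero]
  have hone : ∫ s in Icc r (r + δ), deriv (ramp δ r) s = 1 := by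
    rw [integral_Icc_eq_integral_Ioc, ← intervalIntegral.integral_of_le (by linarith),
      intervalIntegral.integral_deriv_eq_sub
        (fun s _ => ((contDiff_ramp δ r).differentiable (by simp)).differentiableAt)
        (hdc.intervalIntegrable _ _), ramp_eq_one hδ' le_rfl, ramp_eq_zero hδ' le_rfl, sub_zero]
  have hdi : IntegrableOn (fun s => deriv (ramp δ r) s) (Icc r (r + δ)) :=
    hdc.continuousOn.integrableOn_Icc
  have e : (∫ s in Icc r (r + δ), E s * deriv (ramp δ r) s) - E r =
      ∫ s in Icc r (r + δ), (E s - E r) * deriv (ramp δ r) s := by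
    simp only [sub_mul]
    rw [integral_sub (hEc hr.1.le (by linarith)) (hdi.const_mul _), integral_const_mul, hone, mul_one]
  rw [Real.dist_eq, hint, e]
  have hle : ‖∫ s in Icc r (r + δ), (E s - E r) * deriv (ramp δ r) s‖ ≤
      ∫ s in Icc r (r + δ), η / 2 * deriv (ramp δ r) s := by
    refine norm_integral_le_of_norm_le (hdi.const_mul _) ?_
    filter_upwards [ae_restrict_mem measurableSet_Icc] with s hs
    rw [norm_mul, Real.norm_of_nonneg (hd0 s)]
    refine mul_le_mul_of_nonneg_right (hb ?_).le (hd0 s)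
    rw [Real.dist_eq, abs_lt]
    constructor <;> linarith [hs.1, hs.2]
  rw [integral_const_mul, hone, mul_one, Real.norm_eq_abs] at hle
  linarith

lemma tendsto_integral_mul_ramp_sub {F : ℝ → ℝ} (hF : IntegrableOn F (Ioo 0 T)) {r t : ℝ}
    (hr : 0 < r) (hrt : r ≤ t) (ht : t < T) :
    Tendsto (fun δ => ∫ s in Ioo 0 T, F s * (ramp δ r s - ramp δ t s)) (𝓝[>] 0)
      (𝓝 (∫ s in r..t, F s)) := by
  have e : ∫ s in r..t, F s = ∫ s in Ioo 0 T, (Ioc r t).indicator F s := by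
    rw [intervalIntegral.integral_of_le hrt, setIntegral_indicator measurableSet_Ioc]
    congr 2
    ext s
    simp only [mem_Ioc, mem_inter_iff, mem_Ioo]
    constructor
    · rintro ⟨h1, h2⟩; exact ⟨⟨by linarith, by linarith⟩, h1, h2⟩
    · exact fun h => h.2
  rw [e]
  refine tendsto_integral_filter_of_dominated_convergence (fun s => 2 * ‖F s‖) ?_ ?_
    (hF.norm.const_mul 2) ?_
  · refine Eventually.of_forall fun δ => hF.aestronglyMeasurable.mul ?_
    exact ((contDiff_ramp δ r).continuous.sub (contDiff_ramp δ t).continuous).aestronglyMeasurable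
  · refine Eventually.of_forall fun δ => Eventually.of_forall fun s => ?_
    rw [norm_mul, mul_comm]
    refine mul_le_mul_of_nonneg_right ?_ (norm_nonneg _)
    refine (norm_sub_le _ _).trans ?_
    rw [Real.norm_eq_abs, Real.norm_eq_abs]
    linarith [abs_ramp_le δ r s, abs_ramp_le δ t s]
  · refine Eventually.of_forall fun s => ?_
    have hev : ∀ r s : ℝ, r < s → ∀ᶠ δ in 𝓝[>] (0 : ℝ), ramp δ r s = 1 := by
      intro r s hs
      have h1 : ∀ᶠ δ in 𝓝[>] (0 : ℝ), δ < s - r := nhdsWithin_le_nhds (gt_mem_nhds (by linarith))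
      filter_upwards [h1, self_mem_nhdsWithin] with δ h hδ
      exact ramp_eq_one hδ (by linarith)
    have hev0 : ∀ r s : ℝ, s ≤ r → ∀ᶠ δ in 𝓝[>] (0 : ℝ), ramp δ r s = 0 := by
      intro r s hs
      filter_upwards [self_mem_nhdsWithin] with δ hδ using ramp_eq_zero hδ hs
    by_cases hs : s ∈ Ioc r t
    · rw [indicator_of_mem hs]
      refine tendsto_const_nhds.congr' ?_
      filter_upwards [hev r s hs.1, hev0 t s hs.2] with δ h1 h2
      rw [h1, h2]; ring
    · rw [indicator_of_notMem hs]
      refine tendsto_const_nhds.congr' ?_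
      rcases le_or_gt s r with h | h
      · filter_upwards [hev0 r s h, hev0 t s (h.trans hrt)] with δ h1 h2
        rw [h1, h2]; ring
      · have h' : t < s := by
          by_contra! h''
          exact hs ⟨h, h''⟩
        filter_upwards [hev r s h, hev t s h'] with δ h1 h2
        rw [h1, h2]; ring

/-- A continuous function with integrable distributional derivative is its primitive. -/
lemma sub_eq_integral_of_weak_deriv (hT : 0 < T) {E F : ℝ → ℝ} (hE : ContinuousOn E (Icc 0 T))
    (hF : IntegrableOn F (Ioo 0 T))
    (h : ∀ θ : ℝ → ℝ, ContDiff ℝ (⊤ : ℕ∞) θ →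
      (∃ a b : ℝ, 0 < a ∧ b < T ∧ ∀ t, t ∉ Icc a b → θ t = 0) →
      ∫ s in Ioo 0 T, (E s * deriv θ s + F s * θ s) = 0)
    {t : ℝ} (ht : t ∈ Icc 0 T) {r : ℝ} (hr : r ∈ Icc 0 T) : E t - E r = ∫ s in r..t, F s := by
  have hEi : IntegrableOn E (Ioo 0 T) := hE.integrableOn_Icc.mono_set Ioo_subset_Icc_self
  have key : ∀ r t : ℝ, 0 < r → r ≤ t → t < T → E t - E r = ∫ s in r..t, F s := by
    intro r t hr hrt ht
    -- The test function is a smooth approximation of the indicator of (r, t], the difference of two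
    -- ramps; it vanishes outside [r, t + δ].
    have l1 := (tendsto_integral_mul_deriv_ramp hE ⟨hr, hrt.trans_lt ht⟩).sub
      (tendsto_integral_mul_deriv_ramp hE ⟨hr.trans_le hrt, ht⟩)
    have l2 := l1.add (tendsto_integral_mul_ramp_sub hF hr hrt ht)
    have hev : ∀ᶠ δ in 𝓝[>] (0 : ℝ), ((∫ s in Ioo 0 T, E s * deriv (ramp δ r) s)
        - ∫ s in Ioo 0 T, E s * deriv (ramp δ t) s)
        + ∫ s in Ioo 0 T, F s * (ramp δ r s - ramp δ t s) = 0 := by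
      have h2 : ∀ᶠ δ in 𝓝[>] (0 : ℝ), δ < T - t :=
        nhdsWithin_le_nhds (gt_mem_nhds (by linarith))
      filter_upwards [h2, self_mem_nhdsWithin] with δ hδT hδ
      have hδ' : 0 < δ := hδ
      have hd : ∀ r, Differentiable ℝ (ramp δ r) := fun r =>
        (contDiff_ramp δ r).differentiable (by simp)
      have hdc : ∀ r, Continuous (deriv (ramp δ r)) := fun r =>
        (contDiff_ramp δ r).continuous_deriv (by simp)
      have hi1 : ∀ r, IntegrableOn (fun s => E s * deriv (ramp δ r) s) (Ioo 0 T) := fun r =>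
        (hE.mul (hdc r).continuousOn).integrableOn_Icc.mono_set Ioo_subset_Icc_self
      have hi2 : IntegrableOn (fun s => F s * (ramp δ r s - ramp δ t s)) (Ioo 0 T) := by
        refine hF.mul_bdd (c := 2) ?_ (Eventually.of_forall fun s => ?_)
        · exact ((contDiff_ramp δ r).continuous.sub
            (contDiff_ramp δ t).continuous).aestronglyMeasurable
        · refine (norm_sub_le _ _).trans ?_
          rw [Real.norm_eq_abs, Real.norm_eq_abs]
          linarith [abs_ramp_le δ r s, abs_ramp_le δ t s]
      have hθ := h (fun s => ramp δ r s - ramp δ t s)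
        ((contDiff_ramp δ r).sub (contDiff_ramp δ t)) ⟨r, t + δ, hr, by linarith, fun s hs => ?_⟩
      · have hi3 : IntegrableOn (fun s => E s * deriv (ramp δ r) s - E s * deriv (ramp δ t) s)
          (Ioo 0 T) := (hi1 r).sub (hi1 t)
        rw [← integral_sub (hi1 r) (hi1 t), ← integral_add hi3 hi2]
        refine Eq.trans ?_ hθ
        congr! 2 with s
        have : deriv (fun s => ramp δ r s - ramp δ t s) s = deriv (ramp δ r) s - deriv (ramp δ t) s :=
          deriv_fun_sub (hd r s) (hd t s)
        rw [this]
        ring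
      · have : s < r ∨ t + δ < s := by
          by_contra! h
          exact hs ⟨h.1, h.2⟩
        rcases this with h | h
        · rw [ramp_eq_zero hδ' h.le, ramp_eq_zero hδ' (h.le.trans hrt), sub_zero]
        · rw [ramp_eq_one hδ' h.le, ramp_eq_one hδ' (by linarith), sub_self]
    have := tendsto_nhds_unique (l2.congr' hev) tendsto_const_nhds
    linarith
  have hFi : IntegrableOn F (Icc 0 T) := by rwa [integrableOn_Icc_iff_integrableOn_Ioo]
  have hFii : ∀ a b, a ∈ Icc 0 T → b ∈ Icc 0 T → IntervalIntegrable F volume a b := by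
    intro a b ha hb
    rw [intervalIntegrable_iff]
    refine hFi.mono_set (uIoc_subset_uIcc.trans ?_)
    exact (uIcc_subset_Icc ha hb)
  have h0 : (0 : ℝ) ∈ Icc 0 T := ⟨le_rfl, hT.le⟩
  -- `E` minus the primitive of `F` is constant on the open interval by `key`; continuity carries
  -- the identity to the endpoints, where no test function reaches.
  set Φ : ℝ → ℝ := fun s => E s - ∫ σ in (0 : ℝ)..s, F σ with hΦ
  have hΦc : ContinuousOn Φ (Icc 0 T) := by
    refine hE.sub ?_
    exact intervalIntegral.continuousOn_primitive_interval (by rwa [uIcc_of_le hT.le]) |>.mono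
      (by rw [uIcc_of_le hT.le])
  have hΦe : ∀ s ∈ Ioo 0 T, Φ s = Φ (T / 2) := by
    intro s hs
    have hm : T / 2 ∈ Ioo 0 T := ⟨by linarith, by linarith⟩
    have hsub : (∫ σ in (0 : ℝ)..s, F σ) - ∫ σ in (0 : ℝ)..(T / 2), F σ = ∫ σ in (T / 2)..s, F σ :=
      intervalIntegral.integral_interval_sub_left
        (hFii _ _ h0 (Ioo_subset_Icc_self hs)) (hFii _ _ h0 (Ioo_subset_Icc_self hm))
    have : E s - E (T / 2) = ∫ σ in (T / 2)..s, F σ := by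
      rcases le_total (T / 2) s with hle | hle
      · exact key _ _ hm.1 hle hs.2
      · have := key _ _ hs.1 hle hm.2
        rw [intervalIntegral.integral_symm, ← this]; ring
    simp only [hΦ]
    linarith
  have hΦa : EqOn Φ (fun _ => Φ (T / 2)) (Icc 0 T) :=
    Set.EqOn.of_subset_closure (fun s hs => hΦe s hs) hΦc continuousOn_const
      Ioo_subset_Icc_self (by rw [closure_Ioo hT.ne])
  have a1 := hΦa ht
  have a2 := hΦa hr
  have hsub : (∫ σ in (0 : ℝ)..t, F σ) - ∫ σ in (0 : ℝ)..r, F σ = ∫ σ in r..t, F σ :=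
    intervalIntegral.integral_interval_sub_left (hFii _ _ h0 ht) (hFii _ _ h0 hr)
  simp only [hΦ] at a1 a2
  linarith

/-- If the increments of `E` are given by a symmetrized two-time integrand, then `E` is the
primitive of the diagonal of the integrand. -/
lemma sub_eq_integral_diagonal {E : ℝ → ℝ} {G : ℝ → ℝ → ℝ} {M : ℝ}
    (hE : ∀ r t, 0 ≤ r → r ≤ t → t ≤ T → E t - E r = ∫ τ in r..t, (G τ t + G τ r))
    (hm : ∀ s ∈ Icc 0 T, AEStronglyMeasurable (fun τ => G τ s) (timeMeasure T))
    (hc : ∀ᵐ τ ∂(timeMeasure T), ContinuousOn (G τ) (Icc 0 T))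
    (hb : ∀ᵐ τ ∂(timeMeasure T), ∀ s ∈ Icc 0 T, |G τ s| ≤ M) {t : ℝ} (ht : t ∈ Icc 0 T) :
    E t - E 0 = ∫ τ in Ioo 0 t, 2 * G τ τ := by
  rcases eq_or_lt_of_le ht.1 with rfl | ht0
  · simp
  have hsubset : Ioc 0 t ⊆ Ioc 0 T := Ioc_subset_Ioc_right ht.2
  have hres : (volume.restrict (Ioc 0 t) : Measure ℝ) ≤ timeMeasure T := by
    rw [timeMeasure, Measure.restrict_congr_set Ioo_ae_eq_Ioc]
    exact Measure.restrict_mono hsubset le_rfl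
  have hm' : ∀ s ∈ Icc 0 T, AEStronglyMeasurable (fun τ => G τ s) (volume.restrict (Ioc 0 t)) :=
    fun s hs => (hm s hs).mono_measure hres
  have hc' := ae_mono hres hc
  have hb' := ae_mono hres hb
  have hGi : ∀ s ∈ Icc 0 T, IntegrableOn (fun τ => G τ s) (Ioc 0 t) := fun s hs =>
    Integrable.of_bound (hm' s hs) M (by filter_upwards [hb'] with τ h using h s hs)
  -- The uniform partition of [0, t] into `n + 1` pieces; the shift by one avoids division by zero
  -- at `n = 0`.
  let a : ℕ → ℕ → ℝ := fun n i => i * (t / (n + 1))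
  have han : ∀ n : ℕ, a n (n + 1) = t := fun n => by
    simp only [a]; push_cast; field_simp
  have ha0 : ∀ n : ℕ, a n 0 = 0 := fun n => by simp [a]
  have hmono : ∀ n, Monotone (a n) := fun n i j hij => by
    simp only [a]
    have : (i : ℝ) ≤ j := by exact_mod_cast hij
    gcongr
  have hmem : ∀ n i, i ≤ n + 1 → a n i ∈ Icc 0 t := fun n i hi =>
    ⟨(ha0 n).symm.trans_le (hmono n (Nat.zero_le i)), (hmono n hi).trans_eq (han n)⟩
  have hmemT : ∀ n i, i ≤ n + 1 → a n i ∈ Icc 0 T := fun n i hi =>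
    Icc_subset_Icc_right ht.2 (hmem n i hi)
  -- On each cell the second variable is frozen at the two endpoints. The integral of `F n`
  -- telescopes to the full increment for every `n`, while the frozen points converge to τ.
  let F : ℕ → ℝ → ℝ := fun n τ => ∑ i ∈ Finset.range (n + 1),
    (Ioc (a n i) (a n (i + 1))).indicator (fun τ => G τ (a n (i + 1)) + G τ (a n i)) τ
  have hii : ∀ n i, i < n + 1 →
      IntegrableOn (fun τ => G τ (a n (i + 1)) + G τ (a n i)) (Ioc 0 t) := fun n i hi =>
    (hGi _ (hmemT n _ hi)).add (hGi _ (hmemT n _ hi.le))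
  have hFint : ∀ n, ∫ τ in Ioc 0 t, F n τ = E t - E 0 := by
    intro n
    simp only [F]
    rw [integral_finsetSum _ fun i hi => (hii n i (Finset.mem_range.1 hi)).indicator measurableSet_Ioc]
    have h1 : ∀ i ∈ Finset.range (n + 1), ∫ τ in Ioc 0 t,
        (Ioc (a n i) (a n (i + 1))).indicator (fun τ => G τ (a n (i + 1)) + G τ (a n i)) τ =
        E (a n (i + 1)) - E (a n i) := by
      intro i hi
      have hi' := Finset.mem_range.1 hi
      have hle := hmono n (Nat.le_succ i)
      rw [hE _ _ (hmem n i hi'.le).1 hle (hmemT n _ hi').2,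
        intervalIntegral.integral_of_le hle, setIntegral_indicator measurableSet_Ioc,
        inter_eq_self_of_subset_right]
      exact Ioc_subset_Ioc (hmem n i hi'.le).1 (hmem n _ hi').2
    rw [Finset.sum_congr rfl h1, Finset.sum_range_sub (fun i => E (a n i)), han, ha0]
  have hFpt : ∀ (n : ℕ) (τ : ℝ), τ ∈ Ioc 0 t → ∃ p q, p ∈ Icc 0 T ∧ q ∈ Icc 0 T ∧
      |p - τ| ≤ t / (n + 1) ∧ |q - τ| ≤ t / (n + 1) ∧ F n τ = G τ p + G τ q := by
    intro n τ hτ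
    have hδ : 0 < t / ((n : ℝ) + 1) := by positivity
    obtain ⟨i, hi, hmemi⟩ : ∃ i < n + 1, τ ∈ Ioc (a n i) (a n (i + 1)) := by
      have hex : ∃ i, τ ≤ a n (i + 1) := ⟨n, by rw [han]; exact hτ.2⟩
      classical
      have hfind := Nat.find_spec hex
      refine ⟨Nat.find hex, Nat.lt_succ_of_le (Nat.find_min' hex (by rw [han]; exact hτ.2)), ?_, hfind⟩
      rcases Nat.eq_zero_or_pos (Nat.find hex) with h0 | hpos
      · rw [h0, ha0]; exact hτ.1
      · have := Nat.find_min hex (Nat.sub_lt hpos one_pos)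
        rw [Nat.sub_add_cancel (show 1 ≤ Nat.find hex from hpos)] at this
        exact not_le.1 this
    have hstep : a n (i + 1) = a n i + t / (n + 1) := by simp only [a]; push_cast; ring
    refine ⟨a n (i + 1), a n i, hmemT n _ hi, hmemT n _ hi.le, ?_, ?_, ?_⟩
    · rw [abs_le]; constructor <;> linarith [hmemi.1, hmemi.2]
    · rw [abs_le]; constructor <;> linarith [hmemi.1, hmemi.2]
    · simp only [F]
      rw [Finset.sum_eq_single i, indicator_of_mem hmemi]
      · intro j _ hji
        refine indicator_of_notMem (fun hj => ?_) _
        rcases lt_or_gt_of_ne hji with h | h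
        · have := hmono n (Nat.succ_le_of_lt h)
          simp only [Nat.succ_eq_add_one] at this
          linarith [hj.2, hmemi.1]
        · have := hmono n (Nat.succ_le_of_lt h)
          simp only [Nat.succ_eq_add_one] at this
          linarith [hj.1, hmemi.2]
      · exact fun h => absurd (Finset.mem_range.2 hi) h
  have hlim : Tendsto (fun n => ∫ τ in Ioc 0 t, F n τ) atTop (𝓝 (∫ τ in Ioc 0 t, 2 * G τ τ)) := by
    refine tendsto_integral_of_dominated_convergence (fun _ => 2 * M) (fun n => ?_)
      (integrable_const _) (fun n => ?_) ?_
    · exact (integrable_finsetSum _ fun i hi =>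
        (hii n i (Finset.mem_range.1 hi)).indicator measurableSet_Ioc).aestronglyMeasurable
    · filter_upwards [hb', ae_restrict_mem measurableSet_Ioc] with τ hbτ hτ
      obtain ⟨p, q, hp, hq, -, -, e⟩ := hFpt n τ hτ
      rw [e]
      refine (norm_add_le _ _).trans ?_
      rw [Real.norm_eq_abs, Real.norm_eq_abs]
      linarith [hbτ p hp, hbτ q hq]
    · filter_upwards [hc', ae_restrict_mem measurableSet_Ioc] with τ hcτ hτ
      have hτT : τ ∈ Icc 0 T := ⟨hτ.1.le, hτ.2.trans ht.2⟩
      choose p q hp hq hpd hqd e using fun n => hFpt n τ hτ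
      have hz : Tendsto (fun n : ℕ => t / ((n : ℝ) + 1)) atTop (𝓝 0) := by
        have := (tendsto_one_div_add_atTop_nhds_zero_nat (𝕜 := ℝ)).const_mul t
        simpa [div_eq_mul_inv] using this
      have hseq : ∀ p : ℕ → ℝ, (∀ n, p n ∈ Icc 0 T) → (∀ n : ℕ, |p n - τ| ≤ t / (n + 1)) →
          Tendsto (fun n => G τ (p n)) atTop (𝓝 (G τ τ)) := by
        intro p hp hpd
        have h1 : Tendsto p atTop (𝓝 τ) := by
          rw [tendsto_iff_norm_sub_tendsto_zero]
          exact squeeze_zero (fun n => norm_nonneg _) hpd hz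
        exact (hcτ τ hτT).tendsto.comp
          (tendsto_nhdsWithin_iff.2 ⟨h1, Eventually.of_forall hp⟩)
      have := (hseq p hp hpd).add (hseq q hq hqd)
      rw [← two_mul] at this
      exact this.congr fun n => (e n).symm
  rw [← integral_Ioc_eq_integral_Ioo]
  refine tendsto_nhds_unique (tendsto_const_nhds.congr fun n => (hFint n).symm) hlim

end HallMHD

namespace HallMHD

variable {T : ℝ}

/-! ### Bounded weakly continuous scalar fields and two-time integrands -/

/-- A field that is bounded and weakly continuous in time with values in `L²`. -/
structure GoodField (T : ℝ) (a : ℝ → Torus3 → ℝ) : Prop where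
  meas : MeasurableOnCylinder T a
  memLp : ∀ t ∈ Icc 0 T, MemLp (a t) 2 volume
  bound : ∃ M : ℝ, 0 ≤ M ∧ ∀ t ∈ Icc 0 T, ∫ x, a t x ^ 2 ≤ M ^ 2
  cont : ∀ g : Torus3 → ℝ, MemLp g 2 volume → ContinuousOn (fun t => ∫ x, a t x * g x) (Icc 0 T)

lemma goodField_const (T c : ℝ) : GoodField T fun _ _ => c where
  meas := aestronglyMeasurable_const
  memLp _ _ := memLp_const c
  bound := ⟨|c|, abs_nonneg c, fun t _ => by simp⟩
  cont _ _ := continuousOn_const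

lemma GoodField.abs_integral_mul_le {a b : ℝ → Torus3 → ℝ} (ha : GoodField T a)
    (hb : GoodField T b) : ∃ M : ℝ, 0 ≤ M ∧ ∀ t ∈ Icc 0 T, ∫ x, |a t x * b t x| ≤ M := by
  obtain ⟨A, hA, hA'⟩ := ha.bound
  obtain ⟨B, hB, hB'⟩ := hb.bound
  refine ⟨A * B, mul_nonneg hA hB, fun t ht => ?_⟩
  have h := HallMHD.abs_integral_mul_le (ha.memLp t ht).norm (hb.memLp t ht).norm
  simp only [Real.norm_eq_abs, sq_abs] at h
  simp only [abs_mul]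
  refine (le_abs_self _).trans (h.trans ?_)
  exact mul_le_mul (Real.sqrt_le_iff.2 ⟨hA, hA' t ht⟩) (Real.sqrt_le_iff.2 ⟨hB, hB' t ht⟩)
    (Real.sqrt_nonneg _) hA

lemma GoodField.abs_integral_le {a : ℝ → Torus3 → ℝ} (ha : GoodField T a) :
    ∃ M : ℝ, 0 ≤ M ∧ ∀ t ∈ Icc 0 T, ∫ x, |a t x| ≤ M := by
  simpa using ha.abs_integral_mul_le (goodField_const T 1)

lemma abs_integral_mul_le_of_bound {f g : Torus3 → ℝ} (hf : Integrable f) {C : ℝ}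
    (hg : ∀ x, |g x| ≤ C) : |∫ x, f x * g x| ≤ C * ∫ x, |f x| := by
  rw [← integral_const_mul, ← Real.norm_eq_abs]
  refine norm_integral_le_of_norm_le (hf.norm.const_mul C) (Eventually.of_forall fun x => ?_)
  rw [norm_mul, mul_comm, Real.norm_eq_abs, Real.norm_eq_abs]
  exact mul_le_mul_of_nonneg_right (hg x) (abs_nonneg _)

/-- An integrand `G τ s` that is bounded, measurable in `τ` and continuous in `s`. -/
structure TwoTime (T : ℝ) (G : ℝ → ℝ → ℝ) : Prop where
  meas : ∀ s ∈ Icc 0 T, AEStronglyMeasurable (fun τ => G τ s) (timeMeasure T)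
  diag : AEStronglyMeasurable (fun τ => G τ τ) (timeMeasure T)
  cont : ∀ τ ∈ Ioo 0 T, ContinuousOn (G τ) (Icc 0 T)
  bound : ∃ M : ℝ, ∀ τ ∈ Ioo 0 T, ∀ s ∈ Icc 0 T, |G τ s| ≤ M

namespace TwoTime

variable {G G' : ℝ → ℝ → ℝ}

lemma add (h : TwoTime T G) (h' : TwoTime T G') : TwoTime T fun τ s => G τ s + G' τ s where
  meas s hs := (h.meas s hs).add (h'.meas s hs)
  diag := h.diag.add h'.diag
  cont τ hτ := (h.cont τ hτ).add (h'.cont τ hτ)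
  bound := by
    obtain ⟨M, hM⟩ := h.bound
    obtain ⟨M', hM'⟩ := h'.bound
    exact ⟨M + M', fun τ hτ s hs => (abs_add_le _ _).trans (add_le_add (hM τ hτ s hs) (hM' τ hτ s hs))⟩

lemma neg (h : TwoTime T G) : TwoTime T fun τ s => - G τ s where
  meas s hs := (h.meas s hs).neg
  diag := h.diag.neg
  cont τ hτ := (h.cont τ hτ).neg
  bound := by
    obtain ⟨M, hM⟩ := h.bound
    exact ⟨M, fun τ hτ s hs => (abs_neg _).trans_le (hM τ hτ s hs)⟩

lemma sub (h : TwoTime T G) (h' : TwoTime T G') : TwoTime T fun τ s => G τ s - G' τ s := by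
  simpa only [sub_eq_add_neg] using h.add h'.neg

lemma sum {ι : Type*} {S : Finset ι} {F : ι → ℝ → ℝ → ℝ} (h : ∀ i, TwoTime T (F i)) :
    TwoTime T fun τ s => ∑ i ∈ S, F i τ s := by
  classical
  induction S using Finset.induction_on with
  | empty =>
    simp only [Finset.sum_empty]
    exact ⟨fun _ _ => aestronglyMeasurable_const, aestronglyMeasurable_const, fun _ _ => continuousOn_const,
      0, fun _ _ _ _ => by simp⟩
  | insert i S hi ih =>
    simp only [Finset.sum_insert hi]
    exact (h i).add ih

lemma integrableOn (h : TwoTime T G) {s : ℝ} (hs : s ∈ Icc 0 T) :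
    IntegrableOn (fun τ => G τ s) (Ioo 0 T) := by
  obtain ⟨M, hM⟩ := h.bound
  refine Integrable.of_bound (h.meas s hs) M ?_
  filter_upwards [ae_restrict_mem measurableSet_Ioo] with τ hτ using hM τ hτ s hs

lemma integrableOn_diag (h : TwoTime T G) : IntegrableOn (fun τ => G τ τ) (Ioo 0 T) := by
  obtain ⟨M, hM⟩ := h.bound
  refine Integrable.of_bound h.diag M ?_
  filter_upwards [ae_restrict_mem measurableSet_Ioo] with τ hτ
  exact hM τ hτ τ (Ioo_subset_Icc_self hτ)

lemma sub_eq_integral (h : TwoTime T G) {E : ℝ → ℝ}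
    (hE : ∀ r t, 0 ≤ r → r ≤ t → t ≤ T → E t - E r = ∫ τ in r..t, (G τ t + G τ r))
    {t : ℝ} (ht : t ∈ Icc 0 T) : E t - E 0 = ∫ τ in Ioo 0 t, 2 * G τ τ := by
  obtain ⟨M, hM⟩ := h.bound
  refine sub_eq_integral_diagonal (M := M) hE h.meas ?_ ?_ ht
  · filter_upwards [ae_restrict_mem measurableSet_Ioo] with τ hτ using h.cont τ hτ
  · filter_upwards [ae_restrict_mem measurableSet_Ioo] with τ hτ using hM τ hτ

end TwoTime

lemma GoodField.aestronglyMeasurable_integral {a b : ℝ → Torus3 → ℝ} (ha : GoodField T a)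
    (hb : GoodField T b) {g : Torus3 → ℝ} (hg : Continuous g) :
    AEStronglyMeasurable (fun τ => ∫ x, a τ x * b τ x * g x) (timeMeasure T) := by
  refine MeasurableOnCylinder.integral (f := fun τ x => a τ x * b τ x * g x) ?_
  exact (ha.meas.mul hb.meas).mul (f := fun τ x => a τ x * b τ x) (g := fun _ => g)
    (hg.comp continuous_snd).aestronglyMeasurable

/-- Two-time integrands coming from a test function that does not depend on time. -/
lemma GoodField.twoTime_const {a b : ℝ → Torus3 → ℝ} (ha : GoodField T a) (hb : GoodField T b)
    {g : Torus3 → ℝ} (hg : Continuous g) :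
    TwoTime T fun τ _ => ∫ x, a τ x * b τ x * g x where
  meas _ _ := ha.aestronglyMeasurable_integral hb hg
  diag := ha.aestronglyMeasurable_integral hb hg
  cont _ _ := continuousOn_const
  bound := by
    obtain ⟨M, hM, hM'⟩ := ha.abs_integral_mul_le hb
    obtain ⟨C, hC, hC'⟩ := exists_norm_le_of_continuous hg
    refine ⟨C * M, fun τ hτ s _ => ?_⟩
    have hτ' := Ioo_subset_Icc_self hτ
    exact (abs_integral_mul_le_of_bound (integrable_mul_of_memLp (ha.memLp τ hτ') (hb.memLp τ hτ'))
      hC').trans (mul_le_mul_of_nonneg_left (hM' τ hτ') hC)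

/-- For continuity in s both kernels are moved, reflected, onto the product a(τ) b(τ). This makes
the integral a pairing of c(s) with a fixed smooth function, to which weak continuity applies. The
bound uses that kernels map L¹ to L^∞. -/
lemma GoodField.twoTime_conv {a b c : ℝ → Torus3 → ℝ} (ha : GoodField T a) (hb : GoodField T b)
    (hc : GoodField T c) {k l : E3 → ℝ} (hk : IsKernel k) (hl : IsKernel l) :
    TwoTime T fun τ s => ∫ x, a τ x * b τ x * conv k (conv l (c s)) x where
  meas s hs := by
    refine ha.aestronglyMeasurable_integral hb ?_
    exact (hk.smooth_conv (hl.smooth_conv (MemLp.integrable_two (hc.memLp s hs))).integrable).continuous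
  diag := ((ha.meas.mul hb.meas).mul ((hc.meas.conv hl).conv hk)).integral
  cont τ hτ := by
    have hτ' := Ioo_subset_Icc_self hτ
    have hab := integrable_mul_of_memLp (ha.memLp τ hτ') (hb.memLp τ hτ')
    have h1 := hk.reflect.smooth_conv hab
    have h2 := hl.reflect.smooth_conv h1.integrable
    refine (hc.cont _ (h2.memLp 2)).congr fun s hs => ?_
    have hcs := MemLp.integrable_two (hc.memLp s hs)
    have e1 := integral_conv_mul_eq_reflect hk.reflect.integrable hab (hl.smooth_conv hcs).continuous
    have e2 := integral_conv_mul_eq_reflect hl.integrable hcs h1.continuous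
    simp only [neg_neg] at e1
    simp only
    rw [← e1, ← e2]
    exact integral_congr_ae (Eventually.of_forall fun x => mul_comm _ _)
  bound := by
    obtain ⟨M, hM, hM'⟩ := ha.abs_integral_mul_le hb
    obtain ⟨M₂, hM₂, hM₂'⟩ := hc.abs_integral_le
    obtain ⟨C, hC, hC'⟩ := hk.exists_norm_conv_le
    obtain ⟨D, hD, hD'⟩ := hl.exists_norm_conv_le
    refine ⟨C * (D * M₂) * M, fun τ hτ s hs => ?_⟩
    have hτ' := Ioo_subset_Icc_self hτ
    have hcs := MemLp.integrable_two (hc.memLp s hs)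
    have hl1 := (hl.smooth_conv hcs).integrable
    refine (abs_integral_mul_le_of_bound (C := C * (D * M₂))
      (integrable_mul_of_memLp (ha.memLp τ hτ') (hb.memLp τ hτ')) fun x => ?_).trans
      (mul_le_mul_of_nonneg_left (hM' τ hτ') (by positivity))
    refine (hC' _ hl1 x).trans (mul_le_mul_of_nonneg_left ?_ hC)
    calc ∫ z, |conv l (c s) z| ≤ ∫ _ : Torus3, D * M₂ := by
          refine integral_mono hl1.abs (integrable_const _) fun z => ?_
          exact (hD' _ hcs z).trans (mul_le_mul_of_nonneg_left (hM₂' s hs) hD)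
      _ = D * M₂ := by simp

/-- The content is the bound at every time rather than almost every time. Pairing u(s) with the
fixed u(t) gives a continuous function of s that is at most M‖u(t)‖ almost everywhere, hence
everywhere; s = t then gives ‖u(t)‖ ≤ M. -/
lemma WeaklyContinuousL2.goodField (hT : 0 < T) {u : ℝ → Torus3 → E3} {Du : ℝ → Torus3 → Mat3}
    (hw : WeaklyContinuousL2 T u) (hu : InEnergyClass T u Du) (j : Fin 3) :
    GoodField T fun t x => u t x j := by
  have hmem : ∀ t ∈ Icc 0 T, MemLp (fun x => u t x j) 2 volume := fun t ht =>
    memLp_apply (hw.memLp t ht) j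
  have hcont : ∀ g : Torus3 → ℝ, MemLp g 2 volume →
      ContinuousOn (fun t => ∫ x, u t x j * g x) (Icc 0 T) := by
    intro g hg
    have hg' : MemLp (fun x => EuclideanSpace.single j (g x) : Torus3 → E3) 2 volume := by
      have h1 : (fun x => EuclideanSpace.single j (g x) : Torus3 → E3) =
          fun x => g x • EuclideanSpace.single j (1 : ℝ) := by
        funext x
        ext i
        by_cases hi : i = j <;> simp [hi]
      rw [h1]
      exact (memLp_const (p := ⊤) (EuclideanSpace.single j (1 : ℝ))).smul hg
    refine (hw.continuous _ hg').congr fun t _ => ?_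
    refine integral_congr_ae (Eventually.of_forall fun x => ?_)
    simp [EuclideanSpace.inner_single_right, mul_comm]
  refine ⟨hu.measurable.apply j, hmem, ?_, hcont⟩
  obtain ⟨M, hM, hb⟩ := hu.exists_bound
  have hae : ∀ᵐ t ∂(volume.restrict (Icc 0 T)), ∫ x, u t x j ^ 2 ≤ M ^ 2 := by
    rw [← Measure.restrict_congr_set (Ioo_ae_eq_Icc (a := (0 : ℝ)) (b := T) (μ := volume))]
    filter_upwards [hb, hu.ae_memLp] with t h1 h2
    have h3 : eLpNorm (fun x => u t x j) 2 volume ≤ ENNReal.ofReal M := by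
      refine (eLpNorm_mono fun x => ?_).trans h1
      exact PiLp.norm_apply_le (u t x) j
    have hm := memLp_apply h2 j
    have h4 := hm.eLpNorm_eq_integral_rpow_norm (by norm_num) (by norm_num)
    rw [h4, ENNReal.ofReal_le_ofReal_iff hM] at h3
    simp only [ENNReal.toReal_ofNat, Real.norm_eq_abs, Real.rpow_two, sq_abs] at h3
    have h0 : (0 : ℝ) ≤ ∫ x, u t x j ^ 2 := integral_nonneg fun x => sq_nonneg _
    calc _ = ((∫ x, u t x j ^ 2) ^ (2⁻¹ : ℝ)) ^ 2 := by
          rw [← Real.rpow_natCast, ← Real.rpow_mul h0]; norm_num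
      _ ≤ M ^ 2 := pow_le_pow_left₀ (Real.rpow_nonneg h0 _) h3 2
  refine ⟨M, hM, fun t ht => ?_⟩
  set N := √(∫ x, u t x j ^ 2) with hN
  -- Taking the maximum with the bound turns an inequality almost everywhere into an equality of
  -- continuous functions, which extends to the whole interval.
  have hev := Measure.eqOn_Icc_of_ae_eq volume hT.ne
    (f := fun s => max (∫ x, u s x j * u t x j) (M * N)) (g := fun _ => M * N) ?_
    ((hcont _ (hmem t ht)).sup continuousOn_const) continuousOn_const ht
  · have h1 : ∫ x, u t x j * u t x j ≤ M * N := by simpa using hev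
    have h2 : ∫ x, u t x j * u t x j = N ^ 2 := by
      rw [hN, Real.sq_sqrt (integral_nonneg fun x => sq_nonneg _)]
      simp only [sq]
    have h3 : ∫ x, u t x j ^ 2 = N ^ 2 := by rw [← h2]; simp only [sq]
    rw [h3]
    have hN0 : 0 ≤ N := Real.sqrt_nonneg _
    rw [h2] at h1
    rcases hN0.eq_or_lt with h0 | h0
    · rw [← h0]; simpa using sq_nonneg M
    · refine pow_le_pow_left₀ hN0 ?_ 2
      nlinarith
  · filter_upwards [hae, ae_restrict_mem measurableSet_Icc] with s hs hsm
    refine max_eq_right ((le_abs_self _).trans ((HallMHD.abs_integral_mul_le (hmem s hsm)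
      (hmem t ht)).trans ?_))
    exact mul_le_mul_of_nonneg_right (Real.sqrt_le_iff.2 ⟨hM, hs⟩) (Real.sqrt_nonneg _)

end HallMHD

namespace HallMHD

variable {T ε : ℝ} {F ψ : Torus3 → E3}

/-! ### Smooth vector fields, divergence and curl -/

lemma smoothVector_iff : SmoothVector F ↔ ∀ j, SmoothScalar fun x => F x j :=
  contDiff_euclidean

lemma SmoothVector.apply (hF : SmoothVector F) (j : Fin 3) : SmoothScalar fun x => F x j :=
  smoothVector_iff.1 hF j

/-- Cyclic indices in `Fin 3` treat the three components of a curl uniformly. -/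
lemma curl_apply (F : Torus3 → E3) (x : Torus3) (j : Fin 3) :
    curl F x j = pderiv (j + 1) (fun y => F y (j + 2)) x - pderiv (j + 2) (fun y => F y (j + 1)) x := by
  fin_cases j <;> rfl

lemma SmoothVector.curl (hF : SmoothVector F) : SmoothVector (curl F) := by
  refine smoothVector_iff.2 fun j => ?_
  simp only [curl_apply]
  exact ((hF.apply _).pderiv _).sub ((hF.apply _).pderiv _)

lemma divg_curl (hF : SmoothVector F) (x : Torus3) : divg (curl F) x = 0 := by
  have h := fun i j k => congrFun (pderiv_comm (hF.apply k) i j) x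
  simp only [divg, curl_apply, Fin.sum_univ_three]
  rw [pderiv_sub ((hF.apply _).pderiv _) ((hF.apply _).pderiv _),
    pderiv_sub ((hF.apply _).pderiv _) ((hF.apply _).pderiv _),
    pderiv_sub ((hF.apply _).pderiv _) ((hF.apply _).pderiv _)]
  simp only [Fin.isValue, zero_add, show (1 : Fin 3) + 1 = 2 from rfl,
    show (1 : Fin 3) + 2 = 0 from rfl, show (2 : Fin 3) + 1 = 0 from rfl,
    show (2 : Fin 3) + 2 = 1 from rfl]
  rw [h 0 1 2, h 0 2 1, h 1 2 0]
  ring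

lemma inner_eq_sum (v w : E3) : inner ℝ v w = ∑ j, v j * w j := by
  simp [PiLp.inner_apply, mul_comm]

lemma sum_curl_mul {a : Fin 3 → ℝ} {x : Torus3} (F : Torus3 → E3) :
    ∑ j, a j * curl F x j =
      ∑ j, (a (j + 1) * pderiv (j + 2) (fun y => F y j) x
        - a (j + 2) * pderiv (j + 1) (fun y => F y j) x) := by
  simp only [curl_apply, Fin.sum_univ_three, Fin.isValue, zero_add,
    show (1 : Fin 3) + 1 = 2 from rfl, show (1 : Fin 3) + 2 = 0 from rfl,
    show (2 : Fin 3) + 1 = 0 from rfl, show (2 : Fin 3) + 2 = 1 from rfl]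
  ring

/-- The twice mollified vector field. -/
noncomputable def vmoll (ε : ℝ) (F : Torus3 → E3) (x : Torus3) : E3 :=
  WithLp.toLp 2 fun j => conv (rho ε) (conv (rho ε) fun y => F y j) x

lemma vmoll_apply (ε : ℝ) (F : Torus3 → E3) (j : Fin 3) :
    (fun x => vmoll ε F x j) = conv (rho ε) (conv (rho ε) fun y => F y j) := rfl

lemma smoothScalar_conv_rho (hε : 0 < ε) (hF : MemLp F 2 volume) (j : Fin 3) :
    SmoothScalar (conv (rho ε) fun y => F y j) :=
  (isKernel_rho hε).smooth_conv (MemLp.integrable_two (memLp_apply hF j))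

lemma smoothVector_vmoll (hε : 0 < ε) (hF : MemLp F 2 volume) : SmoothVector (vmoll ε F) :=
  smoothVector_iff.2 fun j =>
    (isKernel_rho hε).smooth_conv (smoothScalar_conv_rho hε hF j).integrable

lemma WeakDivFree.sum_pderiv_conv (h : WeakDivFree F) (hF : MemLp F 2 volume) (hε : 0 < ε)
    (x : Torus3) : ∑ i, pderiv i (conv (rho ε) fun y => F y i) x = 0 := by
  have hs := smoothScalar_conv_rho hε hF
  refine congrFun (SmoothScalar.eq_zero_of_orthogonal
    (SmoothScalar.sum fun i _ => (hs i).pderiv i) fun χ hχ => ?_) x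
  have hi : ∀ i, Integrable fun x => pderiv i (conv (rho ε) fun y => F y i) x * χ x := fun i =>
    (((hs i).pderiv i).mul hχ).integrable
  have hj : ∀ i, Integrable fun x => F x i * pderiv i (conv (rho ε) χ) x := fun i =>
    integrable_mul_of_memLp (memLp_apply hF i)
      ((((isKernel_rho hε).smooth_conv hχ.integrable).pderiv i).memLp 2)
  have h1 := h _ ((isKernel_rho hε).smooth_conv hχ.integrable)
  rw [integral_finsetSum _ fun i _ => hj i] at h1
  simp only [Finset.sum_mul]
  rw [integral_finsetSum _ fun i _ => hi i, ← neg_eq_zero, ← h1, ← Finset.sum_neg_distrib]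
  refine Finset.sum_congr rfl fun i _ => ?_
  rw [← integral_mul_pderiv (hs i) hχ, (isKernel_rho hε).conv_pderiv hχ,
    (hχ.pderiv i).conv_rho_comm hε (MemLp.integrable_two (memLp_apply hF i))]

lemma WeakDivFree.divg_vmoll (h : WeakDivFree F) (hF : MemLp F 2 volume) (hε : 0 < ε)
    (x : Torus3) : divg (vmoll ε F) x = 0 := by
  have hs := smoothScalar_conv_rho hε hF
  have h1 : ∀ i, pderiv i (fun y => vmoll ε F y i) =
      conv (rho ε) (pderiv i (conv (rho ε) fun y => F y i)) := fun i => by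
    rw [vmoll_apply, (isKernel_rho hε).conv_pderiv (hs i)]
  simp only [divg, h1]
  have h2 := (isKernel_rho hε).conv_sum (s := Finset.univ) fun i _ => ((hs i).pderiv i).integrable
  rw [← congrFun h2 x]
  simp only [h.sum_pderiv_conv hF hε, conv_const, mul_zero]

/-- The weak curl equation is tested with the field having the mollified χ in component j and 0
elsewhere; self-adjointness of the convolution moves the mollifier back to H and h. -/
lemma IsCurlInverse.curl_conv {h H : Torus3 → E3} (hH : IsCurlInverse h H)
    (hh : MemLp h 2 volume) (hε : 0 < ε) (j : Fin 3) :
    (fun x => pderiv (j + 1) (conv (rho ε) fun y => H y (j + 2)) x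
      - pderiv (j + 2) (conv (rho ε) fun y => H y (j + 1)) x) = conv (rho ε) fun y => h y j := by
  have hs := smoothScalar_conv_rho hε hH.memLp
  refine SmoothScalar.eq_of_forall_integral_mul_eq (((hs _).pderiv _).sub ((hs _).pderiv _))
    (smoothScalar_conv_rho hε hh j) fun χ hχ => ?_
  have hk := isKernel_rho hε
  have hχ' := hk.smooth_conv hχ.integrable
  have hψ : SmoothVector fun x => EuclideanSpace.single j (conv (rho ε) χ x) := by
    refine smoothVector_iff.2 fun i => ?_
    by_cases hi : i = j
    · simpa [hi] using hχ'
    · simpa [hi] using SmoothScalar.const 0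
  have h1 := hH.curl_eq _ hψ
  have hc : ∀ x, inner ℝ (H x) (curl (fun x => EuclideanSpace.single j (conv (rho ε) χ x)) x) =
      H x (j + 1) * pderiv (j + 2) (conv (rho ε) χ) x
        - H x (j + 2) * pderiv (j + 1) (conv (rho ε) χ) x := by
    intro x
    rw [inner_eq_sum, sum_curl_mul, Finset.sum_eq_single j]
    · simp
    · intro i _ hi
      simp [hi, pderiv_const]
    · simp
  have hr : ∀ x, inner ℝ (h x) (EuclideanSpace.single j (conv (rho ε) χ x)) =
      h x j * conv (rho ε) χ x := fun x => by
    simp [EuclideanSpace.inner_single_right, mul_comm]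
  simp only [hc, hr] at h1
  have hi : ∀ i l, Integrable fun x => H x i * pderiv l (conv (rho ε) χ) x := fun i l =>
    integrable_mul_of_memLp (memLp_apply hH.memLp i) ((hχ'.pderiv l).memLp 2)
  have hl : ∀ i l, ∫ x, pderiv l (conv (rho ε) fun y => H y i) x * χ x =
      - ∫ x, H x i * pderiv l (conv (rho ε) χ) x := fun i l => by
    rw [hk.conv_pderiv hχ, ← (hχ.pderiv l).conv_rho_comm hε
      (MemLp.integrable_two (memLp_apply hH.memLp i)), integral_mul_pderiv (hs i) hχ, neg_neg]
  rw [integral_sub (hi _ _) (hi _ _)] at h1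
  rw [hχ.conv_rho_comm hε (MemLp.integrable_two (memLp_apply hh j)), ← h1]
  simp only [sub_mul]
  rw [integral_sub (((hs _).pderiv _).mul hχ).integrable (((hs _).pderiv _).mul hχ).integrable,
    hl, hl]
  ring

lemma IsCurlInverse.curl_vmoll {h H : Torus3 → E3} (hH : IsCurlInverse h H)
    (hh : MemLp h 2 volume) (hε : 0 < ε) : curl (vmoll ε H) = vmoll ε h := by
  have hs := smoothScalar_conv_rho hε hH.memLp
  have hk := isKernel_rho hε
  funext x
  ext j
  rw [curl_apply, vmoll_apply, vmoll_apply, hk.conv_pderiv (hs _), hk.conv_pderiv (hs _),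
    ← congrFun (hk.conv_sub ((hs _).pderiv _).integrable ((hs _).pderiv _).integrable) x,
    hH.curl_conv hh hε]
  rfl

/-! ### The equations tested with time-independent fields -/

/-- The trilinear form `∫ ∑ aᵢ bⱼ ∂ᵢ ψⱼ`. -/
noncomputable def transport (a b ψ : Torus3 → E3) : ℝ :=
  ∑ i, ∑ j, ∫ x, a x i * b x j * pderiv i (fun y => ψ y j) x

/-- The bilinear form `∫ a · Δψ`. -/
noncomputable def diffusion (a ψ : Torus3 → E3) : ℝ :=
  ∑ j, ∑ i, ∫ x, a x j * 1 * pderiv i (pderiv i fun y => ψ y j) x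

lemma integrable_mul_mul {f g χ : Torus3 → ℝ} (hf : MemLp f 2 volume) (hg : MemLp g 2 volume)
    (hχ : SmoothScalar χ) : Integrable fun x => f x * g x * χ x := by
  obtain ⟨C, -, hC⟩ := exists_norm_le_of_continuous hχ.continuous
  exact (integrable_mul_of_memLp hf hg).mul_bdd hχ.continuous.aestronglyMeasurable
    (Eventually.of_forall hC)

lemma isTestField_smul {θ : ℝ → ℝ} (hθ : ContDiff ℝ (⊤ : ℕ∞) θ)
    (hc : ∃ a b : ℝ, 0 < a ∧ b < T ∧ ∀ t, t ∉ Icc a b → θ t = 0) (hψ : SmoothVector ψ)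
    (hd : ∀ x, divg ψ x = 0) : IsTestField T fun t x => θ t • ψ x where
  smooth := (hθ.comp contDiff_fst).smul (hψ.comp contDiff_snd)
  compactSupport := by
    obtain ⟨a, b, ha, hb, h⟩ := hc
    exact ⟨a, b, ha, hb, fun t ht x => by rw [h t ht, zero_smul]⟩
  divFree t x := by
    have h := hd x
    simp only [divg] at h
    simp [divg, pderiv_const_mul, ← Finset.mul_sum, h]

lemma integrable_sum_sum {α : Type*} [MeasurableSpace α] {μ : Measure α}
    {f : Fin 3 → Fin 3 → α → ℝ} (h : ∀ i j, Integrable (f i j) μ) :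
    Integrable (fun x => ∑ i, ∑ j, f i j x) μ :=
  integrable_finsetSum _ fun i _ => integrable_finsetSum _ fun j _ => h i j

lemma integral_sum_sum {α : Type*} [MeasurableSpace α] {μ : Measure α}
    {f : Fin 3 → Fin 3 → α → ℝ} (h : ∀ i j, Integrable (f i j) μ) :
    ∫ x, ∑ i, ∑ j, f i j x ∂μ = ∑ i, ∑ j, ∫ x, f i j x ∂μ := by
  rw [integral_finsetSum _ fun i _ => integrable_finsetSum _ fun j _ => h i j]
  exact Finset.sum_congr rfl fun i _ => integral_finsetSum _ fun j _ => h i j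

lemma integral_linear_combination {A B C D : Torus3 → ℝ} (hA : Integrable A) (hB : Integrable B)
    (hC : Integrable C) (hD : Integrable D) (c d : ℝ) :
    ∫ x, (A x * c + (B x - C x + D x) * d) =
      (∫ x, A x) * c + ((∫ x, B x) - (∫ x, C x) + ∫ x, D x) * d := by
  have h1 : Integrable fun x => B x - C x := hB.sub hC
  have h2 : Integrable fun x => B x - C x + D x := h1.add hD
  rw [integral_add (hA.mul_const _) (h2.mul_const _), integral_mul_const, integral_mul_const,
    integral_add h1 hD, integral_sub hB hC]

section weakform

variable {u h : ℝ → Torus3 → E3} {Du Dh : ℝ → Torus3 → Mat3}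

lemma twoTime_transport_const (hu : ∀ j, GoodField T fun t x => u t x j)
    (hh : ∀ j, GoodField T fun t x => h t x j) (hψ : SmoothVector ψ) :
    TwoTime T fun τ _ => transport (u τ) (h τ) ψ :=
  .sum fun i => .sum fun j => (hu i).twoTime_const (hh j) ((hψ.apply j).pderiv i).continuous

/-- The factor `1` in `diffusion` acts as the second field, so that linear terms are covered by the
lemmas on products of two fields. -/
lemma twoTime_diffusion_const (hu : ∀ j, GoodField T fun t x => u t x j) (hψ : SmoothVector ψ) :
    TwoTime T fun τ _ => diffusion (u τ) ψ :=
  .sum fun j => .sum fun i => (hu j).twoTime_const (goodField_const T 1)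
    (((hψ.apply j).pderiv i).pderiv i).continuous

lemma continuousOn_integral_inner (hu : WeaklyContinuousL2 T u) (hψ : SmoothVector ψ) :
    ContinuousOn (fun t => ∫ x, inner ℝ (u t x) (ψ x)) (Icc 0 T) := by
  refine hu.continuous ψ ?_
  have hc : Continuous ψ := continuous_of_comp_proj hψ.continuous
  obtain ⟨C, -, hC⟩ := exists_norm_le_of_continuous hc
  exact MemLp.of_bound hc.aestronglyMeasurable C (Eventually.of_forall hC)

lemma integrable_inner (hF : MemLp F 2 volume) (hψ : SmoothVector ψ) :
    Integrable fun x => inner ℝ (F x) (ψ x) := by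
  simp only [inner_eq_sum]
  exact integrable_finsetSum _ fun j _ =>
    integrable_mul_of_memLp (memLp_apply hF j) ((hψ.apply j).memLp 2)

lemma integral_transport {a b : Torus3 → E3} (ha : MemLp a 2 volume) (hb : MemLp b 2 volume)
    (hψ : SmoothVector ψ) :
    (Integrable fun x => ∑ i, ∑ j, a x i * b x j * pderiv i (fun y => ψ y j) x) ∧
      ∫ x, ∑ i, ∑ j, a x i * b x j * pderiv i (fun y => ψ y j) x = transport a b ψ := by
  have h := fun i j => integrable_mul_mul (memLp_apply ha i) (memLp_apply hb j)
    ((hψ.apply j).pderiv i)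
  exact ⟨integrable_sum_sum h, integral_sum_sum h⟩

lemma integral_diffusion {a : Torus3 → E3} (ha : MemLp a 2 volume) (hψ : SmoothVector ψ) :
    (Integrable fun x => ∑ j, a x j * lapl (fun y => ψ y j) x) ∧
      ∫ x, ∑ j, a x j * lapl (fun y => ψ y j) x = diffusion a ψ := by
  have h := fun j i => integrable_mul_mul (memLp_apply ha j) (memLp_const (1 : ℝ))
    (((hψ.apply j).pderiv i).pderiv i)
  have e : (fun x => ∑ j, a x j * lapl (fun y => ψ y j) x) =
      fun x => ∑ j, ∑ i, a x j * 1 * pderiv i (pderiv i fun y => ψ y j) x := by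
    simp only [lapl, Finset.mul_sum, mul_one]
  rw [e]
  exact ⟨integrable_sum_sum h, integral_sum_sum h⟩

/-- Test fields θ(t) ψ(x) show that the weak time derivative of t ↦ ⟨u(t), ψ⟩ is a bounded function.
This pairing is continuous by weak continuity, so it is the primitive of that function between any
two times, endpoints included. -/
lemma IsWeakSolution.momentum_sub (hT : 0 < T) (hs : IsWeakSolution T u h)
    (hu : InEnergyClass T u Du) (hh : InEnergyClass T h Dh) (hψ : SmoothVector ψ)
    (hd : ∀ x, divg ψ x = 0) {t r : ℝ} (ht : t ∈ Icc 0 T) (hr : r ∈ Icc 0 T) :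
    (∫ x, inner ℝ (u t x) (ψ x)) - ∫ x, inner ℝ (u r x) (ψ x) =
      ∫ τ in r..t, (transport (u τ) (u τ) ψ - transport (h τ) (h τ) ψ + diffusion (u τ) ψ) := by
  have gu := hs.weakCont_u.goodField hT hu
  have gh := hs.weakCont_h.goodField hT hh
  refine sub_eq_integral_of_weak_deriv hT (continuousOn_integral_inner hs.weakCont_u hψ)
    ((((twoTime_transport_const gu gu hψ).sub (twoTime_transport_const gh gh hψ)).add
      (twoTime_diffusion_const gu hψ)).integrableOn ht) (fun θ hθ hc => ?_) ht hr
  refine Eq.trans ?_ (hs.momentum _ (isTestField_smul hθ hc hψ hd))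
  refine setIntegral_congr_fun measurableSet_Ioo fun τ hτ => Eq.symm ?_
  have hτ' := Ioo_subset_Icc_self hτ
  have mu := hs.weakCont_u.memLp τ hτ'
  have mh := hs.weakCont_h.memLp τ hτ'
  have hθd : DifferentiableAt ℝ θ τ := hθ.differentiable (by simp) τ
  have e : ∀ x, (inner ℝ (u τ x) (deriv (fun s => θ s • ψ x) τ)
      + ∑ i, ∑ j, (u τ x i * u τ x j - h τ x i * h τ x j) * pderiv i (fun y => (θ τ • ψ y) j) x
      + ∑ j, u τ x j * lapl (fun y => (θ τ • ψ y) j) x) =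
      inner ℝ (u τ x) (ψ x) * deriv θ τ
      + ((∑ i, ∑ j, u τ x i * u τ x j * pderiv i (fun y => ψ y j) x)
        - (∑ i, ∑ j, h τ x i * h τ x j * pderiv i (fun y => ψ y j) x)
        + ∑ j, u τ x j * lapl (fun y => ψ y j) x) * θ τ := by
    intro x
    rw [deriv_smul_const hθd, inner_smul_right]
    simp only [PiLp.smul_apply, smul_eq_mul, pderiv_const_mul, lapl, ← Finset.mul_sum]
    simp only [← Finset.sum_sub_distrib, Finset.sum_mul, add_mul, ← add_assoc]
    congr 1
    · congr 1
      · ring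
      · refine Finset.sum_congr rfl fun i _ => Finset.sum_congr rfl fun j _ => by ring
    · refine Finset.sum_congr rfl fun j _ => by ring
  simp only [e]
  obtain ⟨i1, e1⟩ := integral_transport mu mu hψ
  obtain ⟨i2, e2⟩ := integral_transport mh mh hψ
  obtain ⟨i3, e3⟩ := integral_diffusion mu hψ
  rw [integral_linear_combination (integrable_inner mu hψ) i1 i2 i3, e1, e2, e3]

lemma IsWeakSolution.induction_sub (hT : 0 < T) (hs : IsWeakSolution T u h)
    (hu : InEnergyClass T u Du) (hh : InEnergyClass T h Dh) (hψ : SmoothVector ψ)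
    (hd : ∀ x, divg ψ x = 0) {t r : ℝ} (ht : t ∈ Icc 0 T) (hr : r ∈ Icc 0 T) :
    (∫ x, inner ℝ (h t x) (ψ x)) - ∫ x, inner ℝ (h r x) (ψ x) =
      ∫ τ in r..t, (transport (u τ) (h τ) ψ - transport (h τ) (u τ) ψ
        + transport (h τ) (h τ) (curl ψ) + diffusion (h τ) ψ) := by
  have gu := hs.weakCont_u.goodField hT hu
  have gh := hs.weakCont_h.goodField hT hh
  refine sub_eq_integral_of_weak_deriv hT (continuousOn_integral_inner hs.weakCont_h hψ)
    (((((twoTime_transport_const gu gh hψ).sub (twoTime_transport_const gh gu hψ)).add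
      (twoTime_transport_const gh gh hψ.curl)).add
      (twoTime_diffusion_const gh hψ)).integrableOn ht) (fun θ hθ hc => ?_) ht hr
  refine Eq.trans ?_ (hs.induction_eq _ (isTestField_smul hθ hc hψ hd))
  refine setIntegral_congr_fun measurableSet_Ioo fun τ hτ => Eq.symm ?_
  have hτ' := Ioo_subset_Icc_self hτ
  have mu := hs.weakCont_u.memLp τ hτ'
  have mh := hs.weakCont_h.memLp τ hτ'
  have hθd : DifferentiableAt ℝ θ τ := hθ.differentiable (by simp) τ
  have ec : ∀ j, (fun y => curl (fun y => θ τ • ψ y) y j) = fun y => θ τ * curl ψ y j := by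
    intro j
    funext y
    simp only [curl_apply, PiLp.smul_apply, smul_eq_mul, pderiv_const_mul]
    ring
  have e : ∀ x, (inner ℝ (h τ x) (deriv (fun s => θ s • ψ x) τ)
      + ∑ i, ∑ j, (u τ x i * h τ x j - h τ x i * u τ x j) * pderiv i (fun y => (θ τ • ψ y) j) x
      + ∑ i, ∑ j, h τ x i * h τ x j * pderiv i (fun y => curl (fun y => θ τ • ψ y) y j) x
      + ∑ j, h τ x j * lapl (fun y => (θ τ • ψ y) j) x) =
      inner ℝ (h τ x) (ψ x) * deriv θ τ
      + ((∑ i, ∑ j, u τ x i * h τ x j * pderiv i (fun y => ψ y j) x)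
        - (∑ i, ∑ j, h τ x i * u τ x j * pderiv i (fun y => ψ y j) x)
        + ((∑ i, ∑ j, h τ x i * h τ x j * pderiv i (fun y => curl ψ y j) x)
        + ∑ j, h τ x j * lapl (fun y => ψ y j) x)) * θ τ := by
    intro x
    rw [deriv_smul_const hθd, inner_smul_right]
    simp only [ec]
    simp only [PiLp.smul_apply, smul_eq_mul, pderiv_const_mul, lapl, ← Finset.mul_sum]
    simp only [← Finset.sum_sub_distrib, Finset.sum_mul, add_mul, ← add_assoc]
    congr 1
    · congr 1
      · congr 1
        · ring
        · refine Finset.sum_congr rfl fun i _ => Finset.sum_congr rfl fun j _ => by ring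
      · refine Finset.sum_congr rfl fun i _ => Finset.sum_congr rfl fun j _ => by ring
    · refine Finset.sum_congr rfl fun j _ => by ring
  simp only [e]
  obtain ⟨i1, e1⟩ := integral_transport mu mh hψ
  obtain ⟨i2, e2⟩ := integral_transport mh mu hψ
  obtain ⟨i3, e3⟩ := integral_diffusion mh hψ
  obtain ⟨i4, e4⟩ := integral_transport mh mh hψ.curl
  have i43 : Integrable fun x => (∑ i, ∑ j, h τ x i * h τ x j * pderiv i (fun y => curl ψ y j) x)
      + ∑ j, h τ x j * lapl (fun y => ψ y j) x := i4.add i3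
  rw [integral_linear_combination (integrable_inner mh hψ) i1 i2 i43, integral_add i4 i3,
    e1, e2, e3, e4, add_assoc (transport (u τ) (h τ) ψ - transport (h τ) (u τ) ψ)]

end weakform

end HallMHD

/-! ### Flux terms: cancellations and commutators. -/

namespace HallMHD

variable {T ε : ℝ} {a b c U V W ψ : Torus3 → E3}

/-! ### Cancellations for smooth fields -/

/-- Integrate by parts in ∂ᵢ; the terms in which the derivative falls on Uᵢ sum over i to the
divergence of U. -/
lemma transport_antisymm (hU : SmoothVector U) (hd : ∀ x, divg U x = 0) (hV : SmoothVector V)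
    (hW : SmoothVector W) : transport U V W = - transport U W V := by
  have key : ∀ j, ∑ i, ∫ x, U x i * V x j * pderiv i (fun y => W y j) x =
      - ∑ i, ∫ x, U x i * W x j * pderiv i (fun y => V y j) x := by
    intro j
    have h1 : ∀ i, ∫ x, U x i * V x j * pderiv i (fun y => W y j) x =
        - (∫ x, pderiv i (fun y => U y i) x * (V x j * W x j))
          - ∫ x, U x i * W x j * pderiv i (fun y => V y j) x := by
      intro i
      rw [integral_mul_pderiv ((hU.apply i).mul (hV.apply j)) (hW.apply j),
        pderiv_mul (hU.apply i) (hV.apply j)]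
      have i1 : Integrable fun x => pderiv i (fun y => U y i) x * (V x j * W x j) :=
        (((hU.apply i).pderiv i).mul ((hV.apply j).mul (hW.apply j))).integrable
      have i2 : Integrable fun x => U x i * W x j * pderiv i (fun y => V y j) x :=
        (((hU.apply i).mul (hW.apply j)).mul ((hV.apply j).pderiv i)).integrable
      rw [← neg_add', ← integral_add i1 i2]
      congr 1
      refine integral_congr_ae (Eventually.of_forall fun x => ?_)
      simp only
      ring
    have h2 : ∑ i, ∫ x, pderiv i (fun y => U y i) x * (V x j * W x j) = 0 := by
      rw [← integral_finsetSum _ fun i _ =>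
        (((hU.apply i).pderiv i).mul ((hV.apply j).mul (hW.apply j))).integrable]
      simp only [← Finset.sum_mul]
      simp only [divg] at hd
      simp [hd]
    simp only [h1, Finset.sum_sub_distrib, Finset.sum_neg_distrib, h2, neg_zero, zero_sub]
  rw [transport, Finset.sum_comm, transport, Finset.sum_comm (f := fun i j =>
    ∫ x, U x i * W x j * pderiv i (fun y => V y j) x), ← Finset.sum_neg_distrib]
  exact Finset.sum_congr rfl fun j _ => key j

lemma transport_self (hU : SmoothVector U) (hd : ∀ x, divg U x = 0) (hV : SmoothVector V) :
    transport U V V = 0 := by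
  linarith [transport_antisymm hU hd hV hV]

/-- The Hall term does not contribute to the energy of smooth fields. -/
lemma transport_curl_self (hU : SmoothVector U) (hd : ∀ x, divg U x = 0) :
    transport U U (curl U) = 0 := by
  have h0 := transport_self hU.curl (fun x => divg_curl hU x) hU
  -- With ω = curl U, the forms (U, ω, U) and (ω, U, U) have the same integrand, since their
  -- difference is Σ Uᵢ ωⱼ (∂ᵢUⱼ − ∂ⱼUᵢ) = ± U·(ω × ω) = 0. The second form vanishes because ω is
  -- divergence-free.
  rw [transport_antisymm hU hd hU hU.curl, neg_eq_zero, ← h0]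
  have i1 : ∀ i j, Integrable fun x => U x i * curl U x j * pderiv i (fun y => U y j) x :=
    fun i j => (((hU.apply i).mul (hU.curl.apply j)).mul ((hU.apply j).pderiv i)).integrable
  have i2 : ∀ i j, Integrable fun x => curl U x i * U x j * pderiv i (fun y => U y j) x :=
    fun i j => (((hU.curl.apply i).mul (hU.apply j)).mul ((hU.apply j).pderiv i)).integrable
  rw [transport, transport, ← integral_sum_sum i1, ← integral_sum_sum i2]
  refine integral_congr_ae (Eventually.of_forall fun x => ?_)
  simp only [curl_apply, Fin.sum_univ_three, Fin.isValue, zero_add,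
    show (1 : Fin 3) + 1 = 2 from rfl, show (1 : Fin 3) + 2 = 0 from rfl,
    show (2 : Fin 3) + 1 = 0 from rfl, show (2 : Fin 3) + 2 = 1 from rfl]
  ring

/-! ### Mollified vector fields -/

/-- The mollified vector field. -/
noncomputable def moll (ε : ℝ) (F : Torus3 → E3) (x : Torus3) : E3 :=
  WithLp.toLp 2 fun j => conv (rho ε) (fun y => F y j) x

lemma moll_apply (ε : ℝ) (F : Torus3 → E3) (j : Fin 3) :
    (fun x => moll ε F x j) = conv (rho ε) fun y => F y j := rfl

lemma vmoll_eq (ε : ℝ) (F : Torus3 → E3) : vmoll ε F = moll ε (moll ε F) := rfl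

lemma smoothVector_moll (hε : 0 < ε) (ha : MemLp a 2 volume) : SmoothVector (moll ε a) :=
  smoothVector_iff.2 fun j => smoothScalar_conv_rho hε ha j

lemma WeakDivFree.divg_moll (h : WeakDivFree a) (ha : MemLp a 2 volume) (hε : 0 < ε)
    (x : Torus3) : divg (moll ε a) x = 0 :=
  h.sum_pderiv_conv ha hε x

lemma curl_moll (hε : 0 < ε) (hψ : SmoothVector ψ) : curl (moll ε ψ) = moll ε (curl ψ) := by
  have hk := isKernel_rho hε
  funext x
  ext j
  rw [curl_apply, moll_apply, moll_apply, hk.conv_pderiv (hψ.apply _), hk.conv_pderiv (hψ.apply _),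
    ← congrFun (hk.conv_sub ((hψ.apply _).pderiv _).integrable ((hψ.apply _).pderiv _).integrable) x]
  change _ = conv (rho ε) (fun y => curl ψ y j) x
  simp only [curl_apply]

/-- The commutator part of a mollified trilinear form. -/
noncomputable def commTransport (ε : ℝ) (a b ψ : Torus3 → E3) : ℝ :=
  ∑ i, ∑ j, ∫ x, commut ε (fun y => a y i) (fun y => b y j) x * pderiv i (fun y => ψ y j) x

/-- The outer mollifier moves from the test field onto the product aᵢ bⱼ, and `commut` is by
definition the defect between the mollified product and the product of mollifications. -/
lemma transport_moll (hε : 0 < ε) (ha : MemLp a 2 volume) (hb : MemLp b 2 volume)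
    (hψ : SmoothVector ψ) :
    transport a b (moll ε ψ) = transport (moll ε a) (moll ε b) ψ + commTransport ε a b ψ := by
  have hk := isKernel_rho hε
  simp only [transport, commTransport, ← Finset.sum_add_distrib]
  refine Finset.sum_congr rfl fun i _ => Finset.sum_congr rfl fun j _ => ?_
  have hab := integrable_mul_of_memLp (memLp_apply ha i) (memLp_apply hb j)
  have hg := (hψ.apply j).pderiv i
  have h1 := hk.smooth_conv hab
  have h2 := (smoothScalar_conv_rho hε ha i).mul (smoothScalar_conv_rho hε hb j)
  rw [moll_apply, hk.conv_pderiv (hψ.apply j), ← hg.conv_rho_comm hε hab]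
  have i1 : Integrable fun x => moll ε a x i * moll ε b x j * pderiv i (fun y => ψ y j) x :=
    (h2.mul hg).integrable
  have i2 : Integrable fun x => commut ε (fun y => a y i) (fun y => b y j) x
      * pderiv i (fun y => ψ y j) x := ((h1.sub h2).mul hg).integrable
  rw [← integral_add i1 i2]
  refine integral_congr_ae (Eventually.of_forall fun x => ?_)
  simp only [commut]
  rw [show moll ε a x i = conv (rho ε) (fun y => a y i) x from rfl,
    show moll ε b x j = conv (rho ε) (fun y => b y j) x from rfl]
  ring

lemma IsKernel.pderiv_conv_scale {k : E3 → ℝ} (hk : IsKernel k) (hε : 0 < ε) {f : Torus3 → ℝ}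
    (hf : Integrable f) (i : Fin 3) :
    pderiv i (conv (HallMHD.scale ε k) f) =
      fun x => ε⁻¹ * conv (HallMHD.scale ε (HallMHD.dker i k)) f x := by
  rw [(hk.scale hε).pderiv_conv hf, dker_scale hk]
  funext x
  simp only [conv, ← integral_const_mul, mul_assoc]

lemma enorm_sum_sum_le {f : Fin 3 → Fin 3 → ℝ} {B : Fin 3 → Fin 3 → ℝ≥0∞}
    (h : ∀ i j, ‖f i j‖ₑ ≤ B i j) : ‖∑ i, ∑ j, f i j‖ₑ ≤ ∑ i, ∑ j, B i j :=
  (enorm_sum_le _ _).trans (Finset.sum_le_sum fun i _ =>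
    (enorm_sum_le _ _).trans (Finset.sum_le_sum fun j _ => h i j))

/-- The derivative ∂ᵢ falls on the mollifier of c, costing one ε⁻¹ and leaving a kernel of mass
zero, as the commutator estimate requires. -/
lemma exists_enorm_commTransport_le :
    ∃ C : ℝ≥0∞, C ≠ ⊤ ∧ ∀ ε, 0 < ε → ∀ a b c : Torus3 → E3,
      MemLp a 2 volume → MemLp b 2 volume → MemLp c 2 volume →
      ‖commTransport ε a b (moll ε c)‖ₑ ≤
        C * (ENNReal.ofReal ε⁻¹ * (oscInt ε a + oscInt ε b + oscInt ε c)) := by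
  choose C hC hC' using fun i => (isUnitKernel_rho1.dker i).exists_enorm_integral_commut_mul_le
    (integral_dker_eq_zero isKernel_rho1 i)
  refine ⟨∑ i, ∑ _j : Fin 3, C i, ?_, fun ε hε a b c ha hb hc => ?_⟩
  · exact ENNReal.sum_ne_top.2 fun i _ => ENNReal.sum_ne_top.2 fun j _ => hC i
  simp only [Finset.sum_mul]
  refine enorm_sum_sum_le fun i j => ?_
  have e : ∀ x, pderiv i (fun y => moll ε c y j) x =
      ε⁻¹ * conv (scale ε (dker i rho1)) (fun y => c y j) x := fun x =>
    congrFun (isKernel_rho1.pderiv_conv_scale hε (MemLp.integrable_two (memLp_apply hc j)) i) x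
  simp only [e, mul_left_comm _ ε⁻¹]
  rw [integral_const_mul, enorm_mul, Real.enorm_of_nonneg (by positivity), mul_left_comm]
  gcongr
  exact hC' i ε hε a b c ha hb hc i j j

/-- Here two derivatives, ∂ᵢ and the one in the curl, fall on the mollifier and cost ε⁻². This is
why the Hall term requires order 2/3 where transport requires 1/3. -/
lemma exists_enorm_commTransport_curl_le :
    ∃ C : ℝ≥0∞, C ≠ ⊤ ∧ ∀ ε, 0 < ε → ∀ a b c : Torus3 → E3,
      MemLp a 2 volume → MemLp b 2 volume → MemLp c 2 volume →
      ‖commTransport ε a b (curl (moll ε c))‖ₑ ≤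
        C * (ENNReal.ofReal (ε⁻¹ ^ 2) * (oscInt ε a + oscInt ε b + oscInt ε c)) := by
  choose C hC hC' using fun i m => ((isUnitKernel_rho1.dker m).dker i).exists_enorm_integral_commut_mul_le
    (integral_dker_eq_zero (isKernel_rho1.dker m) i)
  refine ⟨∑ i, ∑ j : Fin 3, (C i (j + 1) + C i (j + 2)), ?_, fun ε hε a b c ha hb hc => ?_⟩
  · exact ENNReal.sum_ne_top.2 fun i _ => ENNReal.sum_ne_top.2 fun j _ =>
      ENNReal.add_ne_top.2 ⟨hC _ _, hC _ _⟩
  simp only [Finset.sum_mul]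
  refine enorm_sum_sum_le fun i j => ?_
  have hi := fun l => MemLp.integrable_two (memLp_apply hc l)
  have hs := smoothScalar_conv_rho hε hc
  have e1 : ∀ m l, pderiv i (pderiv m (fun y => moll ε c y l)) = fun x =>
      ε⁻¹ ^ 2 * conv (scale ε (dker i (dker m rho1))) (fun y => c y l) x := by
    intro m l
    have h1 := isKernel_rho1.pderiv_conv_scale hε (hi l) m
    rw [moll_apply, rho, h1, pderiv_const_mul, (isKernel_rho1.dker m).pderiv_conv_scale hε (hi l) i]
    funext x
    ring
  have e : ∀ x, pderiv i (fun y => curl (moll ε c) y j) x =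
      ε⁻¹ ^ 2 * conv (scale ε (dker i (dker (j + 1) rho1))) (fun y => c y (j + 2)) x
      - ε⁻¹ ^ 2 * conv (scale ε (dker i (dker (j + 2) rho1))) (fun y => c y (j + 1)) x := by
    intro x
    simp only [curl_apply]
    have h2 := pderiv_sub ((hs (j + 2)).pderiv (j + 1)) ((hs (j + 1)).pderiv (j + 2)) i
    exact (congrFun h2 x).trans (congrArg₂ _ (congrFun (e1 _ _) x) (congrFun (e1 _ _) x))
  have hcm : SmoothScalar (commut ε (fun y => a y i) (fun y => b y j)) :=
    ((isKernel_rho hε).smooth_conv (integrable_mul_of_memLp (memLp_apply ha i)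
      (memLp_apply hb j))).sub ((smoothScalar_conv_rho hε ha i).mul (smoothScalar_conv_rho hε hb j))
  have hint : ∀ m l, Integrable fun x => ε⁻¹ ^ 2 * (commut ε (fun y => a y i) (fun y => b y j) x
      * conv (scale ε (dker i (dker m rho1))) (fun y => c y l) x) := fun m l =>
    (hcm.mul ((((isKernel_rho1.dker m).dker i).scale hε).smooth_conv (hi l))).integrable.const_mul _
  simp only [e, mul_sub, mul_left_comm _ (ε⁻¹ ^ 2)]
  rw [integral_sub (hint _ _) (hint _ _), integral_const_mul, integral_const_mul, add_mul]
  refine (enorm_sub_le).trans (add_le_add ?_ ?_)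
  all_goals
    rw [enorm_mul, Real.enorm_of_nonneg (by positivity), mul_left_comm]
    gcongr
    exact hC' _ _ ε hε a b c ha hb hc i j _

/-! ### Quadratic terms -/

lemma integral_inner_vmoll (hε : 0 < ε) (ha : MemLp a 2 volume) (hb : MemLp b 2 volume) :
    ∫ x, inner ℝ (a x) (vmoll ε b x) =
      ∑ j, ∫ x, conv (rho ε) (fun y => a y j) x * conv (rho ε) (fun y => b y j) x := by
  have hs := smoothScalar_conv_rho hε hb
  simp only [inner_eq_sum]
  rw [integral_finsetSum]
  · refine Finset.sum_congr rfl fun j _ => ?_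
    exact ((hs j).conv_rho_comm hε (MemLp.integrable_two (memLp_apply ha j))).symm
  · intro j _
    exact integrable_mul_of_memLp (memLp_apply ha j)
      (((smoothVector_vmoll hε hb).apply j).memLp 2)

lemma integral_inner_vmoll_comm (hε : 0 < ε) (ha : MemLp a 2 volume) (hb : MemLp b 2 volume) :
    ∫ x, inner ℝ (a x) (vmoll ε b x) = ∫ x, inner ℝ (b x) (vmoll ε a x) := by
  rw [integral_inner_vmoll hε ha hb, integral_inner_vmoll hε hb ha]
  simp only [mul_comm]

/-- One mollifier goes to each factor; integration by parts then yields minus the squared L² norm of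
the mollified gradient. -/
lemma diffusion_vmoll (hε : 0 < ε) (ha : MemLp a 2 volume) {D : Torus3 → Mat3}
    (hD : MemLp D 2 volume) (h : IsWeakGradient a D) :
    diffusion a (vmoll ε a) = - ∑ j, ∑ i, ∫ x, conv (rho ε) (fun y => D y (i, j)) x ^ 2 := by
  have hs := smoothScalar_conv_rho hε ha
  have hk := isKernel_rho hε
  simp only [diffusion, ← Finset.sum_neg_distrib]
  refine Finset.sum_congr rfl fun j _ => Finset.sum_congr rfl fun i _ => ?_
  have ha' := MemLp.integrable_two (memLp_apply ha j)
  have hp := (h.hasWeakPartial i j).pderiv_conv hε ha' (MemLp.integrable_two (memLp_apply_matrix hD _))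
  simp only [mul_one]
  rw [vmoll_apply, hk.conv_pderiv (hs j), hk.conv_pderiv ((hs j).pderiv i),
    ← (((hs j).pderiv i).pderiv i).conv_rho_comm hε ha', integral_mul_pderiv (hs j) ((hs j).pderiv i),
    hp]
  simp only [sq]

/-! ### Two-time integrands of the mollified equations -/

lemma TwoTime.congr {G G' : ℝ → ℝ → ℝ} (h : TwoTime T G)
    (e : ∀ τ ∈ Ioo 0 T, ∀ s ∈ Icc 0 T, G' τ s = G τ s) : TwoTime T G' where
  meas s hs := (h.meas s hs).congr (by
    filter_upwards [ae_restrict_mem measurableSet_Ioo] with τ hτ using (e τ hτ s hs).symm)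
  diag := h.diag.congr (by
    filter_upwards [ae_restrict_mem measurableSet_Ioo] with τ hτ
    exact (e τ hτ τ (Ioo_subset_Icc_self hτ)).symm)
  cont τ hτ := (h.cont τ hτ).congr fun s hs => e τ hτ s hs
  bound := by
    obtain ⟨M, hM⟩ := h.bound
    exact ⟨M, fun τ hτ s hs => by rw [e τ hτ s hs]; exact hM τ hτ s hs⟩

section

variable {u v w : ℝ → Torus3 → E3}

/-- The derivative is absorbed by the outer kernel, which brings each entry to the form of
`GoodField.twoTime_conv`; the diffusion and curl versions differ only in the number of derivatives
absorbed. -/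
lemma twoTime_transport (hε : 0 < ε) (hu : ∀ j, GoodField T fun t x => u t x j)
    (hv : ∀ j, GoodField T fun t x => v t x j) (hw : ∀ j, GoodField T fun t x => w t x j) :
    TwoTime T fun τ s => transport (u τ) (v τ) (vmoll ε (w s)) := by
  have hk := isKernel_rho hε
  refine .sum fun i => .sum fun j =>
    ((hu i).twoTime_conv (hv j) (hw j) (hk.dker i) hk).congr fun τ _ s hs => ?_
  rw [vmoll_apply, hk.pderiv_conv]
  exact (hk.smooth_conv (MemLp.integrable_two ((hw j).memLp s hs))).integrable

lemma twoTime_diffusion (hε : 0 < ε) (hu : ∀ j, GoodField T fun t x => u t x j)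
    (hw : ∀ j, GoodField T fun t x => w t x j) :
    TwoTime T fun τ s => diffusion (u τ) (vmoll ε (w s)) := by
  have hk := isKernel_rho hε
  refine .sum fun j => .sum fun i =>
    ((hu j).twoTime_conv (goodField_const T 1) (hw j) ((hk.dker i).dker i) hk).congr
      fun τ _ s hs => ?_
  have hi := (hk.smooth_conv (MemLp.integrable_two ((hw j).memLp s hs))).integrable
  rw [vmoll_apply, hk.pderiv_conv hi, (hk.dker i).pderiv_conv hi]

lemma twoTime_transport_curl (hε : 0 < ε) (hu : ∀ j, GoodField T fun t x => u t x j)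
    (hv : ∀ j, GoodField T fun t x => v t x j) (hw : ∀ j, GoodField T fun t x => w t x j) :
    TwoTime T fun τ s => transport (u τ) (v τ) (curl (vmoll ε (w s))) := by
  have hk := isKernel_rho hε
  refine .sum fun i => .sum fun j =>
    (((hu i).twoTime_conv (hv j) (hw (j + 2)) ((hk.dker (j + 1)).dker i) hk).sub
      ((hu i).twoTime_conv (hv j) (hw (j + 1)) ((hk.dker (j + 2)).dker i) hk)).congr
      fun τ hτ s hs => ?_
  have hs' := fun l => hk.smooth_conv (MemLp.integrable_two ((hw l).memLp s hs))
  have hi := fun l => (hs' l).integrable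
  have e := fun m l => hk.pderiv_conv (hi l) m
  have e2 := fun m l => (hk.dker m).pderiv_conv (hi l) i
  have hsm := fun m l => (hk.dker m).smooth_conv (hi l)
  have hτ' := Ioo_subset_Icc_self hτ
  simp only [curl_apply, vmoll_apply, e]
  rw [pderiv_sub (hsm _ _) (hsm _ _), e2, e2]
  have hint := fun m l => integrable_mul_mul ((hu i).memLp τ hτ') ((hv j).memLp τ hτ')
    (((hk.dker m).dker i).smooth_conv (hi l))
  simp only [mul_sub]
  rw [integral_sub (hint _ _) (hint _ _)]

end

end HallMHD

/-! ### The energy equality. -/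

namespace HallMHD

variable {T ε : ℝ} {u h : ℝ → Torus3 → E3} {Du Dh : ℝ → Torus3 → Mat3}

/-! ### Limits of time integrals -/

lemma tendsto_integral_zero_of_enorm_le {f : ℝ → ℝ → ℝ} {B : ℝ → ℝ → ℝ≥0∞} {t : ℝ} (ht : t ≤ T)
    (hB : ∀ᶠ ε in 𝓝[>] (0 : ℝ), ∀ᵐ τ ∂(timeMeasure T), ‖f ε τ‖ₑ ≤ B ε τ)
    (h : Tendsto (fun ε => ∫⁻ τ in Ioo 0 T, B ε τ) (𝓝[>] 0) (𝓝 0)) :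
    Tendsto (fun ε => ∫ τ in Ioo 0 t, f ε τ) (𝓝[>] 0) (𝓝 0) := by
  rw [tendsto_zero_iff_enorm_tendsto_zero]
  refine tendsto_of_tendsto_of_tendsto_of_le_of_le' tendsto_const_nhds h
    (Eventually.of_forall fun _ => zero_le) ?_
  filter_upwards [hB] with ε hε
  exact (enorm_integral_le_lintegral_enorm _).trans
    ((lintegral_mono_set (Ioo_subset_Ioo_right ht)).trans (lintegral_mono_ae hε))

/-- Dissipation of the mollified gradient. -/
noncomputable def dissipation (ε : ℝ) (D : Torus3 → Mat3) : ℝ :=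
  ∑ j, ∑ i, ∫ x, conv (rho ε) (fun y => D y (i, j)) x ^ 2

lemma integral_norm_sq_matrix {D : Torus3 → Mat3} (hD : MemLp D 2 volume) :
    ∫ x, ‖D x‖ ^ 2 = ∑ j, ∑ i, ∫ x, D x (i, j) ^ 2 := by
  have h := fun j i => (memLp_apply_matrix hD (i, j)).integrable_sq
  rw [← integral_sum_sum h]
  refine integral_congr_ae (Eventually.of_forall fun x => ?_)
  simp only [EuclideanSpace.real_norm_sq_eq, Fintype.sum_prod_type]
  exact Finset.sum_comm

lemma integral_norm_sq_vector {F : Torus3 → E3} (hF : MemLp F 2 volume) :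
    ∫ x, ‖F x‖ ^ 2 = ∑ j, ∫ x, F x j * F x j := by
  rw [← integral_finsetSum _ fun j _ => integrable_mul_of_memLp (memLp_apply hF j) (memLp_apply hF j)]
  refine integral_congr_ae (Eventually.of_forall fun x => ?_)
  simp only [EuclideanSpace.real_norm_sq_eq, ← sq]

lemma dissipation_nonneg (ε : ℝ) (D : Torus3 → Mat3) : 0 ≤ dissipation ε D :=
  Finset.sum_nonneg fun _ _ => Finset.sum_nonneg fun _ _ => integral_nonneg fun _ => sq_nonneg _

lemma dissipation_le (hε : 0 < ε) {D : Torus3 → Mat3} (hD : MemLp D 2 volume) :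
    dissipation ε D ≤ ∫ x, ‖D x‖ ^ 2 := by
  rw [integral_norm_sq_matrix hD]
  exact Finset.sum_le_sum fun j _ => Finset.sum_le_sum fun i _ =>
    integral_sq_conv_rho_le hε (memLp_apply_matrix hD _)

lemma tendsto_dissipation {D : Torus3 → Mat3} (hD : MemLp D 2 volume) :
    Tendsto (fun ε => dissipation ε D) (𝓝[>] 0) (𝓝 (∫ x, ‖D x‖ ^ 2)) := by
  rw [integral_norm_sq_matrix hD]
  refine tendsto_finsetSum _ fun j _ => tendsto_finsetSum _ fun i _ => ?_
  simpa only [sq] using tendsto_integral_conv_rho_mul_conv_rho (memLp_apply_matrix hD (i, j))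
    (memLp_apply_matrix hD (i, j))

lemma InEnergyClass.aestronglyMeasurable_dissipation (hu : InEnergyClass T u Du) (hε : 0 < ε) :
    AEStronglyMeasurable (fun τ => dissipation ε (Du τ)) (timeMeasure T) := by
  have h : ∀ j i, AEStronglyMeasurable
      (fun τ => ∫ x, conv (rho ε) (fun y => Du τ y (i, j)) x ^ 2) (timeMeasure T) := fun j i => by
    have h1 := (hu.measurable_gradient.apply_matrix (i, j)).conv (isKernel_rho hε)
    simpa only [sq] using (h1.mul h1).integral
  have := Finset.aestronglyMeasurable_fun_sum Finset.univ fun j _ =>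
    Finset.aestronglyMeasurable_fun_sum Finset.univ fun i _ => h j i
  exact this

lemma InEnergyClass.integrableOn_gradient (hu : InEnergyClass T u Du) :
    IntegrableOn (fun τ => ∫ x, ‖Du τ x‖ ^ 2) (Ioo 0 T) := by
  have hm : MeasurableOnCylinder T fun τ x => ‖Du τ x‖ ^ 2 :=
    (AEStronglyMeasurable.norm hu.measurable_gradient).pow 2
  refine ⟨hm.integral, ?_⟩
  refine lt_of_le_of_lt ?_ hu.lintegral_gradient_lt_top
  refine lintegral_mono_ae ?_
  filter_upwards [hu.ae_memLp_gradient] with τ hτ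
  rw [hτ.eLpNorm_eq_integral_rpow_norm (by norm_num) (by norm_num)]
  have h0 : (0 : ℝ) ≤ ∫ x, ‖Du τ x‖ ^ 2 := integral_nonneg fun x => sq_nonneg _
  simp only [ENNReal.toReal_ofNat, Real.rpow_two]
  rw [Real.enorm_of_nonneg h0, ← ENNReal.ofReal_pow (by positivity), ← Real.rpow_natCast,
    ← Real.rpow_mul h0]
  norm_num

lemma InEnergyClass.integrableOn_dissipation (hu : InEnergyClass T u Du) (hε : 0 < ε) :
    IntegrableOn (fun τ => dissipation ε (Du τ)) (Ioo 0 T) := by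
  refine Integrable.mono' hu.integrableOn_gradient (hu.aestronglyMeasurable_dissipation hε) ?_
  filter_upwards [hu.ae_memLp_gradient] with τ hτ
  rw [Real.norm_of_nonneg (dissipation_nonneg _ _)]
  exact dissipation_le hε hτ

lemma InEnergyClass.tendsto_integral_dissipation (hu : InEnergyClass T u Du) {t : ℝ} (ht : t ≤ T) :
    Tendsto (fun ε => ∫ τ in Ioo 0 t, dissipation ε (Du τ)) (𝓝[>] 0)
      (𝓝 (∫ τ in Ioo 0 t, ∫ x, ‖Du τ x‖ ^ 2)) := by
  have hle : (volume.restrict (Ioo 0 t) : Measure ℝ) ≤ timeMeasure T :=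
    Measure.restrict_mono (Ioo_subset_Ioo_right ht) le_rfl
  refine tendsto_integral_filter_of_dominated_convergence (fun τ => ∫ x, ‖Du τ x‖ ^ 2) ?_ ?_
    (hu.integrableOn_gradient.mono_set (Ioo_subset_Ioo_right ht)) ?_
  · filter_upwards [self_mem_nhdsWithin] with ε hε
    exact (hu.aestronglyMeasurable_dissipation hε).mono_measure hle
  · filter_upwards [self_mem_nhdsWithin] with ε hε
    filter_upwards [ae_mono hle hu.ae_memLp_gradient] with τ hτ
    rw [Real.norm_of_nonneg (dissipation_nonneg _ _)]
    exact dissipation_le hε hτ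
  · filter_upwards [ae_mono hle hu.ae_memLp_gradient] with τ hτ using tendsto_dissipation hτ

lemma tendsto_integral_inner_vmoll {F : Torus3 → E3} (hF : MemLp F 2 volume) :
    Tendsto (fun ε => ∫ x, inner ℝ (F x) (vmoll ε F x)) (𝓝[>] 0) (𝓝 (∫ x, ‖F x‖ ^ 2)) := by
  rw [integral_norm_sq_vector hF]
  refine Tendsto.congr' ?_ (tendsto_finsetSum _ fun j _ =>
    tendsto_integral_conv_rho_mul_conv_rho (memLp_apply hF j) (memLp_apply hF j))
  filter_upwards [self_mem_nhdsWithin] with ε hε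
  exact (integral_inner_vmoll hε hF hF).symm

/-! ### The energy balance of the mollified equations -/

/-- The two-time integrand of the mollified energy balance. -/
noncomputable def energyIntegrand (ε : ℝ) (u h : ℝ → Torus3 → E3) (τ s : ℝ) : ℝ :=
  (transport (u τ) (u τ) (vmoll ε (u s)) - transport (h τ) (h τ) (vmoll ε (u s))
      + diffusion (u τ) (vmoll ε (u s)))
    + (transport (u τ) (h τ) (vmoll ε (h s)) - transport (h τ) (u τ) (vmoll ε (h s))
      + transport (h τ) (h τ) (curl (vmoll ε (h s))) + diffusion (h τ) (vmoll ε (h s)))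

lemma IsWeakSolution.twoTime_energyIntegrand (hT : 0 < T) (hs : IsWeakSolution T u h)
    (hu : InEnergyClass T u Du) (hh : InEnergyClass T h Dh) (hε : 0 < ε) :
    TwoTime T (energyIntegrand ε u h) := by
  have gu := hs.weakCont_u.goodField hT hu
  have gh := hs.weakCont_h.goodField hT hh
  exact (((twoTime_transport hε gu gu gu).sub (twoTime_transport hε gh gh gu)).add
    (twoTime_diffusion hε gu gu)).add ((((twoTime_transport hε gu gh gh).sub
    (twoTime_transport hε gh gu gh)).add (twoTime_transport_curl hε gh gh gh)).add
    (twoTime_diffusion hε gh gh))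

/-- With K symmetric, ⟨u(t) − u(r), K u(t)⟩ + ⟨u(t) − u(r), K u(r)⟩ is the difference of the
diagonal pairings at t and r. The left side is given by the equations tested with the frozen fields,
and `TwoTime.sub_eq_integral` passes to the diagonal. -/
lemma IsWeakSolution.mollified_energy (hT : 0 < T) (hs : IsWeakSolution T u h)
    (hu : InEnergyClass T u Du) (hh : InEnergyClass T h Dh) (hε : 0 < ε) {t : ℝ}
    (ht : t ∈ Icc 0 T) :
    ((∫ x, inner ℝ (u t x) (vmoll ε (u t) x)) + ∫ x, inner ℝ (h t x) (vmoll ε (h t) x))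
      - ((∫ x, inner ℝ (u 0 x) (vmoll ε (u 0) x)) + ∫ x, inner ℝ (h 0 x) (vmoll ε (h 0) x)) =
    ∫ τ in Ioo 0 t, 2 * energyIntegrand ε u h τ τ := by
  have hG := hs.twoTime_energyIntegrand hT hu hh hε
  refine hG.sub_eq_integral (E := fun t => (∫ x, inner ℝ (u t x) (vmoll ε (u t) x))
    + ∫ x, inner ℝ (h t x) (vmoll ε (h t) x)) (fun r t hr hrt ht => ?_) ht
  have ht' : t ∈ Icc 0 T := ⟨hr.trans hrt, ht⟩
  have hr' : r ∈ Icc 0 T := ⟨hr, hrt.trans ht⟩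
  have mu := hs.weakCont_u.memLp
  have mh := hs.weakCont_h.memLp
  have ii : ∀ s ∈ Icc 0 T, IntervalIntegrable (fun τ => energyIntegrand ε u h τ s) volume r t := by
    intro s hs'
    rw [intervalIntegrable_iff_integrableOn_Ioo_of_le hrt]
    exact (hG.integrableOn hs').mono_set (Ioo_subset_Ioo hr ht)
  -- The time s of the test field is independent of the interval [r, t]; it is used below with s = t
  -- and s = r.
  have key : ∀ s ∈ Icc 0 T, ((∫ x, inner ℝ (u t x) (vmoll ε (u s) x))
      - ∫ x, inner ℝ (u r x) (vmoll ε (u s) x)) + ((∫ x, inner ℝ (h t x) (vmoll ε (h s) x))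
      - ∫ x, inner ℝ (h r x) (vmoll ε (h s) x)) = ∫ τ in r..t, energyIntegrand ε u h τ s := by
    intro s hs'
    have su := smoothVector_vmoll hε (mu s hs')
    have sh := smoothVector_vmoll hε (mh s hs')
    have gu := hs.weakCont_u.goodField hT hu
    have gh := hs.weakCont_h.goodField hT hh
    rw [hs.momentum_sub hT hu hh su ((hs.divFree_u s hs').divg_vmoll (mu s hs') hε) ht' hr',
      hs.induction_sub hT hu hh sh ((hs.divFree_h s hs').divg_vmoll (mh s hs') hε) ht' hr',
      ← intervalIntegral.integral_add]
    · rfl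
    · rw [intervalIntegrable_iff_integrableOn_Ioo_of_le hrt]
      exact ((((twoTime_transport_const gu gu su).sub (twoTime_transport_const gh gh su)).add
        (twoTime_diffusion_const gu su)).integrableOn ht').mono_set (Ioo_subset_Ioo hr ht)
    · rw [intervalIntegrable_iff_integrableOn_Ioo_of_le hrt]
      exact (((((twoTime_transport_const gu gh sh).sub (twoTime_transport_const gh gu sh)).add
        (twoTime_transport_const gh gh sh.curl)).add
        (twoTime_diffusion_const gh sh)).integrableOn ht').mono_set (Ioo_subset_Ioo hr ht)
  rw [intervalIntegral.integral_add (ii t ht') (ii r hr'), ← key t ht', ← key r hr',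
    integral_inner_vmoll_comm hε (mu t ht') (mu r hr'),
    integral_inner_vmoll_comm hε (mh t ht') (mh r hr')]
  ring

/-- Once the commutators are split off, only smooth divergence-free fields remain. Self-transport
vanishes, the Lorentz term (h, h, u) of the momentum equation cancels the stretching term (h, u, h)
of the induction equation by antisymmetry, and the Hall term is zero. -/
lemma energyIntegrand_diag {u h : ℝ → Torus3 → E3} {τ : ℝ} (hε : 0 < ε)
    (mu : MemLp (u τ) 2 volume) (mh : MemLp (h τ) 2 volume) (du : WeakDivFree (u τ))
    (dh : WeakDivFree (h τ)) (mDu : MemLp (Du τ) 2 volume) (mDh : MemLp (Dh τ) 2 volume)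
    (gu : IsWeakGradient (u τ) (Du τ)) (gh : IsWeakGradient (h τ) (Dh τ)) :
    energyIntegrand ε u h τ τ + (dissipation ε (Du τ) + dissipation ε (Dh τ)) =
      commTransport ε (u τ) (u τ) (moll ε (u τ)) - commTransport ε (h τ) (h τ) (moll ε (u τ))
      + (commTransport ε (u τ) (h τ) (moll ε (h τ)) - commTransport ε (h τ) (u τ) (moll ε (h τ)))
      + commTransport ε (h τ) (h τ) (curl (moll ε (h τ))) := by
  have su := smoothVector_moll hε mu
  have sh := smoothVector_moll hε mh
  have du' := du.divg_moll mu hε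
  have dh' := dh.divg_moll mh hε
  rw [energyIntegrand, diffusion_vmoll hε mu mDu gu, diffusion_vmoll hε mh mDh gh, ← dissipation,
    ← dissipation]
  simp only [vmoll_eq]
  rw [curl_moll hε sh, transport_moll hε mu mu su, transport_moll hε mh mh su,
    transport_moll hε mu mh sh, transport_moll hε mh mu sh, transport_moll hε mh mh sh.curl,
    transport_self su du' su, transport_self su du' sh, transport_curl_self sh dh',
    transport_antisymm sh dh' sh su]
  ring

/-- Bookkeeping: `a` and `b` are the oscillations of u and h, and each occurs six times in the four
transport commutators. Those of h are charged to the larger weight `e₂`, so that u is only ever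
weighted by ε⁻¹. -/
lemma enorm_flux_le {f₁ f₂ f₃ f₄ f₅ : ℝ} {C₁ C₂ e₁ e₂ a b : ℝ≥0∞} (he : e₁ ≤ e₂)
    (h₁ : ‖f₁‖ₑ ≤ C₁ * (e₁ * (a + a + a))) (h₂ : ‖f₂‖ₑ ≤ C₁ * (e₁ * (b + b + a)))
    (h₃ : ‖f₃‖ₑ ≤ C₁ * (e₁ * (a + b + b))) (h₄ : ‖f₄‖ₑ ≤ C₁ * (e₁ * (b + a + b)))
    (h₅ : ‖f₅‖ₑ ≤ C₂ * (e₂ * (b + b + b))) :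
    ‖f₁ - f₂ + (f₃ - f₄) + f₅‖ₑ ≤ 6 * C₁ * (e₁ * a) + (6 * C₁ + 3 * C₂) * (e₂ * b) := by
  calc ‖f₁ - f₂ + (f₃ - f₄) + f₅‖ₑ ≤ ‖f₁‖ₑ + ‖f₂‖ₑ + (‖f₃‖ₑ + ‖f₄‖ₑ) + ‖f₅‖ₑ := by
        refine (enorm_add_le _ _).trans (add_le_add ((enorm_add_le _ _).trans ?_) le_rfl)
        exact add_le_add enorm_sub_le enorm_sub_le
    _ ≤ C₁ * (e₁ * (a + a + a)) + C₁ * (e₁ * (b + b + a)) + (C₁ * (e₁ * (a + b + b))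
        + C₁ * (e₁ * (b + a + b))) + C₂ * (e₂ * (b + b + b)) := by gcongr
    _ = 6 * C₁ * (e₁ * a) + (6 * C₁ * (e₁ * b) + 3 * C₂ * (e₂ * b)) := by ring
    _ ≤ 6 * C₁ * (e₁ * a) + (6 * C₁ * (e₂ * b) + 3 * C₂ * (e₂ * b)) := by gcongr
    _ = _ := by ring

lemma IsWeakSolution.tendsto_integral_energyIntegrand (hs : IsWeakSolution T u h)
    (hu : InEnergyClass T u Du) (hh : InEnergyClass T h Dh) (bu : InLpBesov T 3 (1 / 3) 3 u)
    (bh : InLpBesovVMO T 3 (2 / 3) 3 h) {t : ℝ} (ht : t ≤ T) :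
    Tendsto (fun ε => ∫ τ in Ioo 0 t, (energyIntegrand ε u h τ τ
      + (dissipation ε (Du τ) + dissipation ε (Dh τ)))) (𝓝[>] 0) (𝓝 0) := by
  obtain ⟨C₁, hC₁, h₁⟩ := exists_enorm_commTransport_le
  obtain ⟨C₂, hC₂, h₂⟩ := exists_enorm_commTransport_curl_le
  refine tendsto_integral_zero_of_enorm_le ht (B := fun ε τ =>
    6 * C₁ * (ENNReal.ofReal ε⁻¹ * oscInt ε (u τ))
      + (6 * C₁ + 3 * C₂) * (ENNReal.ofReal (ε⁻¹ ^ 2) * oscInt ε (h τ))) ?_ ?_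
  · have h1 : ∀ᶠ ε in 𝓝[>] (0 : ℝ), ε < 1 := nhdsWithin_le_nhds (gt_mem_nhds one_pos)
    filter_upwards [self_mem_nhdsWithin, h1] with ε hε hε1
    have hε' : 0 < ε := hε
    filter_upwards [hu.ae_memLp_gradient, hh.ae_memLp_gradient, hu.isWeakGradient,
      hh.isWeakGradient, ae_restrict_mem measurableSet_Ioo] with τ mDu mDh gu gh hτ
    have hτ' := Ioo_subset_Icc_self hτ
    have mu := hs.weakCont_u.memLp τ hτ'
    have mh := hs.weakCont_h.memLp τ hτ'
    rw [energyIntegrand_diag hε mu mh (hs.divFree_u τ hτ') (hs.divFree_h τ hτ') mDu mDh gu gh]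
    refine enorm_flux_le (ENNReal.ofReal_le_ofReal ?_) (h₁ ε hε _ _ _ mu mu mu)
      (h₁ ε hε _ _ _ mh mh mu) (h₁ ε hε _ _ _ mu mh mh) (h₁ ε hε _ _ _ mh mu mh)
      (h₂ ε hε _ _ _ mh mh mh)
    have : 1 ≤ ε⁻¹ := (one_le_inv₀ hε').2 hε1.le
    nlinarith
  · have l1 := ENNReal.Tendsto.const_mul (a := 6 * C₁) (hu.tendsto_lintegral_oscInt bu)
      (Or.inr (ENNReal.mul_ne_top (by norm_num) hC₁))
    have l2 := ENNReal.Tendsto.const_mul (a := 6 * C₁ + 3 * C₂) bh.tendsto_lintegral_oscInt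
      (Or.inr (ENNReal.add_ne_top.2 ⟨ENNReal.mul_ne_top (by norm_num) hC₁,
        ENNReal.mul_ne_top (by norm_num) hC₂⟩))
    have l := l1.add l2
    simp only [mul_zero, add_zero] at l
    refine l.congr fun ε => ?_
    have m1 := (hu.measurable.aemeasurable_oscInt (ε := ε)).const_mul (ENNReal.ofReal ε⁻¹)
    have m2 := hh.measurable.aemeasurable_oscInt (ε := ε)
    rw [lintegral_add_left' (m1.const_mul _), lintegral_const_mul'' _ m1,
      lintegral_const_mul'' _ (m2.const_mul _), lintegral_const_mul'' _ m2]

/-- The energy equality. -/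
theorem IsWeakSolution.energy_equality (hT : 0 < T) (hs : IsWeakSolution T u h)
    (hu : InEnergyClass T u Du) (hh : InEnergyClass T h Dh) (bu : InLpBesov T 3 (1 / 3) 3 u)
    (bh : InLpBesovVMO T 3 (2 / 3) 3 h) {t : ℝ} (ht : t ∈ Icc 0 T) :
    ((1 / 2) * ∫ x, (‖u t x‖ ^ 2 + ‖h t x‖ ^ 2))
      + (∫ s in Ioo 0 t, ∫ x, (‖Du s x‖ ^ 2 + ‖Dh s x‖ ^ 2))
      = (1 / 2) * ∫ x, (‖u 0 x‖ ^ 2 + ‖h 0 x‖ ^ 2) := by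
  have mu := hs.weakCont_u.memLp
  have mh := hs.weakCont_h.memLp
  have h0 : (0 : ℝ) ∈ Icc 0 T := ⟨le_rfl, hT.le⟩
  have hle : (volume.restrict (Ioo 0 t) : Measure ℝ) ≤ timeMeasure T :=
    Measure.restrict_mono (Ioo_subset_Ioo_right ht.2) le_rfl
  have hgrad : ∫ s in Ioo 0 t, ∫ x, (‖Du s x‖ ^ 2 + ‖Dh s x‖ ^ 2) =
      (∫ s in Ioo 0 t, ∫ x, ‖Du s x‖ ^ 2) + ∫ s in Ioo 0 t, ∫ x, ‖Dh s x‖ ^ 2 := by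
    rw [← integral_add (hu.integrableOn_gradient.mono_set (Ioo_subset_Ioo_right ht.2))
      (hh.integrableOn_gradient.mono_set (Ioo_subset_Ioo_right ht.2))]
    refine integral_congr_ae ?_
    filter_upwards [ae_mono hle hu.ae_memLp_gradient, ae_mono hle hh.ae_memLp_gradient] with s h1 h2
    exact integral_add h1.norm.integrable_sq h2.norm.integrable_sq
  have hsum : ∀ s ∈ Icc 0 T, ∫ x, (‖u s x‖ ^ 2 + ‖h s x‖ ^ 2) =
      (∫ x, ‖u s x‖ ^ 2) + ∫ x, ‖h s x‖ ^ 2 := fun s hs' =>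
    integral_add (mu s hs').norm.integrable_sq (mh s hs').norm.integrable_sq
  rw [hgrad, hsum t ht, hsum 0 h0]
  have l1 := ((tendsto_integral_inner_vmoll (mu t ht)).add (tendsto_integral_inner_vmoll (mh t ht))).sub
    ((tendsto_integral_inner_vmoll (mu 0 h0)).add (tendsto_integral_inner_vmoll (mh 0 h0)))
  have l2 := ((hs.tendsto_integral_energyIntegrand hu hh bu bh ht.2).sub
    ((hu.tendsto_integral_dissipation ht.2).add (hh.tendsto_integral_dissipation ht.2))).const_mul 2
  have e := tendsto_nhds_unique l1 (l2.congr' ?_)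
  · linarith
  filter_upwards [self_mem_nhdsWithin] with ε hε
  have iG := ((hs.twoTime_energyIntegrand hT hu hh hε).integrableOn_diag).mono_set (Ioo_subset_Ioo_right ht.2)
  have iu := (hu.integrableOn_dissipation hε).mono_set (Ioo_subset_Ioo_right ht.2)
  have ih := (hh.integrableOn_dissipation hε).mono_set (Ioo_subset_Ioo_right ht.2)
  rw [hs.mollified_energy hT hu hh hε ht, integral_const_mul, ← integral_add iu ih]
  have iuh : Integrable (fun τ => dissipation ε (Du τ) + dissipation ε (Dh τ))
    (volume.restrict (Ioo 0 t)) := iu.add ih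
  rw [integral_add iG iuh, add_sub_cancel_right]

end HallMHD

/-! ### The helicity balance at fixed scale and the bounds for its limit. -/

namespace HallMHD

variable {T ε : ℝ} {u h H : ℝ → Torus3 → E3} {Du Dh : ℝ → Torus3 → Mat3}

/-! ### The magnetic helicity balance of the mollified equations -/

/-- The integral of `(a × b) · φ`. -/
noncomputable def lorentz (a b φ : Torus3 → E3) : ℝ :=
  ∑ l, ((∫ x, a x (l + 1) * b x (l + 2) * φ x l) - ∫ x, a x (l + 2) * b x (l + 1) * φ x l)

/-- The integral of `a · curl φ`. -/
noncomputable def curlPair (a φ : Torus3 → E3) : ℝ :=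
  ∑ j, ((∫ x, a x j * 1 * pderiv (j + 1) (fun y => φ y (j + 2)) x)
    - ∫ x, a x j * 1 * pderiv (j + 2) (fun y => φ y (j + 1)) x)

/-- Antisymmetrising in the indices pairs a × b with the curl of ψ. With ψ = K H this leaves K h and
no derivative. -/
lemma transport_sub_transport {a b ψ : Torus3 → E3} (ha : MemLp a 2 volume) (hb : MemLp b 2 volume)
    (hψ : SmoothVector ψ) :
    transport a b ψ - transport b a ψ = lorentz a b (curl ψ) := by
  have e : ∀ i l k m, ∫ x, a x i * b x l * (pderiv k (fun y => ψ y m) x - pderiv m (fun y => ψ y k) x) =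
      (∫ x, a x i * b x l * pderiv k (fun y => ψ y m) x)
        - ∫ x, a x i * b x l * pderiv m (fun y => ψ y k) x := by
    intro i l k m
    simp only [mul_sub]
    exact integral_sub
      (integrable_mul_mul (memLp_apply ha i) (memLp_apply hb l) ((hψ.apply m).pderiv k))
      (integrable_mul_mul (memLp_apply ha i) (memLp_apply hb l) ((hψ.apply k).pderiv m))
  simp only [lorentz, transport, curl_apply, e, Fin.sum_univ_three, Fin.isValue, zero_add,
    show (1 : Fin 3) + 1 = 2 from rfl, show (1 : Fin 3) + 2 = 0 from rfl,
    show (2 : Fin 3) + 1 = 0 from rfl, show (2 : Fin 3) + 2 = 1 from rfl]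
  simp only [mul_comm (b _ _) (a _ _)]
  ring

/-- The identity Δψ = ∇ div ψ − curl curl ψ in components; `z` records that the gradient of the
divergence drops out. -/
lemma diffusion_eq_neg_curlPair {a ψ : Torus3 → E3} (ha : MemLp a 2 volume) (hψ : SmoothVector ψ)
    (hd : ∀ x, divg ψ x = 0) : diffusion a ψ = - curlPair a (curl ψ) := by
  have hi : ∀ j k l m, Integrable fun x =>
      a x j * 1 * pderiv k (pderiv l fun y => ψ y m) x := fun j k l m =>
    integrable_mul_mul (memLp_apply ha j) (memLp_const (1 : ℝ)) (((hψ.apply m).pderiv l).pderiv k)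
  have e : ∀ j k l m n p, ∫ x, a x j * 1 * pderiv k (fun y => pderiv l (fun z => ψ z m) y
      - pderiv n (fun z => ψ z p) y) x =
      (∫ x, a x j * 1 * pderiv k (pderiv l fun z => ψ z m) x)
        - ∫ x, a x j * 1 * pderiv k (pderiv n fun z => ψ z p) x := by
    intro j k l m n p
    rw [← integral_sub (hi _ _ _ _) (hi _ _ _ _),
      pderiv_sub ((hψ.apply _).pderiv _) ((hψ.apply _).pderiv _)]
    simp only [mul_sub]
  have c : ∀ k l m, pderiv k (pderiv l fun z => ψ z m) = pderiv l (pderiv k fun z => ψ z m) :=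
    fun k l m => pderiv_comm (hψ.apply m) k l
  have z : ∀ j, (∫ x, a x j * 1 * pderiv j (pderiv 0 fun z => ψ z 0) x)
      + (∫ x, a x j * 1 * pderiv j (pderiv 1 fun z => ψ z 1) x)
      + (∫ x, a x j * 1 * pderiv j (pderiv 2 fun z => ψ z 2) x) = 0 := by
    intro j
    have hz : pderiv j (fun x => divg ψ x) = fun _ => 0 := by
      simp only [hd, pderiv_const]
    have hz' := hz
    simp only [divg] at hz'
    rw [pderiv_sum fun i _ => (hψ.apply i).pderiv i] at hz'
    simp only [Fin.sum_univ_three] at hz'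
    have i12 : Integrable fun x => a x j * 1 * pderiv j (pderiv 0 fun z => ψ z 0) x
        + a x j * 1 * pderiv j (pderiv 1 fun z => ψ z 1) x := (hi _ _ _ _).add (hi _ _ _ _)
    rw [← integral_add (hi _ _ _ _) (hi _ _ _ _), ← integral_add i12 (hi _ _ _ _)]
    have : ∀ x, a x j * 1 * pderiv j (pderiv 0 fun z => ψ z 0) x
        + a x j * 1 * pderiv j (pderiv 1 fun z => ψ z 1) x
        + a x j * 1 * pderiv j (pderiv 2 fun z => ψ z 2) x = 0 := fun x => by
      rw [← mul_add, ← mul_add, congrFun hz' x, mul_zero]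
    simp only [this, integral_zero]
  have z0 := z 0
  have z1 := z 1
  have z2 := z 2
  simp only [curlPair, diffusion, curl_apply, e, Fin.sum_univ_three, Fin.isValue, zero_add,
    show (1 : Fin 3) + 1 = 2 from rfl, show (1 : Fin 3) + 2 = 0 from rfl,
    show (2 : Fin 3) + 1 = 0 from rfl, show (2 : Fin 3) + 2 = 1 from rfl]
  rw [c 1 0 1, c 2 0 2, c 2 1 2, c 0 1 0, c 0 2 0, c 1 2 1]
  linarith

/-- The two-time integrand of the mollified helicity balance. -/
noncomputable def helicityIntegrand (ε : ℝ) (u h : ℝ → Torus3 → E3) (τ s : ℝ) : ℝ :=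
  lorentz (u τ) (h τ) (vmoll ε (h s)) + transport (h τ) (h τ) (vmoll ε (h s))
    - curlPair (h τ) (vmoll ε (h s))

lemma twoTime_lorentz (hε : 0 < ε) (hu : ∀ j, GoodField T fun t x => u t x j)
    (hh : ∀ j, GoodField T fun t x => h t x j) :
    TwoTime T fun τ s => lorentz (u τ) (h τ) (vmoll ε (h s)) :=
  .sum fun l => ((hu (l + 1)).twoTime_conv (hh (l + 2)) (hh l) (isKernel_rho hε)
    (isKernel_rho hε)).sub ((hu (l + 2)).twoTime_conv (hh (l + 1)) (hh l) (isKernel_rho hε)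
    (isKernel_rho hε))

lemma twoTime_curlPair (hε : 0 < ε) (hh : ∀ j, GoodField T fun t x => h t x j) :
    TwoTime T fun τ s => curlPair (h τ) (vmoll ε (h s)) := by
  have hk := isKernel_rho hε
  refine .sum fun j => (((hh j).twoTime_conv (goodField_const T 1) (hh (j + 2)) (hk.dker (j + 1))
    hk).sub ((hh j).twoTime_conv (goodField_const T 1) (hh (j + 1)) (hk.dker (j + 2)) hk)).congr
    fun τ _ s hs => ?_
  have hi := fun l => (hk.smooth_conv (MemLp.integrable_two ((hh l).memLp s hs))).integrable
  simp only [vmoll_apply]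
  rw [hk.pderiv_conv (hi _), hk.pderiv_conv (hi _)]

lemma IsWeakSolution.twoTime_helicityIntegrand (hT : 0 < T) (hs : IsWeakSolution T u h)
    (hu : InEnergyClass T u Du) (hh : InEnergyClass T h Dh) (hε : 0 < ε) :
    TwoTime T (helicityIntegrand ε u h) := by
  have gu := hs.weakCont_u.goodField hT hu
  have gh := hs.weakCont_h.goodField hT hh
  exact ((twoTime_lorentz hε gu gh).add (twoTime_transport hε gh gh gh)).sub
    (twoTime_curlPair hε gh)

/-- The curl is symmetric: ⟨h₁, K H₂⟩ = ⟨H₁, curl K H₂⟩ = ⟨H₁, K h₂⟩ = ⟨h₂, K H₁⟩. This replaces the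
symmetry of K in the two-time argument. -/
lemma IsCurlInverse.integral_inner_vmoll_comm {h₁ h₂ H₁ H₂ : Torus3 → E3}
    (hH₁ : IsCurlInverse h₁ H₁) (hH₂ : IsCurlInverse h₂ H₂) (m₂ : MemLp h₂ 2 volume) (hε : 0 < ε) :
    ∫ x, inner ℝ (h₁ x) (vmoll ε H₂ x) = ∫ x, inner ℝ (h₂ x) (vmoll ε H₁ x) := by
  rw [← hH₁.curl_eq _ (smoothVector_vmoll hε hH₂.memLp), hH₂.curl_vmoll m₂ hε,
    HallMHD.integral_inner_vmoll_comm hε hH₁.memLp m₂]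

/-- The same two-time argument with test field K H(s). All terms of the induction equation can be
written through curl K H(s) = K h(s), so measurability and continuity in time are only required of
h. -/
lemma IsWeakSolution.mollified_helicity (hT : 0 < T) (hs : IsWeakSolution T u h)
    (hu : InEnergyClass T u Du) (hh : InEnergyClass T h Dh)
    (hH : ∀ t ∈ Icc 0 T, IsCurlInverse (h t) (H t)) (hε : 0 < ε) {t : ℝ} (ht : t ∈ Icc 0 T) :
    (∫ x, inner ℝ (h t x) (vmoll ε (H t) x)) - ∫ x, inner ℝ (h 0 x) (vmoll ε (H 0) x) =
    ∫ τ in Ioo 0 t, 2 * helicityIntegrand ε u h τ τ := by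
  have hG := hs.twoTime_helicityIntegrand hT hu hh hε
  refine hG.sub_eq_integral (E := fun t => ∫ x, inner ℝ (h t x) (vmoll ε (H t) x))
    (fun r t hr hrt ht => ?_) ht
  have ht' : t ∈ Icc 0 T := ⟨hr.trans hrt, ht⟩
  have hr' : r ∈ Icc 0 T := ⟨hr, hrt.trans ht⟩
  have mu := hs.weakCont_u.memLp
  have mh := hs.weakCont_h.memLp
  have ii : ∀ s ∈ Icc 0 T, IntervalIntegrable (fun τ => helicityIntegrand ε u h τ s) volume r t := by
    intro s hs'
    rw [intervalIntegrable_iff_integrableOn_Ioo_of_le hrt]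
    exact (hG.integrableOn hs').mono_set (Ioo_subset_Ioo hr ht)
  have key : ∀ s ∈ Icc 0 T, (∫ x, inner ℝ (h t x) (vmoll ε (H s) x))
      - ∫ x, inner ℝ (h r x) (vmoll ε (H s) x) = ∫ τ in r..t, helicityIntegrand ε u h τ s := by
    intro s hs'
    have sH := smoothVector_vmoll hε (hH s hs').memLp
    have dH := (hH s hs').divFree.divg_vmoll (hH s hs').memLp hε
    rw [hs.induction_sub hT hu hh sH dH ht' hr']
    refine intervalIntegral.integral_congr fun τ hτ => ?_
    rw [uIcc_of_le hrt] at hτ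
    have hτ' : τ ∈ Icc 0 T := Icc_subset_Icc hr ht hτ
    simp only [helicityIntegrand]
    rw [transport_sub_transport (mu τ hτ') (mh τ hτ') sH, diffusion_eq_neg_curlPair (mh τ hτ') sH dH,
      (hH s hs').curl_vmoll (mh s hs') hε]
    ring
  rw [intervalIntegral.integral_add (ii t ht') (ii r hr'), ← key t ht', ← key r hr',
    (hH r hr').integral_inner_vmoll_comm (hH t ht') (mh t ht') hε]
  ring

/-! ### Passage to the limit -/

/-- H¹ embeds in L⁶, which embeds in L⁴ on a probability space. The bound is quadratic in the H¹
norm so that it is integrable in time; the factor 4 is Cauchy–Schwarz for a sum of four norms. -/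
lemma exists_sqrt_integral_pow_four_le :
    ∃ C : ℝ, 0 ≤ C ∧ ∀ (f : Torus3 → ℝ) (D : Fin 3 → Torus3 → ℝ), MemLp f 2 volume →
      (∀ i, MemLp (D i) 2 volume) → (∀ i, HasWeakPartial i f (D i)) →
      MemLp (fun x => f x ^ 2) 2 volume ∧
        √(∫ x, f x ^ 4) ≤ C * ((∫ x, f x ^ 2) + ∑ i, ∫ x, D i x ^ 2) := by
  obtain ⟨C, hC, h⟩ := exists_eLpNorm_six_le
  refine ⟨4 * C.toReal ^ 2, by positivity, fun f D hf hD hfD => ?_⟩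
  have h6 := h f D hf hD hfD
  have hfin : eLpNorm f 2 volume + ∑ i, eLpNorm (D i) 2 volume ≠ ⊤ :=
    ENNReal.add_ne_top.2 ⟨hf.eLpNorm_ne_top, ENNReal.sum_ne_top.2 fun i _ => (hD i).eLpNorm_ne_top⟩
  have h4 : eLpNorm f 4 volume ≤ C * (eLpNorm f 2 volume + ∑ i, eLpNorm (D i) 2 volume) :=
    (eLpNorm_le_eLpNorm_of_exponent_le (by norm_num) hf.aestronglyMeasurable).trans h6
  have m4 : MemLp f 4 volume :=
    ⟨hf.aestronglyMeasurable, h4.trans_lt (ENNReal.mul_ne_top hC hfin).lt_top⟩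
  have e2 : ∀ g : Torus3 → ℝ, MemLp g 2 volume →
      (eLpNorm g 2 volume).toReal = √(∫ x, g x ^ 2) := by
    intro g hg
    rw [hg.eLpNorm_eq_integral_rpow_norm (by norm_num) (by norm_num), ENNReal.toReal_ofReal
      (by positivity), Real.sqrt_eq_rpow]
    simp
  have e4 : (eLpNorm f 4 volume).toReal ^ 2 = √(∫ x, f x ^ 4) := by
    have h0 : 0 ≤ ∫ x, f x ^ 4 := integral_nonneg fun x => by positivity
    rw [m4.eLpNorm_eq_integral_rpow_norm (by norm_num) (by norm_num), ENNReal.toReal_ofReal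
      (by positivity), Real.sqrt_eq_rpow]
    have : ∀ x, ‖f x‖ ^ (ENNReal.toReal 4) = f x ^ 4 := fun x => by
      rw [ENNReal.toReal_ofNat, ← Real.rpow_natCast (f x) 4, Real.norm_eq_abs]
      norm_num
      exact Even.pow_abs ⟨2, rfl⟩ _
    simp only [this]
    rw [← Real.rpow_natCast, ← Real.rpow_mul h0]
    norm_num
  constructor
  · refine (memLp_two_iff_integrable_sq (hf.aestronglyMeasurable.pow 2)).2 ?_
    have := m4.integrable_norm_pow (p := 4) (by norm_num)
    refine this.congr (Eventually.of_forall fun x => ?_)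
    simp only [Real.norm_eq_abs, Pi.pow_apply]
    rw [← pow_mul, Even.pow_abs ⟨2, rfl⟩]
  · rw [← e4]
    have h5 := ENNReal.toReal_mono (ENNReal.mul_ne_top hC hfin) h4
    rw [ENNReal.toReal_mul, ENNReal.toReal_add hf.eLpNorm_ne_top
      (ENNReal.sum_ne_top.2 fun i _ => (hD i).eLpNorm_ne_top),
      ENNReal.toReal_sum fun i _ => (hD i).eLpNorm_ne_top, e2 f hf] at h5
    simp only [e2 _ (hD _), Fin.sum_univ_three] at h5
    have n0 : 0 ≤ ∫ x, f x ^ 2 := integral_nonneg fun x => sq_nonneg _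
    have n1 : ∀ i, 0 ≤ ∫ x, D i x ^ 2 := fun i => integral_nonneg fun x => sq_nonneg _
    have q0 := Real.sq_sqrt n0
    have q1 := fun i => Real.sq_sqrt (n1 i)
    refine (pow_le_pow_left₀ ENNReal.toReal_nonneg h5 2).trans ?_
    rw [mul_pow, mul_comm 4, mul_assoc]
    refine mul_le_mul_of_nonneg_left ?_ (sq_nonneg _)
    rw [Fin.sum_univ_three]
    have q10 := q1 0
    have q11 := q1 1
    have q12 := q1 2
    generalize √(∫ x, f x ^ 2) = s at *
    generalize √(∫ x, D 0 x ^ 2) = s0 at *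
    generalize √(∫ x, D 1 x ^ 2) = s1 at *
    generalize √(∫ x, D 2 x ^ 2) = s2 at *
    rw [← q0, ← q10, ← q11, ← q12]
    nlinarith [sq_nonneg (s - s0), sq_nonneg (s - s1), sq_nonneg (s - s2), sq_nonneg (s0 - s1),
      sq_nonneg (s0 - s2), sq_nonneg (s1 - s2)]

lemma memLp_mul_of_sq {f g : Torus3 → ℝ} (hf : AEStronglyMeasurable f volume)
    (hg : AEStronglyMeasurable g volume) (hf4 : MemLp (fun x => f x ^ 2) 2 volume)
    (hg4 : MemLp (fun x => g x ^ 2) 2 volume) : MemLp (fun x => f x * g x) 2 volume := by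
  refine MemLp.of_le (hf4.add hg4) (hf.mul hg) (Eventually.of_forall fun x => ?_)
  simp only [Pi.add_apply, Real.norm_eq_abs]
  rw [abs_mul, abs_of_nonneg (show 0 ≤ f x ^ 2 + g x ^ 2 by positivity), ← sq_abs (f x),
    ← sq_abs (g x)]
  nlinarith [sq_nonneg (|f x| - |g x|), sq_nonneg (|f x| + |g x|)]

/-- A bound on `∫ a b (K c)` that is uniform in the mollification parameter. -/
lemma abs_integral_mul_mul_conv_le (hε : 0 < ε) {a b c : Torus3 → ℝ} (ha : MemLp a 2 volume)
    (hb : MemLp b 2 volume) (hc : MemLp c 2 volume) (hb4 : MemLp (fun x => b x ^ 2) 2 volume)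
    (hc4 : MemLp (fun x => c x ^ 2) 2 volume) :
    |∫ x, a x * b x * conv (rho ε) (conv (rho ε) c) x| ≤
      √(∫ x, a x ^ 2) * (√(∫ x, b x ^ 4) + √(∫ x, c x ^ 4)) := by
  have hk := isKernel_rho hε
  have s1 := hk.smooth_conv (MemLp.integrable_two hc)
  have s2 := hk.smooth_conv s1.integrable
  have hbK : MemLp (fun x => b x * conv (rho ε) (conv (rho ε) c) x) 2 volume :=
    memLp_mul_of_sq hb.aestronglyMeasurable s2.continuous.aestronglyMeasurable hb4
      (by simpa only [sq] using (s2.mul s2).memLp 2)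
  simp only [mul_assoc]
  refine (abs_integral_mul_le ha hbK).trans (mul_le_mul_of_nonneg_left ?_ (Real.sqrt_nonneg _))
  have hK4 : ∫ x, conv (rho ε) (conv (rho ε) c) x ^ 4 ≤ ∫ x, c x ^ 4 :=
    (integral_pow_four_conv_rho_le hε (s1.memLp 2)
      (by simpa only [sq] using (s1.mul s1).memLp 2)).trans
      (integral_pow_four_conv_rho_le hε hc hc4)
  have h1 : ∫ x, (b x * conv (rho ε) (conv (rho ε) c) x) ^ 2 ≤
      √(∫ x, b x ^ 4) * √(∫ x, c x ^ 4) := by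
    simp only [mul_pow]
    refine (le_abs_self _).trans ((abs_integral_mul_le hb4
      (by simpa only [sq] using (s2.mul s2).memLp 2)).trans ?_)
    simp only [← pow_mul]
    norm_num only
    exact mul_le_mul_of_nonneg_left (Real.sqrt_le_sqrt hK4) (Real.sqrt_nonneg _)
  refine Real.sqrt_le_iff.2 ⟨by positivity, h1.trans ?_⟩
  nlinarith [Real.sqrt_nonneg (∫ x, b x ^ 4), Real.sqrt_nonneg (∫ x, c x ^ 4)]

lemma tendsto_integral_mul_conv_conv {f g : Torus3 → ℝ} (hf : MemLp f 2 volume)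
    (hg : MemLp g 2 volume) :
    Tendsto (fun ε => ∫ x, f x * conv (rho ε) (conv (rho ε) g) x) (𝓝[>] 0)
      (𝓝 (∫ x, f x * g x)) := by
  refine (tendsto_integral_conv_rho_mul_conv_rho hf hg).congr' ?_
  filter_upwards [self_mem_nhdsWithin] with ε hε
  exact ((isKernel_rho hε).smooth_conv (MemLp.integrable_two hg)).conv_rho_comm hε
    (MemLp.integrable_two hf)

/-- With the products in L² the mollifier can be removed in the limit, and (a × b)·b vanishes
pointwise. -/
lemma tendsto_lorentz {a b : Torus3 → E3} (hb : MemLp b 2 volume)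
    (hab : ∀ i j, MemLp (fun x => a x i * b x j) 2 volume) :
    Tendsto (fun ε => lorentz a b (vmoll ε b)) (𝓝[>] 0) (𝓝 0) := by
  have h : Tendsto (fun ε => lorentz a b (vmoll ε b)) (𝓝[>] 0) (𝓝 (lorentz a b b)) :=
    tendsto_finsetSum _ fun l _ =>
      (tendsto_integral_mul_conv_conv (hab (l + 1) (l + 2)) (memLp_apply hb l)).sub
        (tendsto_integral_mul_conv_conv (hab (l + 2) (l + 1)) (memLp_apply hb l))
  have e : lorentz a b b = 0 := by
    simp only [lorentz, Fin.sum_univ_three, Fin.isValue, zero_add,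
      show (1 : Fin 3) + 1 = 2 from rfl, show (1 : Fin 3) + 2 = 0 from rfl,
      show (2 : Fin 3) + 1 = 0 from rfl, show (2 : Fin 3) + 2 = 1 from rfl]
    simp only [mul_assoc, mul_comm (b _ 1) (b _ 0), mul_comm (b _ 2) (b _ 0),
      mul_comm (b _ 2) (b _ 1)]
    ring
  rwa [e] at h

end HallMHD

/-! ### Limits of the individual terms of the helicity balance. -/

namespace HallMHD

variable {T ε : ℝ} {u h H : ℝ → Torus3 → E3} {Du Dh : ℝ → Torus3 → Mat3}

lemma integral_apply_sq_le {F : Torus3 → E3} (hF : MemLp F 2 volume) (j : Fin 3) :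
    ∫ x, F x j ^ 2 ≤ ∫ x, ‖F x‖ ^ 2 := by
  refine integral_mono (memLp_apply hF j).integrable_sq hF.norm.integrable_sq fun x => ?_
  simp only [← sq_abs (F x j)]
  exact pow_le_pow_left₀ (abs_nonneg _) (PiLp.norm_apply_le (F x) j) 2

lemma integral_apply_matrix_sq_le {D : Torus3 → Mat3} (hD : MemLp D 2 volume)
    (q : Fin 3 × Fin 3) : ∫ x, D x q ^ 2 ≤ ∫ x, ‖D x‖ ^ 2 := by
  refine integral_mono (memLp_apply_matrix hD q).integrable_sq hD.norm.integrable_sq fun x => ?_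
  simp only [← sq_abs (D x q)]
  exact pow_le_pow_left₀ (abs_nonneg _) (PiLp.norm_apply_le (D x) q) 2

lemma curlPair_vmoll (hε : 0 < ε) {a : Torus3 → E3} (ha : MemLp a 2 volume) {D : Torus3 → Mat3}
    (hD : MemLp D 2 volume) (h : IsWeakGradient a D) :
    curlPair a (vmoll ε a) =
      ∑ j, ((∫ x, conv (rho ε) (fun y => a y j) x * conv (rho ε) (fun y => D y (j + 1, j + 2)) x)
        - ∫ x, conv (rho ε) (fun y => a y j) x
          * conv (rho ε) (fun y => D y (j + 2, j + 1)) x) := by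
  have hk := isKernel_rho hε
  have hs := smoothScalar_conv_rho hε ha
  have ha' := fun j => MemLp.integrable_two (memLp_apply ha j)
  have hD' := fun q => MemLp.integrable_two (memLp_apply_matrix hD q)
  have e : ∀ j i l, ∫ x, a x j * 1 * pderiv i (fun y => vmoll ε a y l) x =
      ∫ x, conv (rho ε) (fun y => a y j) x * conv (rho ε) (fun y => D y (i, l)) x := by
    intro j i l
    simp only [mul_one]
    rw [vmoll_apply, hk.conv_pderiv (hs l), (h.hasWeakPartial i l).pderiv_conv hε (ha' l) (hD' _),
      ← (hk.smooth_conv (hD' _)).conv_rho_comm hε (ha' j)]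
  simp only [curlPair, e]

lemma curlOfGradient_apply (G : Mat3) (j : Fin 3) :
    curlOfGradient G j = G (j + 1, j + 2) - G (j + 2, j + 1) := by
  fin_cases j <;> rfl

lemma integral_inner_curlOfGradient {a : Torus3 → E3} (ha : MemLp a 2 volume) {D : Torus3 → Mat3}
    (hD : MemLp D 2 volume) :
    ∫ x, inner ℝ (curlOfGradient (D x)) (a x) =
      ∑ j, ((∫ x, a x j * D x (j + 1, j + 2)) - ∫ x, a x j * D x (j + 2, j + 1)) := by
  have i := fun j q => integrable_mul_of_memLp (memLp_apply ha j) (memLp_apply_matrix hD q)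
  have e : ∀ j, (∫ x, a x j * D x (j + 1, j + 2)) - ∫ x, a x j * D x (j + 2, j + 1) =
      ∫ x, (a x j * D x (j + 1, j + 2) - a x j * D x (j + 2, j + 1)) := fun j =>
    (integral_sub (i _ _) (i _ _)).symm
  have i' : ∀ j, Integrable fun x => a x j * D x (j + 1, j + 2) - a x j * D x (j + 2, j + 1) :=
    fun j => (i _ _).sub (i _ _)
  simp only [e]
  rw [← integral_finsetSum _ fun j _ => i' j]
  refine integral_congr_ae (Eventually.of_forall fun x => ?_)
  simp only [inner_eq_sum, curlOfGradient_apply]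
  exact Finset.sum_congr rfl fun j _ => by ring

lemma tendsto_curlPair {a : Torus3 → E3} (ha : MemLp a 2 volume) {D : Torus3 → Mat3}
    (hD : MemLp D 2 volume) (h : IsWeakGradient a D) :
    Tendsto (fun ε => curlPair a (vmoll ε a)) (𝓝[>] 0)
      (𝓝 (∫ x, inner ℝ (curlOfGradient (D x)) (a x))) := by
  rw [integral_inner_curlOfGradient ha hD]
  have l : ∀ j q, _ := fun j q =>
    tendsto_integral_conv_rho_mul_conv_rho (memLp_apply ha j) (memLp_apply_matrix hD q)
  refine (tendsto_finsetSum Finset.univ fun j _ =>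
    (l j (j + 1, j + 2)).sub (l j (j + 2, j + 1))).congr' ?_
  filter_upwards [self_mem_nhdsWithin] with ε hε
  exact (curlPair_vmoll hε ha hD h).symm

lemma sqrt_mul_sqrt_le_add {a b A B : ℝ} (hA : 0 ≤ A) (hB : 0 ≤ B) (ha : a ≤ A) (hb : b ≤ B) :
    √a * √b ≤ A + B := by
  have h1 := Real.sqrt_le_sqrt ha
  have h2 := Real.sqrt_le_sqrt hb
  have h3 : √a * √b ≤ √A * √B := by gcongr
  nlinarith [Real.sq_sqrt hA, Real.sq_sqrt hB, sq_nonneg (√A - √B), Real.sqrt_nonneg A,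
    Real.sqrt_nonneg B]

lemma abs_sum_three_sub_le {f g : Fin 3 → ℝ} {B : ℝ} (hf : ∀ j, |f j| ≤ B) (hg : ∀ j, |g j| ≤ B) :
    |∑ j, (f j - g j)| ≤ 6 * B := by
  refine (Finset.abs_sum_le_sum_abs _ _).trans ?_
  have h : ∀ j ∈ Finset.univ, |f j - g j| ≤ 2 * B := fun j _ =>
    (abs_sub _ _).trans (by linarith [hf j, hg j])
  refine (Finset.sum_le_card_nsmul _ _ _ h).trans_eq ?_
  simp
  ring

/-- An ε-independent majorant for dominated convergence in time; the 6 counts two derivatives for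
each of three components. -/
lemma abs_curlPair_le (hε : 0 < ε) {a : Torus3 → E3} (ha : MemLp a 2 volume) {D : Torus3 → Mat3}
    (hD : MemLp D 2 volume) (h : IsWeakGradient a D) :
    |curlPair a (vmoll ε a)| ≤ 6 * ((∫ x, ‖a x‖ ^ 2) + ∫ x, ‖D x‖ ^ 2) := by
  have hk := isKernel_rho hε
  have b : ∀ j q, |∫ x, conv (rho ε) (fun y => a y j) x * conv (rho ε) (fun y => D y q) x| ≤
      (∫ x, ‖a x‖ ^ 2) + ∫ x, ‖D x‖ ^ 2 := by
    intro j q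
    have m1 := memLp_apply ha j
    have m2 := memLp_apply_matrix hD q
    refine (abs_integral_mul_le ((hk.smooth_conv (MemLp.integrable_two m1)).memLp 2)
      ((hk.smooth_conv (MemLp.integrable_two m2)).memLp 2)).trans (sqrt_mul_sqrt_le_add
      (integral_nonneg fun x => by positivity) (integral_nonneg fun x => by positivity) ?_ ?_)
    · exact (integral_sq_conv_rho_le hε m1).trans (integral_apply_sq_le ha j)
    · exact (integral_sq_conv_rho_le hε m2).trans (integral_apply_matrix_sq_le hD q)
  rw [curlPair_vmoll hε ha hD h]
  exact abs_sum_three_sub_le (fun j => b j _) fun j => b j _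

lemma InEnergyClass.integrableOn_norm_sq (hu : InEnergyClass T u Du) :
    IntegrableOn (fun τ => ∫ x, ‖u τ x‖ ^ 2) (Ioo 0 T) := by
  have hm : MeasurableOnCylinder T fun τ x => ‖u τ x‖ ^ 2 :=
    (AEStronglyMeasurable.norm hu.measurable).pow 2
  obtain ⟨M, hM, hb⟩ := hu.exists_bound
  refine Integrable.of_bound hm.integral (M ^ 2) ?_
  filter_upwards [hb, hu.ae_memLp] with τ h1 hτ
  have h0 : (0 : ℝ) ≤ ∫ x, ‖u τ x‖ ^ 2 := integral_nonneg fun x => sq_nonneg _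
  rw [hτ.eLpNorm_eq_integral_rpow_norm (by norm_num) (by norm_num),
    ENNReal.ofReal_le_ofReal_iff hM] at h1
  simp only [ENNReal.toReal_ofNat, Real.rpow_two] at h1
  rw [Real.norm_of_nonneg h0]
  calc _ = ((∫ x, ‖u τ x‖ ^ 2) ^ (2⁻¹ : ℝ)) ^ 2 := by
        rw [← Real.rpow_natCast, ← Real.rpow_mul h0]; norm_num
    _ ≤ M ^ 2 := pow_le_pow_left₀ (Real.rpow_nonneg h0 _) h1 2

lemma exists_fourth_power_bound :
    ∃ C : ℝ, 0 ≤ C ∧ ∀ (a : Torus3 → E3) (D : Torus3 → Mat3), MemLp a 2 volume →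
      MemLp D 2 volume → IsWeakGradient a D → ∀ j,
      MemLp (fun x => a x j ^ 2) 2 volume ∧
        √(∫ x, a x j ^ 4) ≤ C * ((∫ x, ‖a x‖ ^ 2) + ∫ x, ‖D x‖ ^ 2) := by
  obtain ⟨C, hC, h⟩ := exists_sqrt_integral_pow_four_le
  refine ⟨C, hC, fun a D ha hD hg j => ?_⟩
  obtain ⟨h1, h2⟩ := h _ (fun i x => D x (i, j)) (memLp_apply ha j)
    (fun i => memLp_apply_matrix hD _) fun i => hg.hasWeakPartial i j
  refine ⟨h1, h2.trans (mul_le_mul_of_nonneg_left (add_le_add (integral_apply_sq_le ha j) ?_) hC)⟩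
  rw [integral_norm_sq_matrix hD]
  exact Finset.single_le_sum (f := fun j => ∑ i, ∫ x, D x (i, j) ^ 2)
    (fun j _ => Finset.sum_nonneg fun i _ => integral_nonneg fun x => sq_nonneg _)
    (Finset.mem_univ j)

/-- At almost every time u and h lie in H¹, so `tendsto_lorentz` applies. The majorant is the
uniform L² bound of u times the squared H¹ norm of h, since each integral is at most ‖u‖₂ (‖h_j‖₄² +
‖h_l‖₄²). -/
lemma IsWeakSolution.tendsto_integral_lorentz (hT : 0 < T) (hs : IsWeakSolution T u h)
    (hu : InEnergyClass T u Du) (hh : InEnergyClass T h Dh) {t : ℝ} (ht : t ≤ T) :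
    Tendsto (fun ε => ∫ τ in Ioo 0 t, lorentz (u τ) (h τ) (vmoll ε (h τ))) (𝓝[>] 0) (𝓝 0) := by
  obtain ⟨C, hC, hC4⟩ := exists_fourth_power_bound
  have gu := hs.weakCont_u.goodField hT hu
  have gh := hs.weakCont_h.goodField hT hh
  choose M hM hM' using fun j => (gu j).bound
  have hle : (volume.restrict (Ioo 0 t) : Measure ℝ) ≤ timeMeasure T :=
    Measure.restrict_mono (Ioo_subset_Ioo_right ht) le_rfl
  have hi : IntegrableOn (fun τ => (∫ x, ‖h τ x‖ ^ 2) + ∫ x, ‖Dh τ x‖ ^ 2) (Ioo 0 t) :=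
    (hh.integrableOn_norm_sq.add hh.integrableOn_gradient).mono_set (Ioo_subset_Ioo_right ht)
  have key := tendsto_integral_filter_of_dominated_convergence (μ := volume.restrict (Ioo 0 t))
    (l := 𝓝[>] (0 : ℝ)) (F := fun ε τ => lorentz (u τ) (h τ) (vmoll ε (h τ))) (f := fun _ => 0)
    (fun τ => 6 * ((∑ j, M j) * (2 * C)) * ((∫ x, ‖h τ x‖ ^ 2) + ∫ x, ‖Dh τ x‖ ^ 2))
    ?_ ?_ (hi.const_mul _) ?_
  · simpa using key
  · filter_upwards [self_mem_nhdsWithin] with ε hε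
    exact (twoTime_lorentz hε gu gh).diag.mono_measure hle
  · filter_upwards [self_mem_nhdsWithin] with ε hε
    filter_upwards [ae_mono hle hh.ae_memLp_gradient, ae_mono hle hh.isWeakGradient,
      ae_mono hle (ae_restrict_mem measurableSet_Ioo)] with τ mD hg hτ
    have hτ' := Ioo_subset_Icc_self hτ
    have mu := hs.weakCont_u.memLp τ hτ'
    have mh := hs.weakCont_h.memLp τ hτ'
    have h4 := hC4 _ _ mh mD hg
    have hR : 0 ≤ (∫ x, ‖h τ x‖ ^ 2) + ∫ x, ‖Dh τ x‖ ^ 2 := by positivity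
    have b : ∀ i j l, |∫ x, u τ x i * h τ x j * vmoll ε (h τ) x l| ≤
        (∑ j, M j) * (2 * C) * ((∫ x, ‖h τ x‖ ^ 2) + ∫ x, ‖Dh τ x‖ ^ 2) := by
      intro i j l
      refine (abs_integral_mul_mul_conv_le hε (memLp_apply mu i) (memLp_apply mh j)
        (memLp_apply mh l) (h4 j).1 (h4 l).1).trans ?_
      rw [mul_assoc]
      refine mul_le_mul ?_ ?_ (by positivity) (Finset.sum_nonneg fun j _ => hM j)
      · exact (Real.sqrt_le_iff.2 ⟨hM i, hM' i τ hτ'⟩).trans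
          (Finset.single_le_sum (fun j _ => hM j) (Finset.mem_univ i))
      · linarith [(h4 j).2, (h4 l).2]
    rw [mul_assoc 6, Real.norm_eq_abs]
    exact abs_sum_three_sub_le (fun l => b _ _ l) fun l => b _ _ l
  · filter_upwards [ae_mono hle hh.ae_memLp_gradient, ae_mono hle hh.isWeakGradient,
      ae_mono hle hu.ae_memLp_gradient, ae_mono hle hu.isWeakGradient,
      ae_mono hle (ae_restrict_mem measurableSet_Ioo)] with τ mDh hgh mDu hgu hτ
    have hτ' := Ioo_subset_Icc_self hτ
    have mu := hs.weakCont_u.memLp τ hτ'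
    have mh := hs.weakCont_h.memLp τ hτ'
    exact tendsto_lorentz mh fun i j => memLp_mul_of_sq (memLp_apply mu i).aestronglyMeasurable
      (memLp_apply mh j).aestronglyMeasurable (hC4 _ _ mu mDu hgu i).1 (hC4 _ _ mh mDh hgh j).1

lemma IsWeakSolution.tendsto_integral_curlPair (hT : 0 < T) (hs : IsWeakSolution T u h)
    (hh : InEnergyClass T h Dh) {t : ℝ} (ht : t ≤ T) :
    Tendsto (fun ε => ∫ τ in Ioo 0 t, curlPair (h τ) (vmoll ε (h τ))) (𝓝[>] 0)
      (𝓝 (∫ τ in Ioo 0 t, ∫ x, inner ℝ (curlOfGradient (Dh τ x)) (h τ x))) := by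
  have gh := hs.weakCont_h.goodField hT hh
  have hle : (volume.restrict (Ioo 0 t) : Measure ℝ) ≤ timeMeasure T :=
    Measure.restrict_mono (Ioo_subset_Ioo_right ht) le_rfl
  have hi : IntegrableOn (fun τ => (∫ x, ‖h τ x‖ ^ 2) + ∫ x, ‖Dh τ x‖ ^ 2) (Ioo 0 t) :=
    (hh.integrableOn_norm_sq.add hh.integrableOn_gradient).mono_set (Ioo_subset_Ioo_right ht)
  refine tendsto_integral_filter_of_dominated_convergence
    (fun τ => 6 * ((∫ x, ‖h τ x‖ ^ 2) + ∫ x, ‖Dh τ x‖ ^ 2)) ?_ ?_ (hi.const_mul _) ?_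
  · filter_upwards [self_mem_nhdsWithin] with ε hε
    exact (twoTime_curlPair hε gh).diag.mono_measure hle
  · filter_upwards [self_mem_nhdsWithin] with ε hε
    filter_upwards [ae_mono hle hh.ae_memLp, ae_mono hle hh.ae_memLp_gradient,
      ae_mono hle hh.isWeakGradient] with τ m mD hg
    exact abs_curlPair_le hε m mD hg
  · filter_upwards [ae_mono hle hh.ae_memLp, ae_mono hle hh.ae_memLp_gradient,
      ae_mono hle hh.isWeakGradient] with τ m mD hg
    exact tendsto_curlPair m mD hg

/-- The former Hall term. Its test field is now K h without a curl, so the commutator costs only ε⁻¹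
and the order 1/3 together with H¹ suffices, as for u in the energy equality. -/
lemma IsWeakSolution.tendsto_integral_transport (hs : IsWeakSolution T u h)
    (hh : InEnergyClass T h Dh) (bh : InLpBesov T 3 (1 / 3) 3 h) {t : ℝ} (ht : t ≤ T) :
    Tendsto (fun ε => ∫ τ in Ioo 0 t, transport (h τ) (h τ) (vmoll ε (h τ))) (𝓝[>] 0) (𝓝 0) := by
  obtain ⟨C, hC, hC'⟩ := exists_enorm_commTransport_le
  refine tendsto_integral_zero_of_enorm_le ht (B := fun ε τ =>
    3 * C * (ENNReal.ofReal ε⁻¹ * oscInt ε (h τ))) ?_ ?_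
  · filter_upwards [self_mem_nhdsWithin] with ε hε
    filter_upwards [ae_restrict_mem measurableSet_Ioo] with τ hτ
    have hτ' := Ioo_subset_Icc_self hτ
    have mh := hs.weakCont_h.memLp τ hτ'
    have sh := smoothVector_moll hε mh
    rw [vmoll_eq, transport_moll hε mh mh sh,
      transport_self sh ((hs.divFree_h τ hτ').divg_moll mh hε) sh, zero_add]
    exact (hC' ε hε _ _ _ mh mh mh).trans_eq (by ring)
  · have l := ENNReal.Tendsto.const_mul (a := 3 * C) (hh.tendsto_lintegral_oscInt bh)
      (Or.inr (ENNReal.mul_ne_top (by norm_num) hC))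
    rw [mul_zero] at l
    refine l.congr fun ε => ?_
    rw [lintegral_const_mul'' _ (hh.measurable.aemeasurable_oscInt.const_mul _)]

/-- The magnetic helicity balance. -/
theorem IsWeakSolution.helicity_balance (hT : 0 < T) (hs : IsWeakSolution T u h)
    (hu : InEnergyClass T u Du) (hh : InEnergyClass T h Dh) (bh : InLpBesov T 3 (1 / 3) 3 h)
    (hH : ∀ t ∈ Icc 0 T, IsCurlInverse (h t) (H t)) {t : ℝ} (ht : t ∈ Icc 0 T) :
    (∫ x, inner ℝ (h t x) (H t x)) - (∫ x, inner ℝ (h 0 x) (H 0 x))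
      + 2 * ∫ s in Ioo 0 t, ∫ x, inner ℝ (curlOfGradient (Dh s x)) (h s x) = 0 := by
  have h0 : (0 : ℝ) ∈ Icc 0 T := ⟨le_rfl, hT.le⟩
  have gu := hs.weakCont_u.goodField hT hu
  have gh := hs.weakCont_h.goodField hT hh
  have lE : ∀ s ∈ Icc 0 T, Tendsto (fun ε => ∫ x, inner ℝ (h s x) (vmoll ε (H s) x)) (𝓝[>] 0)
      (𝓝 (∫ x, inner ℝ (h s x) (H s x))) := by
    intro s hs'
    have m1 := hs.weakCont_h.memLp s hs'
    have m2 := (hH s hs').memLp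
    have e : ∫ x, inner ℝ (h s x) (H s x) = ∑ j, ∫ x, h s x j * H s x j := by
      simp only [inner_eq_sum]
      exact integral_finsetSum _ fun j _ =>
        integrable_mul_of_memLp (memLp_apply m1 j) (memLp_apply m2 j)
    rw [e]
    refine Tendsto.congr' ?_ (tendsto_finsetSum _ fun j _ =>
      tendsto_integral_conv_rho_mul_conv_rho (memLp_apply m1 j) (memLp_apply m2 j))
    filter_upwards [self_mem_nhdsWithin] with ε hε
    exact (integral_inner_vmoll hε m1 m2).symm
  have l2 := (((hs.tendsto_integral_lorentz hT hu hh ht.2).add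
    (hs.tendsto_integral_transport hh bh ht.2)).sub
    (hs.tendsto_integral_curlPair hT hh ht.2)).const_mul 2
  have e := tendsto_nhds_unique ((lE t ht).sub (lE 0 h0)) (l2.congr' ?_)
  · linarith
  filter_upwards [self_mem_nhdsWithin] with ε hε
  have i1 := (twoTime_lorentz hε gu gh).integrableOn_diag.mono_set (Ioo_subset_Ioo_right ht.2)
  have i2 := (twoTime_transport hε gh gh gh).integrableOn_diag.mono_set (Ioo_subset_Ioo_right ht.2)
  have i3 := (twoTime_curlPair hε gh).integrableOn_diag.mono_set (Ioo_subset_Ioo_right ht.2)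
  have i12 : IntegrableOn (fun τ => lorentz (u τ) (h τ) (vmoll ε (h τ))
      + transport (h τ) (h τ) (vmoll ε (h τ))) (Ioo 0 t) := i1.add i2
  rw [hs.mollified_helicity hT hu hh hH hε ht, integral_const_mul, ← integral_add i1 i2,
    ← integral_sub i12 i3]
  rfl

end HallMHD

/-! ### Towards the vector potential: Poincaré inequality and weak Neumann problem. -/

namespace HallMHD

/-! ### The Poincaré inequality -/

lemma exists_proj_eq (z : Torus3) : ∃ y : E3, proj y = z ∧ ‖y‖ ^ 2 ≤ 3 := by
  have h : ∀ i, ∃ r ∈ Ico (0 : ℝ) (0 + 1), ((r : ℝ) : UnitAddCircle) = z i := fun i => by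
    have := AddCircle.coe_image_Ico_eq (p := (1 : ℝ)) (a := 0)
    exact (this.symm ▸ mem_univ (z i) : z i ∈ ((↑) : ℝ → AddCircle (1 : ℝ)) '' Ico 0 (0 + 1))
  choose r hr hz using h
  refine ⟨WithLp.toLp 2 r, funext hz, ?_⟩
  rw [EuclideanSpace.real_norm_sq_eq]
  have : ∀ i ∈ Finset.univ, (r i) ^ 2 ≤ 1 := fun i _ => by
    have := hr i
    nlinarith [this.1, this.2]
  refine (Finset.sum_le_card_nsmul _ _ _ this).trans ?_
  simp

lemma integral_integral_sub_mul {f : Torus3 → ℝ} (hf : Continuous f) :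
    ∫ z, ∫ x, f (x - z) * f x = (∫ x, f x) ^ 2 := by
  obtain ⟨C, hC, hC'⟩ := exists_norm_le_of_continuous hf
  have hi : Integrable (Function.uncurry fun z x => f (x - z) * f x)
      ((volume : Measure Torus3).prod (volume : Measure Torus3)) := by
    refine Integrable.of_bound (Continuous.aestronglyMeasurable (by fun_prop)) (C * C)
      (Eventually.of_forall fun p => ?_)
    simp only [Function.uncurry, norm_mul]
    exact mul_le_mul (hC' _) (hC' _) (norm_nonneg _) hC
  rw [integral_integral_swap hi]
  have : ∀ x, ∫ z, f (x - z) * f x = (∫ z, f z) * f x := fun x => by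
    rw [integral_mul_const, integral_sub_left_eq_self f volume x]
  simp only [this]
  rw [integral_const_mul, sq]

/-- Average ‖f(· − z) − f‖² over all translations z: the cross term integrates to the square of the
mean, which is zero, leaving 2‖f‖², while each translation is controlled by the gradient. -/
lemma SmoothScalar.poincare {f : Torus3 → ℝ} (hf : SmoothScalar f) (h0 : ∫ x, f x = 0) :
    ∫ x, f x ^ 2 ≤ 5 * ∑ i, ∫ x, (HallMHD.pderiv i f x) ^ 2 := by
  set S := ∑ i, ∫ x, (HallMHD.pderiv i f x) ^ 2 with hS
  have hS0 : 0 ≤ S := Finset.sum_nonneg fun i _ => integral_nonneg fun x => sq_nonneg _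
  obtain ⟨C, hC, hC'⟩ := exists_norm_le_of_continuous hf.continuous
  have hc := hf.continuous
  -- One factor 3 bounds ‖y‖² for a representative in the unit cell, the other comes from the
  -- increment estimate. Averaging gives 2‖f‖² ≤ 9 S, and 5 is a convenient bound for 9/2.
  have key : ∀ z, 2 * (∫ x, f x ^ 2) - 2 * ∫ x, f (x - z) * f x ≤ 9 * S := by
    intro z
    obtain ⟨y, rfl, hy⟩ := exists_proj_eq z
    have h1 := integral_sq_sub_proj_le hf y
    have c1 : Continuous fun x => f (x - proj y) := by fun_prop
    have iz : ∀ {g : Torus3 → ℝ}, Continuous g → Integrable g := fun hg => by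
      obtain ⟨D, -, hD⟩ := exists_norm_le_of_continuous hg
      exact Integrable.of_bound hg.aestronglyMeasurable D (Eventually.of_forall hD)
    have e : ∫ x, (f (x - proj y) - f x) ^ 2 =
        (∫ x, f (x - proj y) ^ 2) + (∫ x, f x ^ 2) - 2 * ∫ x, f (x - proj y) * f x := by
      have i1 : Integrable fun x => f (x - proj y) ^ 2 := iz (c1.pow 2)
      have i2 : Integrable fun x => f x ^ 2 := iz (hc.pow 2)
      have i3 : Integrable fun x => 2 * (f (x - proj y) * f x) := (iz (c1.mul hc)).const_mul 2
      have i12 : Integrable fun x => f (x - proj y) ^ 2 + f x ^ 2 := i1.add i2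
      rw [← integral_const_mul, ← integral_add i1 i2, ← integral_sub i12 i3]
      refine integral_congr_ae (Eventually.of_forall fun x => ?_)
      simp only
      ring
    have e2 : ∫ x, f (x - proj y) ^ 2 = ∫ x, f x ^ 2 :=
      integral_sub_right_eq_self (fun x => f x ^ 2) (proj y)
    rw [e, e2] at h1
    have : ‖y‖ ^ 2 * (3 * S) ≤ 3 * (3 * S) := mul_le_mul_of_nonneg_right hy (by positivity)
    linarith
  have ii : Integrable fun z => ∫ x, f (x - z) * f x := by
    refine Integrable.of_bound ?_ (C * C) (Eventually.of_forall fun z => ?_)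
    · have : Continuous (Function.uncurry fun z x => f (x - z) * f x) := by fun_prop
      exact (this.aestronglyMeasurable (μ := (volume : Measure Torus3).prod
        (volume : Measure Torus3))).integral_prod_right'
    · refine (norm_integral_le_of_norm_le_const (C := C * C) (Eventually.of_forall fun x => ?_)).trans
        (by simp)
      rw [norm_mul]
      exact mul_le_mul (hC' _) (hC' _) (norm_nonneg _) hC
  have h2 : ∫ z, (2 * (∫ x, f x ^ 2) - 2 * ∫ x, f (x - z) * f x) ≤ ∫ _ : Torus3, 9 * S :=
    integral_mono ((integrable_const _).sub (ii.const_mul 2)) (integrable_const _) key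
  rw [integral_sub (integrable_const _) (ii.const_mul 2),
    integral_const_mul 2 fun z => ∫ x, f (x - z) * f x, integral_integral_sub_mul hc, h0] at h2
  simp at h2
  linarith

/-- Since f has mean zero, the mean of χ may be subtracted before Poincaré is applied. This makes
the functional χ ↦ ∫ f χ bounded by the gradient of χ. -/
lemma SmoothScalar.abs_integral_mul_le_of_mean_zero {f χ : Torus3 → ℝ} (hf : MemLp f 2 volume)
    (h0 : ∫ x, f x = 0) (hχ : SmoothScalar χ) :
    |∫ x, f x * χ x| ≤ √(∫ x, f x ^ 2) * √(5 * ∑ i, ∫ x, (HallMHD.pderiv i χ x) ^ 2) := by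
  set m := ∫ x, χ x with hm
  have hs := hχ.sub (SmoothScalar.const m)
  have hs0 : ∫ x, (χ x - m) = 0 := by
    rw [integral_sub hχ.integrable (integrable_const _)]
    simp [hm]
  have hd : ∀ i, HallMHD.pderiv i (fun x => χ x - m) = HallMHD.pderiv i χ := fun i => by
    rw [pderiv_sub hχ (SmoothScalar.const m), pderiv_const]
    simp
  have hp := hs.poincare hs0
  simp only [hd] at hp
  have e : ∫ x, f x * χ x = ∫ x, f x * (χ x - m) := by
    simp only [mul_sub]
    rw [integral_sub (integrable_mul_of_memLp hf (hχ.memLp 2)) ((MemLp.integrable_two hf).mul_const _),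
      integral_mul_const, h0]
    simp
  rw [e]
  exact (abs_integral_mul_le hf (hs.memLp 2)).trans
    (mul_le_mul_of_nonneg_left (Real.sqrt_le_sqrt hp) (Real.sqrt_nonneg _))

/-! ### The weak Neumann problem -/

/-- A linear functional dominated by `‖A ·‖` is represented by an element of the closure of the
range of `A`. -/
lemma exists_mem_closure_range_inner_eq {S E : Type*} [AddCommGroup S] [Module ℝ S]
    [NormedAddCommGroup E] [InnerProductSpace ℝ E] [CompleteSpace E] (A : S →ₗ[ℝ] E)
    (L : S →ₗ[ℝ] ℝ) (C : ℝ) (h : ∀ χ, |L χ| ≤ C * ‖A χ‖) :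
    ∃ G ∈ (LinearMap.range A).topologicalClosure, ∀ χ, inner ℝ G (A χ) = L χ := by
  -- A linear section of A transports L to the range of A. The choice is immaterial: the bound
  -- forces L to vanish on the kernel of A.
  obtain ⟨g, hg⟩ := A.rangeRestrict.exists_rightInverse_of_surjective
    (LinearMap.range_rangeRestrict A)
  have hg' : ∀ v, A (g v) = v := fun v => congrArg Subtype.val (LinearMap.congr_fun hg v)
  let l : LinearMap.range A →L[ℝ] ℝ := (L ∘ₗ g).mkContinuous C fun v => by
    refine (h (g v)).trans_eq ?_
    rw [hg']
    rfl
  -- Hahn–Banach extends the functional to the whole space, Riesz represents it there, and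
  -- projecting onto the closure of the range changes no pairing with the range.
  obtain ⟨k, hk, -⟩ := exists_extension_norm_eq _ l
  set K := (LinearMap.range A).topologicalClosure
  refine ⟨K.starProjection ((InnerProductSpace.toDual ℝ E).symm k), K.starProjection_apply_mem _,
    fun χ => ?_⟩
  have hmem : A χ ∈ K := Submodule.le_topologicalClosure _ (LinearMap.mem_range_self A χ)
  rw [Submodule.inner_starProjection_left_eq_right, Submodule.starProjection_eq_self_iff.2 hmem,
    InnerProductSpace.toDual_symm_apply]
  have h1 := hk ⟨A χ, LinearMap.mem_range_self A χ⟩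
  have h2 := h (g ⟨A χ, LinearMap.mem_range_self A χ⟩ - χ)
  rw [map_sub, map_sub, hg', sub_self, norm_zero, mul_zero] at h2
  have h3 := abs_nonpos_iff.1 h2
  rw [h1]
  exact sub_eq_zero.1 h3

/-- The classical gradient. -/
noncomputable def grad (χ : Torus3 → ℝ) (x : Torus3) : E3 :=
  WithLp.toLp 2 fun i => pderiv i χ x

lemma smoothVector_grad {χ : Torus3 → ℝ} (hχ : SmoothScalar χ) : SmoothVector (grad χ) :=
  smoothVector_iff.2 fun i => hχ.pderiv i

lemma SmoothVector.memLp {F : Torus3 → E3} (hF : SmoothVector F) : MemLp F 2 volume :=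
  MemLp.of_eval_piLp fun i => (hF.apply i).memLp 2

/-- The space of smooth scalar functions. -/
def smoothSubmodule : Submodule ℝ (Torus3 → ℝ) where
  carrier := {χ | SmoothScalar χ}
  add_mem' h h' := SmoothScalar.add h h'
  zero_mem' := SmoothScalar.const 0
  smul_mem' c _ h := (SmoothScalar.const c).mul h

/-- The gradient as a linear map from smooth functions to `L²`. -/
noncomputable def gradLp : smoothSubmodule →ₗ[ℝ] Lp E3 2 (volume : Measure Torus3) where
  toFun χ := (smoothVector_grad χ.2).memLp.toLp _
  map_add' χ χ' := by
    rw [← MemLp.toLp_add]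
    refine MemLp.toLp_congr _ _ (Eventually.of_forall fun x => ?_)
    ext i
    exact congrFun (pderiv_add χ.2 χ'.2 i) x
  map_smul' c χ := by
    rw [RingHom.id_apply, ← MemLp.toLp_const_smul]
    refine MemLp.toLp_congr _ _ (Eventually.of_forall fun x => ?_)
    ext i
    exact congrFun (pderiv_const_mul c χ.1 i) x

lemma inner_toLp {F G : Torus3 → E3} (hF : MemLp F 2 volume) (hG : MemLp G 2 volume) :
    inner ℝ (hF.toLp F) (hG.toLp G) = ∑ i, ∫ x, F x i * G x i := by
  rw [L2.inner_def, ← integral_finsetSum _ fun i _ =>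
    integrable_mul_of_memLp (memLp_apply hF i) (memLp_apply hG i)]
  refine integral_congr_ae ?_
  filter_upwards [hF.coeFn_toLp, hG.coeFn_toLp] with x h1 h2
  rw [h1, h2, inner_eq_sum]

/-- For `f ∈ L²` with mean zero there is a limit `G` of gradients with `-div G = f`. -/
lemma exists_weak_neumann {f : Torus3 → ℝ} (hf : MemLp f 2 volume) (h0 : ∫ x, f x = 0) :
    ∃ G : Torus3 → E3, MemLp G 2 volume ∧
      (∀ χ, SmoothScalar χ → ∑ i, ∫ x, G x i * pderiv i χ x = ∫ x, f x * χ x) ∧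
      ∀ w : Torus3 → E3, SmoothVector w →
        (∀ χ, SmoothScalar χ → ∑ i, ∫ x, w x i * pderiv i χ x = 0) →
        ∑ i, ∫ x, G x i * w x i = 0 := by
  let L : smoothSubmodule →ₗ[ℝ] ℝ :=
    { toFun := fun χ => ∫ x, f x * χ.1 x
      map_add' := fun χ χ' => by
        rw [← integral_add (integrable_mul_of_memLp hf (SmoothScalar.memLp χ.2 2))
          (integrable_mul_of_memLp hf (SmoothScalar.memLp χ'.2 2))]
        simp only [← mul_add]
        rfl
      map_smul' := fun c χ => by
        rw [RingHom.id_apply, smul_eq_mul, ← integral_const_mul]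
        simp only [mul_left_comm c]
        rfl }
  obtain ⟨G, hG, hG'⟩ := exists_mem_closure_range_inner_eq gradLp L
    (√(∫ x, f x ^ 2) * √5) fun χ => by
      refine (SmoothScalar.abs_integral_mul_le_of_mean_zero hf h0 χ.2).trans_eq ?_
      rw [Real.sqrt_mul (by norm_num), ← mul_assoc, @norm_eq_sqrt_real_inner]
      congr 2
      refine Eq.trans ?_ (inner_toLp (smoothVector_grad χ.2).memLp (smoothVector_grad χ.2).memLp).symm
      simp only [sq]
      rfl
  have mG := Lp.memLp G
  have eG : mG.toLp G = G := Lp.toLp_coeFn G mG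
  refine ⟨G, mG, fun χ hχ => ?_, fun w hw h => ?_⟩
  · refine (inner_toLp mG (smoothVector_grad hχ).memLp).symm.trans ?_
    rw [eG]
    exact hG' ⟨χ, hχ⟩
  · rw [← inner_toLp mG hw.memLp, eG, real_inner_comm]
    -- A weakly divergence-free field is orthogonal to all smooth gradients, hence to their closure,
    -- where G lies.
    have hperp : hw.memLp.toLp w ∈ (LinearMap.range gradLp)ᗮ := by
      rw [Submodule.mem_orthogonal']
      rintro _ ⟨χ, rfl⟩
      exact (inner_toLp hw.memLp (smoothVector_grad χ.2).memLp).trans (h χ.1 χ.2)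
    rw [← Submodule.orthogonal_closure, Submodule.mem_orthogonal'] at hperp
    exact hperp G hG

/-- Weakly harmonic functions with mean zero vanish. -/
lemma eq_zero_of_weakly_harmonic {g : Torus3 → ℝ} (hg : MemLp g 2 volume) (h0 : ∫ x, g x = 0)
    (h : ∀ χ, SmoothScalar χ → ∑ i, ∫ x, g x * pderiv i (pderiv i χ) x = 0) : g =ᵐ[volume] 0 := by
  have hz : ∀ ε, 0 < ε → ∫ x, conv (rho ε) g x * conv (rho ε) g x = 0 := by
    intro ε hε
    have hk := isKernel_rho hε
    have hi := MemLp.integrable_two hg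
    have hs := hk.smooth_conv hi
    -- Testing with the twice mollified g makes the squared gradient norm of g^ε vanish; Poincaré
    -- then gives g^ε = 0 in L².
    have h1 := h _ (hk.smooth_conv hs.integrable)
    have e : ∀ i, ∫ x, g x * pderiv i (pderiv i (conv (rho ε) (conv (rho ε) g))) x =
        - ∫ x, (pderiv i (conv (rho ε) g) x) ^ 2 := fun i => by
      rw [hk.conv_pderiv hs, hk.conv_pderiv (hs.pderiv i),
        ← ((hs.pderiv i).pderiv i).conv_rho_comm hε hi, integral_mul_pderiv hs (hs.pderiv i)]
      simp only [sq]
    simp only [e, Finset.sum_neg_distrib, neg_eq_zero] at h1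
    have h2 := hs.poincare (by rw [integral_conv_rho hε hi, h0])
    rw [h1, mul_zero] at h2
    have h3 : 0 ≤ ∫ x, conv (rho ε) g x ^ 2 := integral_nonneg fun x => sq_nonneg _
    simpa only [sq] using le_antisymm h2 h3
  have hl := tendsto_integral_conv_rho_mul_conv_rho hg hg
  have h2 : ∫ x, g x * g x = 0 := by
    refine tendsto_nhds_unique hl (tendsto_const_nhds.congr' ?_)
    filter_upwards [self_mem_nhdsWithin] with ε hε using (hz ε hε).symm
  have h3 := (integral_eq_zero_iff_of_nonneg (fun x => mul_self_nonneg (g x))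
    (integrable_mul_of_memLp hg hg)).1 h2
  filter_upwards [h3] with x hx
  simpa using hx

end HallMHD

namespace HallMHD

/-! ### Existence of the vector potential -/

lemma sum_integral_mul_ite_sub_ite {F : Torus3 → E3} (hF : MemLp F 2 volume) {p q : Torus3 → ℝ}
    (hp : SmoothScalar p) (hq : SmoothScalar q) (i k : Fin 3) :
    ∑ l, ∫ x, F x l * ((if l = i then p x else 0) - (if l = k then q x else 0)) =
      (∫ x, F x i * p x) - ∫ x, F x k * q x := by
  have h : ∀ l, ∫ x, F x l * ((if l = i then p x else 0) - (if l = k then q x else 0)) =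
      (if l = i then ∫ x, F x l * p x else 0) - (if l = k then ∫ x, F x l * q x else 0) := by
    intro l
    have h1 := integrable_mul_of_memLp (memLp_apply hF l) (hp.memLp 2)
    have h2 := integrable_mul_of_memLp (memLp_apply hF l) (hq.memLp 2)
    simp only [mul_sub, mul_ite, mul_zero]
    rw [integral_sub (by split_ifs <;> simp [h1]) (by split_ifs <;> simp [h2])]
    congr 1 <;> split_ifs <;> simp
  simp only [h, Finset.sum_sub_distrib, Finset.sum_ite_eq', Finset.mem_univ, if_true]

/-- G j plays the role of ∇N_j with −ΔN_j = a_j, and H = curl N. Then div H = 0 because the G j are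
curl-free, and curl H = −ΔN + ∇ div N = a once the trace Σ G_jj = div N is shown to vanish. -/
lemma exists_isCurlInverse {a : Torus3 → E3} (ha : MemLp a 2 volume) (hd : WeakDivFree a)
    (h0 : ∀ j, ∫ x, a x j = 0) : ∃ H, IsCurlInverse a H := by
  choose G mG h1 h2 using fun j => exists_weak_neumann (memLp_apply ha j) (h0 j)
  -- Orthogonality of G j to the weakly divergence-free field p eᵢ − q e_k; the next two facts are
  -- special choices of p and q.
  have h3 : ∀ j i k {p q : Torus3 → ℝ}, SmoothScalar p → SmoothScalar q →
      (∀ χ, SmoothScalar χ → ∫ x, pderiv i χ x * p x = ∫ x, pderiv k χ x * q x) →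
      ∫ x, G j x i * p x = ∫ x, G j x k * q x := by
    intro j i k p q hp hq h
    have e := h2 j (fun x => WithLp.toLp 2 fun l =>
      (if l = i then p x else 0) - (if l = k then q x else 0)) (smoothVector_iff.2 fun l => ?_)
      fun χ hχ => ?_
    · have := sum_integral_mul_ite_sub_ite (mG j) hp hq i k
      simp only at e
      linarith
    · refine SmoothScalar.sub ?_ ?_
      · by_cases hl : l = i
        · simpa [hl] using hp
        · simpa [hl] using SmoothScalar.const 0
      · by_cases hl : l = k
        · simpa [hl] using hq
        · simpa [hl] using SmoothScalar.const 0
    · have := sum_integral_mul_ite_sub_ite (smoothVector_grad hχ).memLp hp hq i k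
      simp only [mul_comm _ (pderiv _ χ _)]
      refine this.trans (sub_eq_zero.2 (h χ hχ))
  -- With p = ∂_kχ and q = ∂ᵢχ: each G j is curl-free in the weak sense.
  have hcomm : ∀ j i k {χ : Torus3 → ℝ}, SmoothScalar χ →
      ∫ x, G j x i * pderiv k χ x = ∫ x, G j x k * pderiv i χ x := by
    intro j i k χ hχ
    refine h3 j i k (hχ.pderiv k) (hχ.pderiv i) fun η hη => ?_
    rw [integral_mul_pderiv (hη.pderiv i) hχ, integral_mul_pderiv (hη.pderiv k) hχ, pderiv_comm hη]
  -- With p = 1 and q = 0: a limit of gradients has mean zero.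
  have hmean : ∀ j i, ∫ x, G j x i = 0 := by
    intro j i
    have := h3 j i i (SmoothScalar.const 1) (SmoothScalar.const 0) fun χ hχ => by
      simp [integral_pderiv hχ]
    simpa using this
  have hint : ∀ j i {p : Torus3 → ℝ}, SmoothScalar p → Integrable fun x => G j x i * p x :=
    fun j i p hp => integrable_mul_of_memLp (memLp_apply (mG j) i) (hp.memLp 2)
  -- Against Δχ the trace becomes, after exchanging indices by `hcomm`, the pairing Σ ∫ a_j ∂_jχ,
  -- which is zero since a is divergence-free. So the trace is weakly harmonic with mean zero.
  have htrace : (fun x => ∑ j, G j x j) =ᵐ[volume] 0 := by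
    refine eq_zero_of_weakly_harmonic (memLp_finsetSum _ fun j _ => memLp_apply (mG j) j) ?_
      fun χ hχ => ?_
    · rw [integral_finsetSum _ fun j _ => MemLp.integrable_two (memLp_apply (mG j) j)]
      simp [hmean]
    · have e1 : ∀ i, ∫ x, (∑ j, G j x j) * pderiv i (pderiv i χ) x =
          ∑ j, ∫ x, G j x i * pderiv i (pderiv j χ) x := by
        intro i
        simp only [Finset.sum_mul]
        rw [integral_finsetSum _ fun j _ => hint j j ((hχ.pderiv i).pderiv i)]
        refine Finset.sum_congr rfl fun j _ => ?_
        rw [hcomm j j i (hχ.pderiv i), pderiv_comm hχ]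
      simp only [e1]
      rw [Finset.sum_comm]
      have e2 : ∀ j, ∑ i, ∫ x, G j x i * pderiv i (pderiv j χ) x = ∫ x, a x j * pderiv j χ x :=
        fun j => h1 j _ (hχ.pderiv j)
      simp only [e2]
      rw [← integral_finsetSum _ fun j _ =>
        integrable_mul_of_memLp (memLp_apply ha j) ((hχ.pderiv j).memLp 2)]
      exact hd χ hχ
  have htr : ∀ {p : Torus3 → ℝ}, SmoothScalar p → ∑ j, ∫ x, G j x j * p x = 0 := by
    intro p hp
    rw [← integral_finsetSum _ fun j _ => hint j j hp]
    refine integral_eq_zero_of_ae ?_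
    filter_upwards [htrace] with x hx
    simp only [Pi.zero_apply] at hx
    rw [← Finset.sum_mul, hx, zero_mul, Pi.zero_apply]
  have mH : MemLp (fun x => WithLp.toLp 2 fun j => G (j + 2) x (j + 1) - G (j + 1) x (j + 2) :
      Torus3 → E3) 2 volume :=
    MemLp.of_eval_piLp fun j => (memLp_apply (mG _) _).sub (memLp_apply (mG _) _)
  refine ⟨_, mH, ?_, fun χ hχ => ?_, fun ψ hψ => ?_⟩
  · ext j
    have hi := MemLp.integrable_two (memLp_apply mH j)
    have e := (EuclideanSpace.proj j : E3 →L[ℝ] ℝ).integral_comp_comm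
      (mH.integrable (by norm_num))
    refine e.symm.trans ?_
    change ∫ x, (G (j + 2) x (j + 1) - G (j + 1) x (j + 2)) = 0
    rw [integral_sub (MemLp.integrable_two (memLp_apply (mG _) _))
      (MemLp.integrable_two (memLp_apply (mG _) _)), hmean, hmean, sub_zero]
  · have hp := fun k => hχ.pderiv k
    rw [integral_finsetSum _ fun j _ =>
      integrable_mul_of_memLp (memLp_apply mH j) ((hp j).memLp 2)]
    have e : ∀ j, ∫ x, (G (j + 2) x (j + 1) - G (j + 1) x (j + 2)) * pderiv j χ x =
        (∫ x, G (j + 2) x (j + 1) * pderiv j χ x) - ∫ x, G (j + 1) x (j + 2) * pderiv j χ x := by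
      intro j
      simp only [sub_mul]
      exact integral_sub (hint _ _ (hp j)) (hint _ _ (hp j))
    simp only [e, Fin.sum_univ_three, Fin.isValue, zero_add,
      show (1 : Fin 3) + 1 = 2 from rfl, show (1 : Fin 3) + 2 = 0 from rfl,
      show (2 : Fin 3) + 1 = 0 from rfl, show (2 : Fin 3) + 2 = 1 from rfl]
    rw [hcomm 2 1 0 hχ, hcomm 1 2 0 hχ, hcomm 0 2 1 hχ]
    ring
  · have hp := fun k l => (hψ.apply l).pderiv k
    simp only [inner_eq_sum]
    rw [integral_finsetSum _ fun j _ =>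
      integrable_mul_of_memLp (memLp_apply mH j) ((hψ.curl.apply j).memLp 2),
      integral_finsetSum _ fun j _ =>
      integrable_mul_of_memLp (memLp_apply ha j) ((hψ.apply j).memLp 2)]
    have e : ∀ j i m n k l p q, ∫ x, (G j x i - G m x n) *
        (pderiv k (fun y => ψ y l) x - pderiv p (fun y => ψ y q) x) =
        (∫ x, G j x i * pderiv k (fun y => ψ y l) x) - (∫ x, G m x n * pderiv k (fun y => ψ y l) x)
        - ((∫ x, G j x i * pderiv p (fun y => ψ y q) x)
          - ∫ x, G m x n * pderiv p (fun y => ψ y q) x) := by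
      intro j i m n k l p q
      have i2 : ∀ k l, Integrable fun x => G j x i * pderiv k (fun y => ψ y l) x
          - G m x n * pderiv k (fun y => ψ y l) x := fun k l =>
        (hint _ _ (hp k l)).sub (hint _ _ (hp k l))
      simp only [sub_mul, mul_sub]
      rw [integral_sub (i2 _ _) (i2 _ _), integral_sub (hint _ _ (hp _ _)) (hint _ _ (hp _ _)),
        integral_sub (hint _ _ (hp _ _)) (hint _ _ (hp _ _))]
    have f := fun j => h1 j _ (hψ.apply j)
    have g := fun k => htr (hp k k)
    have f0 := f 0
    have f1 := f 1
    have f2 := f 2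
    have g0 := g 0
    have g1 := g 1
    have g2 := g 2
    simp only [curl_apply, e, Fin.sum_univ_three, Fin.isValue, zero_add,
      show (1 : Fin 3) + 1 = 2 from rfl, show (1 : Fin 3) + 2 = 0 from rfl,
      show (2 : Fin 3) + 1 = 0 from rfl, show (2 : Fin 3) + 2 = 1 from rfl] at f0 f1 f2 g0 g1 g2 ⊢
    have c := fun j i k l => hcomm j i k (hψ.apply l)
    rw [c 2 1 2 1, c 1 2 1 2, c 0 2 0 2, c 2 0 2 0, c 1 0 1 0, c 0 1 0 1]
    linarith

/-! ### Conservation of the mean -/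

/-- A constant field is an admissible test field, and every term on the right of the induction
equation carries a derivative of it. -/
lemma IsWeakSolution.integral_apply_eq {T : ℝ} {u h : ℝ → Torus3 → E3} {Du Dh : ℝ → Torus3 → Mat3}
    (hT : 0 < T) (hs : IsWeakSolution T u h) (hu : InEnergyClass T u Du)
    (hh : InEnergyClass T h Dh) {t : ℝ} (ht : t ∈ Icc 0 T) (j : Fin 3) :
    ∫ x, h t x j = ∫ x, h 0 x j := by
  have hψ : SmoothVector fun _ => EuclideanSpace.single j (1 : ℝ) := contDiff_const
  have hc : curl (fun _ => EuclideanSpace.single j (1 : ℝ)) = fun _ => 0 := by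
    funext x
    ext i
    simp [curl_apply, pderiv_const]
  have h := hs.induction_sub hT hu hh hψ (fun x => by simp [divg, pderiv_const]) ht ⟨le_rfl, hT.le⟩
  simp [transport, diffusion, hc, pderiv_const, EuclideanSpace.inner_single_right] at h
  linarith

theorem IsWeakSolution.exists_isCurlInverse {T : ℝ} {u h : ℝ → Torus3 → E3}
    {Du Dh : ℝ → Torus3 → Mat3} (hT : 0 < T) (hs : IsWeakSolution T u h)
    (hu : InEnergyClass T u Du) (hh : InEnergyClass T h Dh) (h0 : ∫ x, h 0 x = 0) {t : ℝ}
    (ht : t ∈ Icc 0 T) : ∃ H, IsCurlInverse (h t) H := by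
  refine HallMHD.exists_isCurlInverse (hs.weakCont_h.memLp t ht) (hs.divFree_h t ht) fun j => ?_
  rw [hs.integral_apply_eq hT hu hh ht j]
  have e := (EuclideanSpace.proj j : E3 →L[ℝ] ℝ).integral_comp_comm
    ((hs.weakCont_h.memLp 0 ⟨le_rfl, hT.le⟩).integrable (by norm_num))
  refine e.trans ?_
  rw [h0, map_zero]

end HallMHD

/-! ### The two balances together. -/

theorem mainTheorem6 (T : ℝ) (hT : 0 < T)
    (u h : ℝ → HallMHD.Torus3 → HallMHD.E3) (Du Dh : ℝ → HallMHD.Torus3 → HallMHD.Mat3)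
    (hu : HallMHD.InEnergyClass T u Du) (hh : HallMHD.InEnergyClass T h Dh)
    (hsol : HallMHD.IsWeakSolution T u h) :
    (HallMHD.InLpBesov T 3 (1 / 3) 3 u → HallMHD.InLpBesovVMO T 3 (2 / 3) 3 h →
      ∀ t ∈ Icc 0 T,
        ((1 / 2) * ∫ x, (‖u t x‖ ^ 2 + ‖h t x‖ ^ 2))
          + (∫ s in Ioo 0 t, ∫ x, (‖Du s x‖ ^ 2 + ‖Dh s x‖ ^ 2))
        = (1 / 2) * ∫ x, (‖u 0 x‖ ^ 2 + ‖h 0 x‖ ^ 2)) ∧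
    (HallMHD.InLpBesov T 3 (1 / 3) 3 h → (∫ x, h 0 x) = 0 →
      (∀ t ∈ Icc 0 T, ∃ H : HallMHD.Torus3 → HallMHD.E3, HallMHD.IsCurlInverse (h t) H) ∧
      ∀ H : ℝ → HallMHD.Torus3 → HallMHD.E3,
        (∀ t ∈ Icc 0 T, HallMHD.IsCurlInverse (h t) (H t)) →
        ∀ t ∈ Icc 0 T,
          (∫ x, inner ℝ (h t x) (H t x)) - (∫ x, inner ℝ (h 0 x) (H 0 x))
            + 2 * ∫ s in Ioo 0 t, ∫ x,
                inner ℝ (HallMHD.curlOfGradient (Dh s x)) (h s x) = 0) :=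
  ⟨fun bu bh _ ht => hsol.energy_equality hT hu hh bu bh ht,
    fun bh h0 => ⟨fun _ ht => hsol.exists_isCurlInverse hT hu hh h0 ht,
      fun _ hH _ ht => hsol.helicity_balance hT hu hh bh hH ht⟩⟩
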